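/- **Setting.** A program of hybrid active objects consists of classes and a main block. A class has fields, some of them physical with an autonomous explicit ODE $f'=e$, initial values, a constructor with a creation condition $\mathsf{pre}_C$ on its parameters, an object invariant $I_C$ on its fields, and methods $C.m$ with a precondition $\mathsf{pre}_{C.m}$ on the parameters and a postcondition $\mathsf{post}_{C.m}$ on the fields and the result. Statements are $\mathtt{skip}$, sequence, $\mathtt{if}$, $\mathtt{while}$, suspension $\mathtt{await}\ g$ with $g$ of the form $e?$, $\mathtt{duration}(e)$ or $\mathtt{diff}\ e$, blocking time advance $\mathtt{duration}(e)$, and assignments of expressions, $\mathtt{new}\ C(\bar e)$, $e.\mathtt{get}$ and asynchronous calls $e!m(\bar e)$. Differential guards $\mathtt{diff}\ e$ are built with $\wedge,\vee$ from weak inequalities between continuous expressions. A fixed procedure selects, for each class and each field store, a solution of the ODE on $[0,\infty)$. The runtime semantics is the usual one: at most one active process per object, no preemption, message passing with futures; time advances only if no discrete step is possible, by the least time after which a suspended process of an idle object can be scheduled or a blocking $\mathtt{duration}$ is over (a blocking $\mathtt{duration}$ with a negative argument never ends); the physical fields follow the selected solution. A run is a maximal reduction sequence from the initial configuration. **Safety.**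 A class $C$ is *safe* in a program if, in every run that is not time-convergent and in which every process terminates: $I_C$ holds for each object of $C$ whenever the object is inactive, and in every state that it passes through while time advances; $\mathsf{pre}_{C.m}$ holds for every call of $C.m$; and $\mathsf{post}_{C.m}$ holds whenever a process of $C.m$ terminates. A program is safe if all its classes are. **Verification with basic regions.** In differential dynamic logic, let $\mathsf{pr}(\psi) = I_C\wedge[t:=0;\{\mathsf{ode}_C,t'=1\,\&\,\psi\}]I_C$, let $\mathsf{fail}$ be $\mathsf{cll}:=1$, let $\mathsf{havoc}$ and $\mathsf{havoc}^{\mathsf{ph}}$ assign arbitrary values to all fields and to all physical fields, and let $\widetilde\neg$ be negation that merely reverses weak inequalities. Statements are translated as follows: $\mathtt{skip}$, sequence, branching, loops and side-effect free assignments are translated homomorphically, and $\mathtt{return}\ e$ becomes $\mathsf{result}:=e$; - $v=e!m(\bar e)$ and $v=\mathtt{new}\ D(\bar e)$ become $(?\varphi\cup(?\neg\varphi;\mathsf{fail}));v:=*$, with $\varphi$ the precondition of the called method, respectively the creation condition of $D$, for the arguments; - $v=e.\mathtt{get}$ becomes $(?\mathsf{pr}(\mathsf{true});\mathsf{havoc}^{\mathsf{ph}};?I_C;v:=*)\cup(?\neg\mathsf{pr}(\mathsf{true});\mathsf{fail};\mathsf{havoc}^{\mathsf{ph}};v:=*)$;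 - $\mathtt{await}\ \mathtt{diff}\ e$ becomes $(?\mathsf{pr}(\widetilde\neg e);\mathsf{havoc};?(e\wedge(I_C\vee\mathsf{cll}\doteq1)))\cup(?\neg\mathsf{pr}(\widetilde\neg e);\mathsf{fail};\mathsf{havoc};?e)$, and for every other guard the same with both $e$ and $\widetilde\neg e$ replaced by $\mathsf{true}$; - $\mathtt{duration}(e)$ becomes $t:=0;(?\varphi\cup(?\neg\varphi;\mathsf{fail}));t:=0;\{\mathsf{ode}_C,t'=1\,\&\,t\le e\};?\,t\ge e$ with $\varphi=\mathsf{pr}(t\le e)$. The proof obligations are - for each method $C.m$: $I_C\wedge\mathsf{pre}_{C.m}\wedge\mathsf{cll}\doteq0\to[\mathsf{trans}(s_{C.m})](\mathsf{cll}\doteq0\wedge\mathsf{post}_{C.m}\wedge\mathsf{pr}(\mathsf{true}))$, where $s_{C.m}$ is the body including the final $\mathtt{return}$; - for each constructor: $\mathsf{pre}_C\wedge\mathsf{cll}\doteq0\to[\mathsf{trans}(s_{C.\mathrm{init}})](\mathsf{cll}\doteq0\wedge\mathsf{pr}(\mathsf{true}))$, where $s_{C.\mathrm{init}}$ first gives the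 fields their initial values; - for the main block: $\mathsf{cll}\doteq0\to[\mathsf{trans}(s_{\mathrm{main}})]\mathsf{cll}\doteq0$. A class is *verified* if the obligations of its constructor and of all its methods are valid; a program is *verified* if all its classes are verified and the obligation of its main block is valid. **Lemma.** Let $P$ be a program, $C$ a class of $P$ and $m$ a method name. 1. *(Removal.)* Let $P^-$ be $P$ with the method $m$ removed from $C$ and all calls of $C.m$, in any class and in the main block, replaced by $\mathtt{skip}$. Every class that is verified in $P$ (in particular $C$) is verified in $P^-$. If $P$ is verified, then $P^-$ is verified and safe. 2. *(Addition.)* Let $C$ have no method $m$, let no code of $P$ call $C.m$, and let $P^+$ be $P$ with a method $m$ added to $C$ (its body may contain any calls). If the proof obligation of $C.m$ in $P^+$ is valid, then every class that is verified in $P$ is verified in $P^+$, and if $P$ is verified, then $P^+$ is verified and safe. 3. *(Addition with new callers.)* Let $C$ have no method $m$, and let $P'$ result from $P$ by adding a method $m$ to $C$ and by changing the code of methods, constructors and the main block such that every changed piece of code calls $C.m$, while fields, dynamics, invariants, signatures and contracts are kept. Let the proof obligation of $C.m$ in $P'$ be valid. If a class is verified in $P$ and the obligations in $P'$ of those of its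 methods and of its constructor that call $C.m$ are valid, then the class is verified in $P'$. If $P$ is verified and the obligations in $P'$ of all methods, constructors and of the main block that call $C.m$ are valid, then $P'$ is verified and safe. -/

import Mathlib

/-! # Expressions -/

/-- Arithmetic expressions over variables from `V`, with real literals. They serve both as the
expressions of the programming language and as the terms of the logic. -/
inductive Expr (V : Type) : Type
  | const (r : ℝ)
  | var (x : V)
  | neg (a : Expr V)
  | plus (a b : Expr V)
  | minus (a b : Expr V)
  | times (a b : Expr V)
  | over (a b : Expr V)

noncomputable def Expr.eval {V : Type} (σ : V → ℝ) : Expr V → ℝ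
  | .const r => r
  | .var x => σ x
  | .neg a => - a.eval σ
  | .plus a b => a.eval σ + b.eval σ
  | .minus a b => a.eval σ - b.eval σ
  | .times a b => a.eval σ * b.eval σ
  | .over a b => a.eval σ / b.eval σ

def Expr.rename {V W : Type} (f : V → W) : Expr V → Expr W
  | .const r => .const r
  | .var x => .var (f x)
  | .neg a => .neg (a.rename f)
  | .plus a b => .plus (a.rename f) (b.rename f)
  | .minus a b => .minus (a.rename f) (b.rename f)
  | .times a b => .times (a.rename f) (b.rename f)
  | .over a b => .over (a.rename f) (b.rename f)

/-- Boolean expressions. -/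
inductive BExpr (V : Type) : Type
  | tt
  | le (a b : Expr V)
  | ge (a b : Expr V)
  | and (a b : BExpr V)
  | or (a b : BExpr V)
  | not (a : BExpr V)

def BExpr.holds {V : Type} (σ : V → ℝ) : BExpr V → Prop
  | .tt => True
  | .le a b => a.eval σ ≤ b.eval σ
  | .ge a b => b.eval σ ≤ a.eval σ
  | .and a b => a.holds σ ∧ b.holds σ
  | .or a b => a.holds σ ∨ b.holds σ
  | .not a => ¬ a.holds σ

/-- Weak negation: negation pushed to the atoms, where the weak inequalities are merely reversed. -/
def BExpr.weakNeg {V : Type} : BExpr V → BExpr V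
  | .tt => .not .tt
  | .le a b => .ge a b
  | .ge a b => .le a b
  | .and a b => .or a.weakNeg b.weakNeg
  | .or a b => .and a.weakNeg b.weakNeg
  | .not a => a

/-- Only weak inequalities between continuous expressions occur (so that event boundaries exist). -/
def BExpr.IsWeak {V : Type} : BExpr V → Prop
  | .tt => True
  | .le a b => Continuous (fun σ : V → ℝ => a.eval σ) ∧ Continuous (fun σ : V → ℝ => b.eval σ)
  | .ge a b => Continuous (fun σ : V → ℝ => a.eval σ) ∧ Continuous (fun σ : V → ℝ => b.eval σ)
  | .and a b => a.IsWeak ∧ b.IsWeak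
  | .or a b => a.IsWeak ∧ b.IsWeak
  | .not _ => False

/-! # Syntax of hybrid active objects

A class with `n` fields refers to them by `Fin n`; local variables, method names and program points
are natural numbers; class names are taken from a type `K`. The parameters of a method or of a
constructor are its first local variables. All values are real numbers; object identities and
futures are natural numbers, embedded in the reals. -/

/-- Variables that a process on an object with `n` fields can read. -/
inductive PVar (n : ℕ) : Type
  | field (i : Fin n)
  | loc (x : ℕ)
  | this
  deriving DecidableEq

/-- Locations that a process can assign. -/
inductive Lhs (n : ℕ) : Type
  | field (i : Fin n)
  | loc (x : ℕ)

def Lhs.toPVar {n : ℕ} : Lhs n → PVar n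
  | .field i => .field i
  | .loc x => .loc x

/-- Guards `e?`, `duration(e)`, `diff e`. -/
inductive Guard (n : ℕ) : Type
  | fut (e : Expr (PVar n))
  | duration (e : Expr (PVar n))
  | diff (b : BExpr (PVar n))

/-- Right-hand sides `e`, `new C(args)`, `e.get`, `e!m(args)`. In a call, `C` is the static class of
the callee `e`, so that the called method is `C.m`. -/
inductive Rhs (K : Type) (n : ℕ) : Type
  | expr (e : Expr (PVar n))
  | new (C : K) (args : List (Expr (PVar n)))
  | get (e : Expr (PVar n))
  | call (e : Expr (PVar n)) (C : K) (m : ℕ) (args : List (Expr (PVar n)))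

inductive Stmt (K : Type) (n : ℕ) : Type
  | skip
  | seq (s₁ s₂ : Stmt K n)
  | ite (b : BExpr (PVar n)) (s₁ s₂ : Stmt K n)
  | loop (b : BExpr (PVar n)) (s : Stmt K n)
  | await (p : ℕ) (g : Guard n)
  | assign (x : Option (Lhs n)) (r : Rhs K n)
  | duration (e : Expr (PVar n))

/-- A method: number of parameters, body, returned expression, and contract. The precondition
speaks about the parameters, the postcondition about the fields and the returned value. -/
structure MethDecl (K : Type) (n : ℕ) where
  arity : ℕ
  body : Stmt K n
  ret : Expr (PVar n)
  pre : (Fin arity → ℝ) → Prop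
  post : (Fin n → ℝ) → ℝ → Prop

/-- A class: the ODE `f' = e` of each physical field (`none` for the non-physical ones), number of
constructor parameters, initial value of each field, constructor block, creation condition, object
invariant, and methods. -/
structure ClassDecl (K : Type) (n : ℕ) where
  ode : Fin n → Option (Expr (Fin n))
  arity : ℕ
  init : Fin n → Expr (Fin arity)
  ctor : Stmt K n
  pre : (Fin arity → ℝ) → Prop
  inv : (Fin n → ℝ) → Prop
  meths : ℕ → Option (MethDecl K n)

/-- A program: its classes, where class `C` has `nf C` fields, and its main block. -/
structure Prog (K : Type) (nf : K → ℕ) where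
  cls : (C : K) → ClassDecl K (nf C)
  main : Stmt K 0

/-- The number of fields, where `none` is the special class of the main block. -/
def nfo {K : Type} (nf : K → ℕ) : Option K → ℕ
  | none => 0
  | some C => nf C

/-- All classes, including the special class whose constructor is the main block: it has no fields,
no methods and a trivial specification. -/
def Prog.decl {K : Type} {nf : K → ℕ} (P : Prog K nf) : (C : Option K) → ClassDecl K (nfo nf C)
  | none =>
    { ode := fun _ => none
      arity := 0
      init := fun _ => .const 0
      ctor := P.main
      pre := fun _ => True
      inv := fun _ => True
      meths := fun _ => none }
  | some C => P.cls C

/-- Every differential guard in the statement uses only weak inequalities. -/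
def Stmt.GuardsWeak {K : Type} {n : ℕ} : Stmt K n → Prop
  | .seq s₁ s₂ => s₁.GuardsWeak ∧ s₂.GuardsWeak
  | .ite _ s₁ s₂ => s₁.GuardsWeak ∧ s₂.GuardsWeak
  | .loop _ s => s.GuardsWeak
  | .await _ (.diff b) => b.IsWeak
  | _ => True

def Prog.GuardsWeak {K : Type} {nf : K → ℕ} (P : Prog K nf) : Prop :=
  P.main.GuardsWeak ∧
  ∀ C, (P.cls C).ctor.GuardsWeak ∧ ∀ m d, (P.cls C).meths m = some d → d.body.GuardsWeak

/-! # Differential dynamic logic -/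

/-- Variables of the logic: the program variables and the three extra variables. -/
inductive DVar (n : ℕ) : Type
  | prog (x : PVar n)
  | t
  | cll
  | result
  deriving DecidableEq

abbrev Term (n : ℕ) : Type := Expr (DVar n)

abbrev Val (n : ℕ) : Type := DVar n → ℝ

/-- Formulas (index `true`) and hybrid programs (index `false`), which are mutually recursive.
Predicate symbols come with their interpretation. -/
inductive DL (n : ℕ) : Bool → Type
  | pred (k : ℕ) (R : (Fin k → ℝ) → Prop) (ts : Fin k → Term n) : DL n true
  | le (a b : Term n) : DL n true
  | eq (a b : Term n) : DL n true
  | neg (φ : DL n true) : DL n true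
  | conj (φ ψ : DL n true) : DL n true
  | ex (x : DVar n) (φ : DL n true) : DL n true
  | box (α : DL n false) (φ : DL n true) : DL n true
  | assign (x : DVar n) (a : Term n) : DL n false
  | any (x : DVar n) : DL n false
  | choice (α β : DL n false) : DL n false
  | star (α : DL n false) : DL n false
  | test (φ : DL n true) : DL n false
  | seq (α β : DL n false) : DL n false
  | ode (xs : List (DVar n × Term n)) (dom : DL n true) : DL n false

abbrev Fml (n : ℕ) : Type := DL n true

abbrev HP (n : ℕ) : Type := DL n false

def DL.Den (n : ℕ) : Bool → Type
  | true => Val n → Prop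
  | false => Val n → Val n → Prop

/-- The set of models of a formula, and the transition relation of a hybrid program. -/
noncomputable def DL.den {n : ℕ} : {b : Bool} → DL n b → DL.Den n b
  | _, .pred _ R ts => fun σ => R (fun i => (ts i).eval σ)
  | _, .le a b => fun σ => a.eval σ ≤ b.eval σ
  | _, .eq a b => fun σ => a.eval σ = b.eval σ
  | _, .neg φ => fun σ => ¬ φ.den σ
  | _, .conj φ ψ => fun σ => φ.den σ ∧ ψ.den σ
  | _, .ex x φ => fun σ => ∃ r : ℝ, φ.den (Function.update σ x r)
  | _, .box α φ => fun σ => ∀ σ', α.den σ σ' → φ.den σ'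
  | _, .assign x a => fun σ σ' => σ' = Function.update σ x (a.eval σ)
  | _, .any x => fun σ σ' => ∃ r : ℝ, σ' = Function.update σ x r
  | _, .choice α β => fun σ σ' => α.den σ σ' ∨ β.den σ σ'
  | _, .star α => fun σ σ' => Relation.ReflTransGen α.den σ σ'
  | _, .test φ => fun σ σ' => σ' = σ ∧ φ.den σ
  | _, .seq α β => fun σ σ' => ∃ σ₁, α.den σ σ₁ ∧ β.den σ₁ σ'
  | _, .ode xs dom => fun σ σ' => ∃ (r : ℝ) (φ : ℝ → Val n), 0 ≤ r ∧ φ 0 = σ ∧ φ r = σ' ∧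
      ∀ s ∈ Set.Icc 0 r, dom.den (φ s) ∧
        (∀ p ∈ xs, HasDerivWithinAt (fun u => φ u p.1) (p.2.eval (φ s)) (Set.Icc 0 r) s) ∧
        (∀ x, x ∉ xs.map Prod.fst → φ s x = σ x)

def Fml.Holds {n : ℕ} (φ : Fml n) (σ : Val n) : Prop := DL.den φ σ

def Fml.Valid {n : ℕ} (φ : Fml n) : Prop := ∀ σ, φ.Holds σ

def Fml.tru {n : ℕ} : Fml n := .le (.const 0) (.const 0)

def Fml.disj {n : ℕ} (φ ψ : Fml n) : Fml n := .neg (.conj (.neg φ) (.neg ψ))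

def Fml.impl {n : ℕ} (φ ψ : Fml n) : Fml n := .neg (.conj φ (.neg ψ))

def HP.skip {n : ℕ} : HP n := .test Fml.tru

def HP.seqs {n : ℕ} : List (HP n) → HP n
  | [] => HP.skip
  | α :: αs => .seq α (HP.seqs αs)

/-! # Proof obligations -/

def Expr.trans {n : ℕ} (e : Expr (PVar n)) : Term n := e.rename DVar.prog

def BExpr.trans {n : ℕ} : BExpr (PVar n) → Fml n
  | .tt => Fml.tru
  | .le a b => .le a.trans b.trans
  | .ge a b => .le b.trans a.trans
  | .and a b => .conj a.trans b.trans
  | .or a b => Fml.disj a.trans b.trans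
  | .not a => .neg a.trans

/-- What is known when a guard lets the process continue. -/
def Guard.trans {n : ℕ} : Guard n → Fml n
  | .diff b => b.trans
  | _ => Fml.tru

/-- How a guard limits the time that passes before some process is scheduled: only differential
guards do, through their weak negation. -/
def Guard.limit {n : ℕ} : Guard n → Fml n
  | .diff b => b.weakNeg.trans
  | _ => Fml.tru

def fieldVar {n : ℕ} (i : Fin n) : DVar n := .prog (.field i)

def locVar {n : ℕ} (x : ℕ) : DVar n := .prog (.loc x)

/-- `cll := 1`. -/
noncomputable def HP.fail {n : ℕ} : HP n := .assign .cll (.const 1)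

noncomputable def Fml.cllZero {n : ℕ} : Fml n := .eq (.var .cll) (.const 0)

noncomputable def Fml.cllOne {n : ℕ} : Fml n := .eq (.var .cll) (.const 1)

def HP.havoc {n : ℕ} : HP n :=
  HP.seqs ((List.finRange n).map fun i => .any (fieldVar i))

def ClassDecl.havocPh {K : Type} {n : ℕ} (c : ClassDecl K n) : HP n :=
  HP.seqs (((List.finRange n).filter fun i => (c.ode i).isSome).map fun i => .any (fieldVar i))

def ClassDecl.invFml {K : Type} {n : ℕ} (c : ClassDecl K n) : Fml n :=
  .pred n c.inv fun i => .var (fieldVar i)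

/-- `{ode, t' = 1 & ψ}`. -/
noncomputable def ClassDecl.flow {K : Type} {n : ℕ} (c : ClassDecl K n) (ψ : Fml n) : HP n :=
  .ode ((DVar.t, .const 1) :: (List.finRange n).filterMap fun i =>
    (c.ode i).map fun e => (fieldVar i, e.rename fieldVar)) ψ

/-- `inv ∧ [t := 0; {ode, t' = 1 & ψ}] inv`. -/
noncomputable def ClassDecl.pr {K : Type} {n : ℕ} (c : ClassDecl K n) (ψ : Fml n) : Fml n :=
  .conj c.invFml (.box (.seq (.assign .t (.const 0)) (c.flow ψ)) c.invFml)

/-- `{?φ} ∪ {?¬φ; fail}`. -/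
noncomputable def HP.check {n : ℕ} (φ : Fml n) : HP n :=
  .choice (.test φ) (.seq (.test (.neg φ)) HP.fail)

/-- `x := *`, or nothing if there is no target. -/
def HP.anyLhs {n : ℕ} : Option (Lhs n) → HP n
  | none => HP.skip
  | some x => .any (.prog x.toPVar)

/-- The value of the `i`-th argument. -/
noncomputable def argTerm {n : ℕ} (args : List (Expr (PVar n))) (i : ℕ) : Term n :=
  (args.getD i (.const 0)).trans

/-- The precondition of the method `C.m`, instantiated with the arguments. -/
noncomputable def Prog.callPre {K : Type} {nf : K → ℕ} (P : Prog K nf) {n : ℕ} (C : K) (m : ℕ)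
    (args : List (Expr (PVar n))) : Fml n :=
  match (P.cls C).meths m with
  | none => Fml.tru
  | some d => .pred d.arity d.pre fun i => argTerm args i

/-- The creation condition of `C`, instantiated with the arguments. -/
noncomputable def Prog.newPre {K : Type} {nf : K → ℕ} (P : Prog K nf) {n : ℕ} (C : K)
    (args : List (Expr (PVar n))) : Fml n :=
  .pred (P.cls C).arity (P.cls C).pre fun i => argTerm args i

/-- The places for which a post-region is needed: the end of the constructor, the end of a method,
a suspension point. -/
inductive Site : Type
  | init
  | meth (m : ℕ)
  | point (p : ℕ)

/-- Post-region generators. -/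
abbrev PostRegions {K : Type} (nf : K → ℕ) : Type := (C : Option K) → Site → Fml (nfo nf C)

/-- The generator of basic regions. -/
def basicRegions {K : Type} (nf : K → ℕ) : PostRegions nf := fun _ _ => Fml.tru

/-- The translation of the statements of class `C` into hybrid programs. At a suspension, the
invariant may be assumed on reactivation only if no check has failed so far. -/
noncomputable def Prog.trans {K : Type} {nf : K → ℕ} (P : Prog K nf) (Ψ : PostRegions nf)
    (C : Option K) : Stmt K (nfo nf C) → HP (nfo nf C)
  | .skip => HP.skip
  | .seq s₁ s₂ => .seq (P.trans Ψ C s₁) (P.trans Ψ C s₂)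
  | .ite b s₁ s₂ =>
      .choice (.seq (.test b.trans) (P.trans Ψ C s₁))
        (.seq (.test (.neg b.trans)) (P.trans Ψ C s₂))
  | .loop b s =>
      .seq (.star (.seq (.test b.trans) (P.trans Ψ C s))) (.test (.neg b.trans))
  | .await p g =>
      let φ := (P.decl C).pr (.conj (Ψ C (.point p)) g.limit)
      .choice
        (HP.seqs [.test φ, HP.havoc,
          .test (.conj g.trans (Fml.disj (P.decl C).invFml Fml.cllOne))])
        (HP.seqs [.test (.neg φ), HP.fail, HP.havoc, .test g.trans])
  | .assign none (.expr _) => HP.skip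
  | .assign (some x) (.expr e) => .assign (.prog x.toPVar) e.trans
  | .assign x (.new D args) => .seq (HP.check (P.newPre D args)) (HP.anyLhs x)
  | .assign x (.call _ D m args) => .seq (HP.check (P.callPre D m args)) (HP.anyLhs x)
  | .assign x (.get _) =>
      let φ := (P.decl C).pr Fml.tru
      .choice
        (HP.seqs [.test φ, (P.decl C).havocPh, .test (P.decl C).invFml, HP.anyLhs x])
        (HP.seqs [.test (.neg φ), HP.fail, (P.decl C).havocPh, HP.anyLhs x])
  | .duration e =>
      let dom : Fml (nfo nf C) := .le (.var .t) e.trans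
      HP.seqs [.assign .t (.const 0), HP.check ((P.decl C).pr dom),
        .assign .t (.const 0), (P.decl C).flow dom, .test (.le e.trans (.var .t))]

/-- The constructor code: initialization of the fields from the constructor parameters, followed by
the constructor block. -/
noncomputable def Prog.ctorHP {K : Type} {nf : K → ℕ} (P : Prog K nf) (Ψ : PostRegions nf)
    (C : K) : HP (nf C) :=
  .seq (HP.seqs ((List.finRange (nf C)).map fun i =>
      .assign (fieldVar i) (((P.cls C).init i).rename fun j : Fin _ => locVar j.val)))
    (P.trans Ψ (some C) (P.cls C).ctor)

noncomputable def Prog.oblInit {K : Type} {nf : K → ℕ} (P : Prog K nf) (Ψ : PostRegions nf)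
    (C : K) : Fml (nf C) :=
  Fml.impl
    (.conj (.pred (P.cls C).arity (P.cls C).pre fun i => .var (locVar i)) Fml.cllZero)
    (.box (P.ctorHP Ψ C) (.conj Fml.cllZero ((P.cls C).pr (Ψ (some C) .init))))

/-- The proof obligation of the method `C.m` with declaration `d`. -/
noncomputable def Prog.oblMeth {K : Type} {nf : K → ℕ} (P : Prog K nf) (Ψ : PostRegions nf)
    (C : K) (m : ℕ) (d : MethDecl K (nf C)) : Fml (nf C) :=
  Fml.impl
    (.conj (P.cls C).invFml
      (.conj (.pred d.arity d.pre fun i => .var (locVar i)) Fml.cllZero))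
    (.box (.seq (P.trans Ψ (some C) d.body) (.assign .result d.ret.trans))
      (.conj Fml.cllZero
        (.conj
          (.pred (nf C + 1) (fun v => d.post (fun i => v i.succ) (v 0))
            (Fin.cons (.var .result) fun i => .var (fieldVar i)))
          ((P.cls C).pr (Ψ (some C) (.meth m))))))

noncomputable def Prog.oblMain {K : Type} {nf : K → ℕ} (P : Prog K nf) (Ψ : PostRegions nf) :
    Fml 0 :=
  Fml.impl Fml.cllZero (.box (P.trans Ψ none P.main) Fml.cllZero)

/-- All proof obligations of class `C` are valid. -/
def Prog.ClassVerified {K : Type} {nf : K → ℕ} (P : Prog K nf) (Ψ : PostRegions nf) (C : K) :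
    Prop :=
  (P.oblInit Ψ C).Valid ∧
  ∀ m d, (P.cls C).meths m = some d → (P.oblMeth Ψ C m d).Valid

/-- All proof obligations of the program are valid. -/
def Prog.Verified {K : Type} {nf : K → ℕ} (P : Prog K nf) (Ψ : PostRegions nf) : Prop :=
  (P.oblMain Ψ).Valid ∧ ∀ C, P.ClassVerified Ψ C

/-! # Runtime semantics -/

/-- Runtime statements. -/
inductive RStmt (K : Type) (n : ℕ) : Type
  | stmt (s : Stmt K n)
  | susp
  | ret (e : Expr (PVar n))

/-- Put a statement in front of the remaining code, flattening sequences. -/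
def Stmt.load {K : Type} {n : ℕ} : Stmt K n → List (RStmt K n) → List (RStmt K n)
  | .seq s₁ s₂, k => s₁.load (s₂.load k)
  | s, k => .stmt s :: k

/-- A process: local store, future, remaining code, and the method that it runs (`none` for a
constructor or the main block). -/
structure Proc (K : Type) (n : ℕ) where
  loc : ℕ → ℝ
  fid : ℕ
  code : List (RStmt K n)
  meth : Option ℕ

/-- An object: class, field store, current dynamics (from the current moment on), active process,
and inactive processes. -/
structure Obj (K : Type) (nf : K → ℕ) where
  cls : Option K
  heap : Fin (nfo nf cls) → ℝ
  dyn : ℝ → Fin (nfo nf cls) → ℝ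
  act : Option (Proc K (nfo nf cls))
  queue : Multiset (Proc K (nfo nf cls))

/-- A message: callee, called method `cls.meth`, argument values, generated future. -/
structure Msg (K : Type) where
  dest : ℝ
  cls : K
  meth : ℕ
  args : List ℝ
  fid : ℕ

inductive FutSt : Type
  | unused
  | pending
  | resolved (v : ℝ)

structure Conf (K : Type) (nf : K → ℕ) where
  objs : ℕ → Option (Obj K nf)
  msgs : Multiset (Msg K)
  futs : ℕ → FutSt

structure TConf (K : Type) (nf : K → ℕ) where
  clock : ℝ
  conf : Conf K nf

/-- A procedure that selects, for every class and every field store, a solution of the ODE. -/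
abbrev SolFun {K : Type} (nf : K → ℕ) : Type :=
  (C : Option K) → (Fin (nfo nf C) → ℝ) → ℝ → Fin (nfo nf C) → ℝ

/-- `f` is a solution of the ODE for all times `s ≥ 0`, starting in `ρ`. Non-physical fields do
not evolve. -/
def IsSolution {n : ℕ} (ode : Fin n → Option (Expr (Fin n))) (ρ : Fin n → ℝ)
    (f : ℝ → Fin n → ℝ) : Prop :=
  f 0 = ρ ∧ ∀ s, 0 ≤ s → ∀ i, match ode i with
    | some e => HasDerivWithinAt (fun u => f u i) (e.eval (f s)) (Set.Ici 0) s
    | none => f s i = ρ i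

def Prog.Solves {K : Type} {nf : K → ℕ} (P : Prog K nf) (sol : SolFun nf) : Prop :=
  ∀ C ρ, IsSolution (P.decl C).ode ρ (sol C ρ)

/-- The combined store of object and process. -/
def env {n : ℕ} (o : ℕ) (ρ : Fin n → ℝ) (τ : ℕ → ℝ) : PVar n → ℝ
  | .field i => ρ i
  | .loc x => τ x
  | .this => o

def RStmt.IsAwait {K : Type} {n : ℕ} : RStmt K n → Prop
  | .stmt (.await _ _) => True
  | _ => False

/-- The guard holds now, in the combined store `σ`. -/
def Guard.holds {n : ℕ} (futs : ℕ → FutSt) (σ : PVar n → ℝ) : Guard n → Prop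
  | .fut e => ∃ (fid : ℕ) (v : ℝ), (fid : ℝ) = e.eval σ ∧ futs fid = .resolved v
  | .duration e => e.eval σ ≤ 0
  | .diff b => b.holds σ

/-- The object after its active process `q` has stored the value `v` in `x`, with code `k` left. The
dynamics always starts in the current store. -/
noncomputable def Obj.store {K : Type} {nf : K → ℕ} (sol : SolFun nf) (ob : Obj K nf)
    (q : Proc K (nfo nf ob.cls)) (x : Option (Lhs (nfo nf ob.cls))) (v : ℝ)
    (k : List (RStmt K (nfo nf ob.cls))) : Obj K nf :=
  match x with
  | none => { ob with act := some { q with code := k } }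
  | some (.loc y) => { ob with act := some { q with loc := Function.update q.loc y v, code := k } }
  | some (.field i) =>
    { ob with
      heap := Function.update ob.heap i v
      dyn := sol ob.cls (Function.update ob.heap i v)
      act := some { q with code := k } }

/-- Steps that concern only the object with identity `o`, given the state of the futures. -/
inductive LStep {K : Type} {nf : K → ℕ} (sol : SolFun nf) (futs : ℕ → FutSt) (o : ℕ) :
    Obj K nf → Obj K nf → Prop
  | await (ob : Obj K nf) (q : Proc K (nfo nf ob.cls)) (p : ℕ) (g : Guard (nfo nf ob.cls))
      (k : List (RStmt K (nfo nf ob.cls))) (ha : ob.act = some q)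
      (hc : q.code = .stmt (.await p g) :: k) :
      LStep sol futs o ob
        { ob with act := some { q with code := .susp :: .stmt (.await p g) :: k } }
  | susp (ob : Obj K nf) (q : Proc K (nfo nf ob.cls)) (k : List (RStmt K (nfo nf ob.cls)))
      (ha : ob.act = some q) (hc : q.code = .susp :: k) :
      LStep sol futs o ob
        { ob with
          dyn := sol ob.cls ob.heap
          act := none
          queue := { q with code := k } ::ₘ ob.queue }
  | schedAwait (ob : Obj K nf) (q : Proc K (nfo nf ob.cls))
      (Q : Multiset (Proc K (nfo nf ob.cls))) (p : ℕ) (g : Guard (nfo nf ob.cls))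
      (k : List (RStmt K (nfo nf ob.cls))) (ha : ob.act = none) (hq : ob.queue = q ::ₘ Q)
      (hc : q.code = .stmt (.await p g) :: k) (hg : g.holds futs (env o ob.heap q.loc)) :
      LStep sol futs o ob { ob with act := some { q with code := k }, queue := Q }
  | sched (ob : Obj K nf) (q : Proc K (nfo nf ob.cls)) (Q : Multiset (Proc K (nfo nf ob.cls)))
      (ha : ob.act = none) (hq : ob.queue = q ::ₘ Q)
      (hc : ∀ s ∈ q.code.head?, ¬ s.IsAwait) :
      LStep sol futs o ob { ob with act := some q, queue := Q }
  | get (ob : Obj K nf) (q : Proc K (nfo nf ob.cls)) (x : Option (Lhs (nfo nf ob.cls)))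
      (e : Expr (PVar (nfo nf ob.cls))) (k : List (RStmt K (nfo nf ob.cls))) (fid : ℕ) (v : ℝ)
      (ha : ob.act = some q) (hc : q.code = .stmt (.assign x (.get e)) :: k)
      (he : e.eval (env o ob.heap q.loc) = fid) (hf : futs fid = .resolved v) :
      LStep sol futs o ob
        { ob with act := some { q with code := .stmt (.assign x (.expr (.const v))) :: k } }
  | assign (ob : Obj K nf) (q : Proc K (nfo nf ob.cls)) (x : Option (Lhs (nfo nf ob.cls)))
      (e : Expr (PVar (nfo nf ob.cls))) (k : List (RStmt K (nfo nf ob.cls)))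
      (ha : ob.act = some q) (hc : q.code = .stmt (.assign x (.expr e)) :: k) :
      LStep sol futs o ob (ob.store sol q x (e.eval (env o ob.heap q.loc)) k)
  | loop (ob : Obj K nf) (q : Proc K (nfo nf ob.cls)) (b : BExpr (PVar (nfo nf ob.cls)))
      (s : Stmt K (nfo nf ob.cls)) (k : List (RStmt K (nfo nf ob.cls)))
      (ha : ob.act = some q) (hc : q.code = .stmt (.loop b s) :: k) :
      LStep sol futs o ob
        { ob with act := some { q with code := .stmt (.ite b (.seq s (.loop b s)) .skip) :: k } }
  | iteTrue (ob : Obj K nf) (q : Proc K (nfo nf ob.cls)) (b : BExpr (PVar (nfo nf ob.cls)))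
      (s₁ s₂ : Stmt K (nfo nf ob.cls)) (k : List (RStmt K (nfo nf ob.cls)))
      (ha : ob.act = some q) (hc : q.code = .stmt (.ite b s₁ s₂) :: k)
      (hb : b.holds (env o ob.heap q.loc)) :
      LStep sol futs o ob { ob with act := some { q with code := s₁.load k } }
  | iteFalse (ob : Obj K nf) (q : Proc K (nfo nf ob.cls)) (b : BExpr (PVar (nfo nf ob.cls)))
      (s₁ s₂ : Stmt K (nfo nf ob.cls)) (k : List (RStmt K (nfo nf ob.cls)))
      (ha : ob.act = some q) (hc : q.code = .stmt (.ite b s₁ s₂) :: k)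
      (hb : ¬ b.holds (env o ob.heap q.loc)) :
      LStep sol futs o ob { ob with act := some { q with code := s₂.load k } }
  | skip (ob : Obj K nf) (q : Proc K (nfo nf ob.cls)) (k : List (RStmt K (nfo nf ob.cls)))
      (ha : ob.act = some q) (hc : q.code = .stmt .skip :: k) :
      LStep sol futs o ob { ob with act := some { q with code := k } }
  -- The argument of a blocking `duration` decreases with time (see `Proc.advActive`). A process whose
  -- argument is negative from the beginning stays blocked.
  | duration (ob : Obj K nf) (q : Proc K (nfo nf ob.cls)) (e : Expr (PVar (nfo nf ob.cls)))
      (k : List (RStmt K (nfo nf ob.cls)))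
      (ha : ob.act = some q) (hc : q.code = .stmt (.duration e) :: k)
      (he : e.eval (env o ob.heap q.loc) = 0) :
      LStep sol futs o ob { ob with act := some { q with code := k } }

/-- The initial local store: the arguments for the parameters, the default value otherwise. -/
noncomputable def initLoc (arity : ℕ) (args : List ℝ) : ℕ → ℝ :=
  fun x => if x < arity then args.getD x 0 else 0

/-- A new object of class `C`, with its constructor active. -/
noncomputable def Prog.newObj {K : Type} {nf : K → ℕ} (P : Prog K nf) (sol : SolFun nf)
    (C : Option K) (args : List ℝ) (fid : ℕ) : Obj K nf :=
  let ρ : Fin (nfo nf C) → ℝ := fun i => ((P.decl C).init i).eval fun j : Fin _ => args.getD j.val 0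
  { cls := C
    heap := ρ
    dyn := sol C ρ
    act := some
      { loc := initLoc (P.decl C).arity args
        fid := fid
        code := (P.decl C).ctor.load [.ret (.const 0)]
        meth := none }
    queue := 0 }

/-- The discrete transition system. -/
inductive DStep {K : Type} {nf : K → ℕ} (P : Prog K nf) (sol : SolFun nf) :
    Conf K nf → Conf K nf → Prop
  | loc (c : Conf K nf) (o : ℕ) (ob ob' : Obj K nf) (ho : c.objs o = some ob)
      (hs : LStep sol c.futs o ob ob') :
      DStep P sol c { c with objs := Function.update c.objs o (some ob') }
  | ret (c : Conf K nf) (o : ℕ) (ob : Obj K nf) (ho : c.objs o = some ob)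
      (q : Proc K (nfo nf ob.cls)) (e : Expr (PVar (nfo nf ob.cls)))
      (k : List (RStmt K (nfo nf ob.cls)))
      (ha : ob.act = some q) (hc : q.code = .ret e :: k) :
      DStep P sol c
        { c with
          objs := Function.update c.objs o
            (some { ob with dyn := sol ob.cls ob.heap, act := none })
          futs := Function.update c.futs q.fid (.resolved (e.eval (env o ob.heap q.loc))) }
  | call (c : Conf K nf) (o : ℕ) (ob : Obj K nf) (ho : c.objs o = some ob)
      (q : Proc K (nfo nf ob.cls)) (x : Option (Lhs (nfo nf ob.cls)))
      (e : Expr (PVar (nfo nf ob.cls))) (D : K) (m : ℕ) (args : List (Expr (PVar (nfo nf ob.cls))))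
      (k : List (RStmt K (nfo nf ob.cls))) (fid : ℕ)
      (ha : ob.act = some q) (hc : q.code = .stmt (.assign x (.call e D m args)) :: k)
      (hf : c.futs fid = .unused) :
      DStep P sol c
        { objs := Function.update c.objs o (some (ob.store sol q x fid k))
          msgs :=
            { dest := e.eval (env o ob.heap q.loc)
              cls := D
              meth := m
              args := args.map fun a => a.eval (env o ob.heap q.loc)
              fid := fid } ::ₘ c.msgs
          futs := Function.update c.futs fid .pending }
  | dispatch (c : Conf K nf) (o : ℕ) (ob : Obj K nf) (ho : c.objs o = some ob)
      (μ : Msg K) (M : Multiset (Msg K)) (d : MethDecl K (nfo nf ob.cls))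
      (hm : c.msgs = μ ::ₘ M) (hd : μ.dest = o) (hC : ob.cls = some μ.cls)
      (hmeth : (P.decl ob.cls).meths μ.meth = some d) :
      DStep P sol c
        { c with
          objs := Function.update c.objs o (some { ob with
            queue :=
              { loc := initLoc d.arity μ.args
                fid := μ.fid
                code := d.body.load [.ret d.ret]
                meth := some μ.meth } ::ₘ ob.queue })
          msgs := M }
  | new (c : Conf K nf) (o : ℕ) (ob : Obj K nf) (ho : c.objs o = some ob)
      (q : Proc K (nfo nf ob.cls)) (x : Option (Lhs (nfo nf ob.cls))) (D : K)
      (args : List (Expr (PVar (nfo nf ob.cls)))) (k : List (RStmt K (nfo nf ob.cls)))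
      (o' fid : ℕ) (ha : ob.act = some q) (hc : q.code = .stmt (.assign x (.new D args)) :: k)
      (ho' : c.objs o' = none) (hf : c.futs fid = .unused) :
      DStep P sol c
        { c with
          objs := Function.update
            (Function.update c.objs o (some (ob.store sol q x o' k))) o'
            (some (P.newObj sol (some D)
              (args.map fun a => a.eval (env o ob.heap q.loc)) fid))
          futs := Function.update c.futs fid .pending }

/-- The field store of the object after `s` time units. -/
def Prog.advHeap {K : Type} {nf : K → ℕ} (P : Prog K nf) (ob : Obj K nf) (s : ℝ) :
    Fin (nfo nf ob.cls) → ℝ :=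
  fun i => if ((P.decl ob.cls).ode i).isSome then ob.dyn s i else ob.heap i

/-- The argument of an `await duration` at the head of an inactive process is decreased by `s`. -/
def Proc.advQueued {K : Type} {n : ℕ} (q : Proc K n) (s : ℝ) : Proc K n :=
  match q.code with
  | .stmt (.await p (.duration e)) :: k =>
    { q with code := .stmt (.await p (.duration (.minus e (.const s)))) :: k }
  | _ => q

/-- The argument of a blocking `duration` at the head of an active process is decreased by `s`. -/
def Proc.advActive {K : Type} {n : ℕ} (q : Proc K n) (s : ℝ) : Proc K n :=
  match q.code with
  | .stmt (.duration e) :: k => { q with code := .stmt (.duration (.minus e (.const s))) :: k }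
  | _ => q

def Prog.advObj {K : Type} {nf : K → ℕ} (P : Prog K nf) (ob : Obj K nf) (s : ℝ) : Obj K nf :=
  { ob with
    heap := P.advHeap ob s
    dyn := fun u => ob.dyn (s + u)
    act := ob.act.map fun q => q.advActive s
    queue := ob.queue.map fun q => q.advQueued s }

def Prog.adv {K : Type} {nf : K → ℕ} (P : Prog K nf) (c : Conf K nf) (s : ℝ) : Conf K nf :=
  { c with objs := fun o => (c.objs o).map fun ob => P.advObj ob s }

/-- Maximal time elapse of an inactive process. -/
noncomputable def Proc.mte {K : Type} {n : ℕ} (o : ℕ) (dyn : ℝ → Fin n → ℝ) (q : Proc K n) :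
    ENNReal :=
  match q.code with
  | .stmt (.await _ (.diff b)) :: _ =>
    ⨅ (s : ℝ) (_ : 0 ≤ s ∧ b.holds (env o (dyn s) q.loc)), ENNReal.ofReal s
  | .stmt (.await _ (.duration e)) :: _ => ENNReal.ofReal (e.eval (env o (dyn 0) q.loc))
  | _ => ⊤

/-- Maximal time elapse of the active process, which is blocked: the time until a blocking
`duration` is over. -/
noncomputable def Proc.mteBlocked {K : Type} {n : ℕ} (o : ℕ) (dyn : ℝ → Fin n → ℝ)
    (q : Proc K n) : ENNReal :=
  match q.code with
  | .stmt (.duration e) :: _ =>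
    ⨅ (s : ℝ) (_ : 0 ≤ s ∧ e.eval (env o (dyn s) q.loc) ≤ s), ENNReal.ofReal s
  | _ => ⊤

/-- Maximal time elapse of an object. While a process is active, no other process can be scheduled
on the object, so that only the active process limits the time. -/
noncomputable def Obj.mte {K : Type} {nf : K → ℕ} (o : ℕ) (ob : Obj K nf) : ENNReal :=
  match ob.act with
  | none => ⨅ q ∈ ob.queue, q.mte o ob.dyn
  | some q => q.mteBlocked o ob.dyn

noncomputable def Conf.mte {K : Type} {nf : K → ℕ} (c : Conf K nf) : ENNReal :=
  ⨅ (o : ℕ) (ob : Obj K nf) (_ : c.objs o = some ob), ob.mte o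

/-- Time advances by `s`: possible only if no discrete step is. -/
def TimeStep {K : Type} {nf : K → ℕ} (P : Prog K nf) (sol : SolFun nf) (s : ℝ)
    (c c' : TConf K nf) : Prop :=
  (¬ ∃ d, DStep P sol c.conf d) ∧ 0 ≤ s ∧ c.conf.mte = ENNReal.ofReal s ∧
    c' = ⟨c.clock + s, P.adv c.conf s⟩

/-- The timed transition system. -/
def Step {K : Type} {nf : K → ℕ} (P : Prog K nf) (sol : SolFun nf) (c c' : TConf K nf) : Prop :=
  (c'.clock = c.clock ∧ DStep P sol c.conf c'.conf) ∨ ∃ s, TimeStep P sol s c c'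

/-- No transition is possible. -/
def Final {K : Type} {nf : K → ℕ} (P : Prog K nf) (sol : SolFun nf) (c : TConf K nf) : Prop :=
  ¬ ∃ c', Step P sol c c'

/-- Initially, only the main block is executed. -/
noncomputable def Prog.initConf {K : Type} {nf : K → ℕ} (P : Prog K nf) (sol : SolFun nf) :
    TConf K nf where
  clock := 0
  conf :=
    { objs := fun o => if o = 0 then some (P.newObj sol none [] 0) else none
      msgs := 0
      futs := fun fid => if fid = 0 then .pending else .unused }

/-- Maximal runs. A finite run is represented by repeating its final configuration forever. -/
def IsRun {K : Type} {nf : K → ℕ} (P : Prog K nf) (sol : SolFun nf) (r : ℕ → TConf K nf) : Prop :=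
  r 0 = P.initConf sol ∧
  ∀ i, Step P sol (r i) (r (i + 1)) ∨ (Final P sol (r i) ∧ r (i + 1) = r i)

/-- The run is finite, or its clock exceeds all bounds. -/
def TimeDivergent {K : Type} {nf : K → ℕ} (P : Prog K nf) (sol : SolFun nf)
    (r : ℕ → TConf K nf) : Prop :=
  (∃ i, Final P sol (r i)) ∨ Filter.Tendsto (fun i => (r i).clock) Filter.atTop Filter.atTop

/-- Every process in the run terminates. -/
def LocallyTerminating {K : Type} {nf : K → ℕ} (r : ℕ → TConf K nf) : Prop :=
  ∀ i o ob, (r i).conf.objs o = some ob → ∀ q, (ob.act = some q ∨ q ∈ ob.queue) →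
    ∃ j v, (r j).conf.futs q.fid = .resolved v

/-- From the `i`-th configuration of the run, time advances to (at least) `x` time units later
without a discrete step: either by a transition, or because the run is finished. -/
def Elapses {K : Type} {nf : K → ℕ} (P : Prog K nf) (sol : SolFun nf) (r : ℕ → TConf K nf)
    (i : ℕ) (x : ℝ) : Prop :=
  0 ≤ x ∧ ((∃ s, TimeStep P sol s (r i) (r (i + 1)) ∧ x ≤ s) ∨ Final P sol (r i))

/-- Class `D` is safe in the program: in every locally terminating, time-divergent run,
* the invariant holds for every object of the class whenever the object is inactive,
* it holds in every state through which such an object passes while time advances, whether a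
  process is active or not (these are the states of the trace of the object),
* the precondition of a method holds for the parameters of every call of the method,
* the postcondition of a method holds whenever a process of the method terminates. -/
def Prog.ClassSafe {K : Type} {nf : K → ℕ} (P : Prog K nf) (sol : SolFun nf) (D : K) : Prop :=
  ∀ r, IsRun P sol r → TimeDivergent P sol r → LocallyTerminating r →
    ∀ i,
      (∀ o ob, (r i).conf.objs o = some ob → ob.cls = some D →
        (ob.act = none → (P.decl ob.cls).inv ob.heap) ∧
        (∀ x, Elapses P sol r i x → (P.decl ob.cls).inv (P.advHeap ob x)) ∧
        (∀ q m d e k, ob.act = some q → q.meth = some m →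
          (P.decl ob.cls).meths m = some d → q.code = .ret e :: k →
          d.post ob.heap (e.eval (env o ob.heap q.loc)))) ∧
      (∀ μ ∈ (r i).conf.msgs, μ.cls = D → ∀ d, (P.cls D).meths μ.meth = some d →
        d.pre fun j => initLoc d.arity μ.args j)

/-- Every class of the program is safe. -/
def Prog.Safe {K : Type} {nf : K → ℕ} (P : Prog K nf) (sol : SolFun nf) : Prop :=
  ∀ D, P.ClassSafe sol D

/-! # Removing and adding methods -/

/-- The statement contains a call of `C.m`. -/
def Stmt.Calls {K : Type} {n : ℕ} (C : K) (m : ℕ) : Stmt K n → Prop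
  | .seq s₁ s₂ => s₁.Calls C m ∨ s₂.Calls C m
  | .ite _ s₁ s₂ => s₁.Calls C m ∨ s₂.Calls C m
  | .loop _ s => s.Calls C m
  | .assign _ (.call _ D m' _) => D = C ∧ m' = m
  | _ => False

/-- All calls of `C.m` are replaced by `skip`. -/
def Stmt.eraseCalls {K : Type} [DecidableEq K] {n : ℕ} (C : K) (m : ℕ) : Stmt K n → Stmt K n
  | .seq s₁ s₂ => .seq (s₁.eraseCalls C m) (s₂.eraseCalls C m)
  | .ite b s₁ s₂ => .ite b (s₁.eraseCalls C m) (s₂.eraseCalls C m)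
  | .loop b s => .loop b (s.eraseCalls C m)
  | .assign x (.call e D m' args) =>
    if D = C ∧ m' = m then .skip else .assign x (.call e D m' args)
  | s => s

/-- The method `m` is removed from class `C`, and all calls of it are replaced by `skip`. -/
def Prog.removeMethod {K : Type} [DecidableEq K] {nf : K → ℕ} (P : Prog K nf) (C : K) (m : ℕ) :
    Prog K nf where
  cls := fun D =>
    { P.cls D with
      ctor := (P.cls D).ctor.eraseCalls C m
      meths := fun m' =>
        if D = C ∧ m' = m then none
        else ((P.cls D).meths m').map fun d => { d with body := d.body.eraseCalls C m } }
  main := P.main.eraseCalls C m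

/-- The method `m` with declaration `d` is added to class `C`. -/
def Prog.addMethod {K : Type} [DecidableEq K] {nf : K → ℕ} (P : Prog K nf) (C : K) (m : ℕ)
    (d : MethDecl K (nf C)) : Prog K nf where
  cls := Function.update P.cls C
    { P.cls C with meths := Function.update (P.cls C).meths m (some d) }
  main := P.main

/-- The main block, a constructor or a method contains a call of `C.m`. -/
def Prog.Calls {K : Type} {nf : K → ℕ} (P : Prog K nf) (C : K) (m : ℕ) : Prop :=
  P.main.Calls C m ∨
  ∃ D, (P.cls D).ctor.Calls C m ∨ ∃ m' d, (P.cls D).meths m' = some d ∧ d.body.Calls C m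

/-- `P'` results from `P` by changing code so that it may call `C.m`: any block that differs from
the one in `P` contains a call of `C.m`. Contracts, invariants, dynamics and fields are kept. -/
def Prog.ChangedCallers {K : Type} {nf : K → ℕ} (P P' : Prog K nf) (C : K) (m : ℕ) : Prop :=
  (P'.main = P.main ∨ P'.main.Calls C m) ∧
  ∀ D,
    (∃ s M, P'.cls D = { P.cls D with ctor := s, meths := M }) ∧
    ((P'.cls D).ctor = (P.cls D).ctor ∨ (P'.cls D).ctor.Calls C m) ∧
    ∀ m', match (P.cls D).meths m', (P'.cls D).meths m' with
      | none, none => True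
      | some d, some d' => d' = d ∨
          (d'.body.Calls C m ∧ ∃ s e, d' = { d with body := s, ret := e })
      | _, _ => False

/-- The proof obligations of the constructor and of the methods of `D` that call `C.m` are valid. -/
def Prog.CallersVerified {K : Type} {nf : K → ℕ} (P : Prog K nf) (Ψ : PostRegions nf)
    (C : K) (m : ℕ) (D : K) : Prop :=
  ((P.cls D).ctor.Calls C m → (P.oblInit Ψ D).Valid) ∧
  ∀ m' d, (P.cls D).meths m' = some d → d.body.Calls C m → (P.oblMeth Ψ D m' d).Valid

/-! # Evaluation and the states of the logic -/

/-! There are two ingredients: verification implies safety (`Prog.Verified.safe`), and verification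
is preserved by the changes of the program. Safety of the changed program follows from its own
verification, not from the safety of the original one.

Soundness rests on the flag `cll`. A failed check does not stop the translated code; it sets `cll`
to 1, which is never undone, while every obligation demands `cll = 0` at the end. So a process in
which a check has failed satisfies a weakest precondition that excludes its return, and its future
stays pending forever. In a locally terminating run no check fails, and then the checks yield the
required facts. `Prog.CodeOK` records, for the remaining code of a process, that its weakest
precondition holds with `cll` equal to `flag b`. The invariant proof is run twice with the same
lemmas: with `b = false` for all processes (`Conf.Sound`), until a check fails; and with `b = true`
for the single process that failed (`Conf.Doomed`), identified by its future. In the second mode the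
other processes are no longer controlled, so the invariant may be false when the doomed process is
reactivated; the disjunct `cll = 1` in the translation of `await` exists for this. An idle object
keeps its invariant while time advances because the process that was active last has proved it:
either for all times, or for as long as the weak negation of its guard holds. Time cannot run past
the first moment at which that guard is true, and the weak negation defines a closed set, so it
holds up to and including that moment (`weakNeg_on_Icc`).

For the modularity part, obligations depend on the rest of the program only through contracts,
invariants and dynamics. Code that does not call `C.m` thus has the same translation before and
after the change (`Prog.Agree.trans_eq`), which settles both forms of addition. Replacing a call by
`skip` removes a check: the run of `skip` is matched by the call that leaves its target unchanged,
except that `cll` may become 1. The rest of the code can be repeated with `cll = 1`, because tests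
use `cll` at most through the positive atom `cll = 1` (`Prog.keeps_trans`). The original obligation
excludes a final state with `cll = 1`, so the check cannot have failed (`Prog.Agree.covers`). -/

theorem Expr.eval_rename {V W : Type} (f : V → W) (e : Expr V) (σ : W → ℝ) :
    (e.rename f).eval σ = e.eval (fun x => σ (f x)) := by
  induction e <;> simp_all [Expr.rename, Expr.eval]

/-- The value of `cll`: whether a check has failed. -/
noncomputable def flag (b : Bool) : ℝ := if b then 1 else 0

/-- The state of the logic for an object with identity `o`, field store `ρ` and local store `τ`. -/
noncomputable def stateOf {n : ℕ} (o : ℕ) (ρ : Fin n → ℝ) (τ : ℕ → ℝ) (b : Bool) (t r : ℝ) : Val n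
  | .prog x => env o ρ τ x
  | .t => t
  | .cll => flag b
  | .result => r

section
variable {n : ℕ} (o : ℕ) (ρ : Fin n → ℝ) (τ : ℕ → ℝ) (b : Bool) (t r : ℝ)

@[simp] theorem stateOf_t : stateOf o ρ τ b t r .t = t := rfl
@[simp] theorem stateOf_cll : stateOf o ρ τ b t r .cll = flag b := rfl
@[simp] theorem stateOf_locVar (x : ℕ) : stateOf o ρ τ b t r (locVar x) = τ x := rfl

@[simp] theorem update_stateOf_t (u : ℝ) :
    Function.update (stateOf o ρ τ b t r) .t u = stateOf o ρ τ b u r := by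
  funext x; cases x <;> simp [stateOf]

@[simp] theorem update_stateOf_cll :
    Function.update (stateOf o ρ τ b t r) .cll 1 = stateOf o ρ τ true t r := by
  funext x; cases x <;> simp [stateOf, flag]

@[simp] theorem update_stateOf_fieldVar (i : Fin n) (v : ℝ) :
    Function.update (stateOf o ρ τ b t r) (fieldVar i) v
      = stateOf o (Function.update ρ i v) τ b t r := by
  funext x
  rcases x with (j | _ | _) | _ | _ | _ <;>
    simp [Function.update_apply, stateOf, fieldVar, env]

theorem update_stateOf_locVar (x : ℕ) (v : ℝ) :
    Function.update (stateOf o ρ τ b t r) (locVar x) v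
      = stateOf o ρ (Function.update τ x v) b t r := by
  funext y
  rcases y with (j | _ | _) | _ | _ | _ <;>
    simp [Function.update_apply, stateOf, locVar, env]

end

/-- The field store after the assignment of `v` to `x`. -/
def setHeap {n : ℕ} (x : Option (Lhs n)) (v : ℝ) (ρ : Fin n → ℝ) : Fin n → ℝ :=
  match x with
  | some (.field i) => Function.update ρ i v
  | _ => ρ

/-- The local store after the assignment of `v` to `x`. -/
def setLoc {n : ℕ} (x : Option (Lhs n)) (v : ℝ) (τ : ℕ → ℝ) : ℕ → ℝ :=
  match x with
  | some (.loc y) => Function.update τ y v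
  | _ => τ

theorem update_stateOf_toPVar {n : ℕ} (o : ℕ) (ρ : Fin n → ℝ) (τ : ℕ → ℝ) (b : Bool) (t r : ℝ)
    (x : Lhs n) (v : ℝ) :
    Function.update (stateOf o ρ τ b t r) (.prog x.toPVar) v
      = stateOf o (setHeap (some x) v ρ) (setLoc (some x) v τ) b t r := by
  cases x with
  | field i => exact update_stateOf_fieldVar o ρ τ b t r i v
  | loc y => exact update_stateOf_locVar o ρ τ b t r y v

theorem Expr.eval_trans_state {n : ℕ} (e : Expr (PVar n)) (σ : Val n) :
    e.trans.eval σ = e.eval fun x => σ (.prog x) :=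
  e.eval_rename _ σ

@[simp] theorem Expr.eval_trans {n : ℕ} (e : Expr (PVar n)) (o : ℕ) (ρ : Fin n → ℝ) (τ : ℕ → ℝ)
    (b : Bool) (t r : ℝ) : e.trans.eval (stateOf o ρ τ b t r) = e.eval (env o ρ τ) :=
  e.eval_trans_state _

/-! # Satisfaction and transitions -/

/-- The transition relation of a hybrid program. -/
def HP.Rel {n : ℕ} (α : HP n) (σ σ' : Val n) : Prop := DL.den α σ σ'

namespace Fml
variable {n : ℕ} (σ : Val n)

@[simp] theorem holds_pred (k : ℕ) (R : (Fin k → ℝ) → Prop) (ts : Fin k → Term n) :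
    Fml.Holds (.pred k R ts) σ ↔ R (fun i => (ts i).eval σ) := Iff.rfl
@[simp] theorem holds_le (a b : Term n) : Fml.Holds (.le a b) σ ↔ a.eval σ ≤ b.eval σ := Iff.rfl
@[simp] theorem holds_neg (φ : Fml n) : Fml.Holds (.neg φ) σ ↔ ¬ φ.Holds σ := Iff.rfl
@[simp] theorem holds_conj (φ ψ : Fml n) :
    Fml.Holds (.conj φ ψ) σ ↔ φ.Holds σ ∧ ψ.Holds σ := Iff.rfl
@[simp] theorem holds_tru : Fml.tru.Holds σ := le_refl _
@[simp] theorem holds_disj (φ ψ : Fml n) : (Fml.disj φ ψ).Holds σ ↔ φ.Holds σ ∨ ψ.Holds σ := by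
  simp [Fml.disj, or_iff_not_imp_left]
@[simp] theorem holds_impl (φ ψ : Fml n) : (Fml.impl φ ψ).Holds σ ↔ (φ.Holds σ → ψ.Holds σ) := by
  simp [Fml.impl]
@[simp] theorem holds_cllZero : (Fml.cllZero (n := n)).Holds σ ↔ σ .cll = 0 := Iff.rfl
@[simp] theorem holds_cllOne : (Fml.cllOne (n := n)).Holds σ ↔ σ .cll = 1 := Iff.rfl

end Fml

namespace HP
variable {n : ℕ} (σ σ' : Val n)

theorem rel_assign (x : DVar n) (a : Term n) :
    HP.Rel (.assign x a) σ σ' ↔ σ' = Function.update σ x (a.eval σ) := Iff.rfl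
theorem rel_any (x : DVar n) :
    HP.Rel (.any x) σ σ' ↔ ∃ r : ℝ, σ' = Function.update σ x r := Iff.rfl
theorem rel_choice (α β : HP n) : HP.Rel (.choice α β) σ σ' ↔ α.Rel σ σ' ∨ β.Rel σ σ' := Iff.rfl
theorem rel_test (φ : Fml n) : HP.Rel (.test φ) σ σ' ↔ σ' = σ ∧ φ.Holds σ := Iff.rfl
theorem rel_seq (α β : HP n) : HP.Rel (.seq α β) σ σ' ↔ ∃ σ₁, α.Rel σ σ₁ ∧ β.Rel σ₁ σ' := Iff.rfl
theorem rel_skip : HP.skip.Rel σ σ' ↔ σ' = σ := by simp [HP.skip, rel_test]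
theorem rel_seqs_nil : (HP.seqs []).Rel σ σ' ↔ σ' = σ := rel_skip σ σ'
theorem rel_seqs_cons (α : HP n) (αs : List (HP n)) :
    (HP.seqs (α :: αs)).Rel σ σ' ↔ ∃ σ₁, α.Rel σ σ₁ ∧ (HP.seqs αs).Rel σ₁ σ' := Iff.rfl
theorem rel_fail : HP.fail.Rel σ σ' ↔ σ' = Function.update σ .cll 1 := Iff.rfl
theorem rel_check (φ : Fml n) : (HP.check φ).Rel σ σ' ↔
    (σ' = σ ∧ φ.Holds σ) ∨ (¬ φ.Holds σ ∧ σ' = Function.update σ .cll 1) := by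
  simp only [HP.check, rel_choice, rel_test, rel_seq, rel_fail, Fml.holds_neg]
  constructor
  · rintro (h | ⟨_, ⟨rfl, h⟩, rfl⟩)
    · exact Or.inl h
    · exact Or.inr ⟨h, rfl⟩
  · rintro (h | ⟨h, rfl⟩)
    · exact Or.inl h
    · exact Or.inr ⟨_, ⟨rfl, h⟩, rfl⟩

end HP

section
variable {n : ℕ} (o : ℕ) (ρ : Fin n → ℝ) (τ : ℕ → ℝ) (b : Bool) (t r : ℝ)

theorem BExpr.holds_trans_state (g : BExpr (PVar n)) (σ : Val n) :
    g.trans.Holds σ ↔ g.holds fun x => σ (.prog x) := by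
  induction g <;> simp_all [BExpr.trans, BExpr.holds, Expr.eval_trans_state]

theorem BExpr.holds_trans (g : BExpr (PVar n)) :
    g.trans.Holds (stateOf o ρ τ b t r) ↔ g.holds (env o ρ τ) :=
  g.holds_trans_state _

/-- The part of a guard that speaks about the fields. -/
def Guard.stateCond (g : Guard n) (σ : PVar n → ℝ) : Prop :=
  match g with
  | .diff e => e.holds σ
  | _ => True

/-- How a guard limits the time, as a condition on the program variables. -/
def Guard.stateLimit (g : Guard n) (σ : PVar n → ℝ) : Prop :=
  match g with
  | .diff e => e.weakNeg.holds σ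
  | _ => True

theorem Guard.holds_trans (g : Guard n) :
    g.trans.Holds (stateOf o ρ τ b t r) ↔ g.stateCond (env o ρ τ) := by
  cases g <;> simp [Guard.trans, Guard.stateCond, BExpr.holds_trans]

theorem Guard.holds_limit (g : Guard n) :
    g.limit.Holds (stateOf o ρ τ b t r) ↔ g.stateLimit (env o ρ τ) := by
  cases g <;> simp [Guard.limit, Guard.stateLimit, BExpr.holds_trans]

theorem Guard.stateCond_of_holds {futs : ℕ → FutSt} {σ : PVar n → ℝ} {g : Guard n}
    (h : g.holds futs σ) : g.stateCond σ := by
  cases g <;> simp_all [Guard.holds, Guard.stateCond]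

theorem rel_anyLhs (x : Option (Lhs n)) (v : ℝ) :
    (HP.anyLhs x).Rel (stateOf o ρ τ b t r)
      (stateOf o (setHeap x v ρ) (setLoc x v τ) b t r) := by
  cases x with
  | none => exact (HP.rel_skip _ _).2 rfl
  | some x => exact (HP.rel_any _ _ _).2 ⟨v, (update_stateOf_toPVar o ρ τ b t r x v).symm⟩

theorem rel_seqs_any (l : List (Fin n)) (ρ' : Fin n → ℝ) (h : ∀ i, i ∉ l → ρ' i = ρ i) :
    (HP.seqs (l.map fun i => .any (fieldVar i))).Rel (stateOf o ρ τ b t r)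
      (stateOf o ρ' τ b t r) := by
  induction l generalizing ρ with
  | nil =>
    have : ρ' = ρ := funext fun i => h i (by simp)
    subst this; exact (HP.rel_seqs_nil _ _).2 rfl
  | cons j l ih =>
    refine (HP.rel_seqs_cons _ _ _ _).2 ⟨_, (HP.rel_any _ _ _).2 ⟨ρ' j, rfl⟩, ?_⟩
    rw [update_stateOf_fieldVar]
    refine ih _ fun i hi => ?_
    by_cases hij : i = j
    · subst hij; simp
    · simpa [hij] using h i (by simp [hij, hi])

theorem rel_havoc (ρ' : Fin n → ℝ) :
    HP.havoc.Rel (stateOf o ρ τ b t r) (stateOf o ρ' τ b t r) :=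
  rel_seqs_any o ρ τ b t r _ ρ' (by simp)

theorem rel_havocPh {K : Type} (c : ClassDecl K n) (ρ' : Fin n → ℝ)
    (h : ∀ i, c.ode i = none → ρ' i = ρ i) :
    c.havocPh.Rel (stateOf o ρ τ b t r) (stateOf o ρ' τ b t r) :=
  rel_seqs_any o ρ τ b t r _ ρ' fun i hi => h i (by simpa using hi)

@[simp] theorem holds_invFml {K : Type} (c : ClassDecl K n) (σ : Val n) :
    c.invFml.Holds σ ↔ c.inv (fun i => σ (fieldVar i)) := Iff.rfl

/-- The initial values read only the parameters, which are local variables, so the successive field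
assignments do not interfere with each other. -/
theorem rel_initFields {k : ℕ} (init : Fin n → Expr (Fin k)) (l : List (Fin n)) (ρ' : Fin n → ℝ)
    (h : ∀ i, ρ' i = if i ∈ l then (init i).eval (fun j : Fin k => τ j) else ρ i) :
    (HP.seqs (l.map fun i =>
        .assign (fieldVar i) ((init i).rename fun j : Fin _ => locVar j.val))).Rel
      (stateOf o ρ τ b t r) (stateOf o ρ' τ b t r) := by
  induction l generalizing ρ with
  | nil =>
    have : ρ' = ρ := funext fun i => by simpa using h i
    subst this; exact (HP.rel_seqs_nil _ _).2 rfl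
  | cons j l ih =>
    refine (HP.rel_seqs_cons _ _ _ _).2 ⟨_, (HP.rel_assign _ _ _ _).2 rfl, ?_⟩
    rw [update_stateOf_fieldVar]
    refine ih _ fun i => ?_
    rw [h i]
    by_cases hij : i = j
    · subst hij; simp [Expr.eval_rename]
    · simp [hij]

end

/-- The state after the fields have evolved to `ρ` and the clock `t` to `u`. -/
def flowState {n : ℕ} (σ : Val n) (ρ : Fin n → ℝ) (u : ℝ) : Val n
  | .prog (.field i) => ρ i
  | .t => u
  | x => σ x

theorem flowState_stateOf {n : ℕ} (o : ℕ) (ρ ρ' : Fin n → ℝ) (τ : ℕ → ℝ) (b : Bool) (t t' r : ℝ) :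
    flowState (stateOf o ρ τ b t r) ρ' t' = stateOf o ρ' τ b t' r := by
  funext x
  rcases x with (i | _ | _) | _ | _ | _ <;> rfl

/-- Connects the two notions of evolution: a solution on the half-line, cut off at `u`, is an
evolution of the hybrid program, with the clock advancing at rate 1. -/
theorem rel_flow {K : Type} {n : ℕ} {c : ClassDecl K n} {dom : Fml n} {σ : Val n}
    {f : ℝ → Fin n → ℝ} (hf : IsSolution c.ode (fun i => σ (fieldVar i)) f) {u : ℝ} (hu : 0 ≤ u)
    (hdom : ∀ s ∈ Set.Icc 0 u, dom.Holds (flowState σ (f s) (σ .t + s))) :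
    (c.flow dom).Rel σ (flowState σ (f u) (σ .t + u)) := by
  refine ⟨u, fun s => flowState σ (f s) (σ .t + s), hu, ?_, rfl,
    fun s hs => ⟨hdom s hs, ?_, ?_⟩⟩
  · funext x
    rcases x with (i | _ | _) | _ | _ | _
    · exact congrFun hf.1 i
    · rfl
    · rfl
    · exact add_zero _
    · rfl
    · rfl
  · intro p hp
    rcases List.mem_cons.1 hp with rfl | hp
    · have : HasDerivWithinAt (fun v : ℝ => σ .t + v) 1 (Set.Icc 0 u) s :=
        (hasDerivWithinAt_id s _).const_add _
      simpa [Expr.eval, flowState] using this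
    · obtain ⟨i, -, hi⟩ := List.mem_filterMap.1 hp
      obtain ⟨e, he, rfl⟩ := Option.map_eq_some_iff.1 hi
      have h := hf.2 s hs.1 i
      rw [he] at h
      simpa [Expr.eval_rename, fieldVar, flowState] using h.mono Set.Icc_subset_Ici_self
  -- A physical field occurs in the list, contrary to `hx`; every other variable is constant in both
  -- notions of evolution.
  · intro x hx
    rcases x with (i | _ | _) | _ | _ | _
    · have h := hf.2 s hs.1 i
      cases hi : c.ode i with
      | none => rw [hi] at h; exact h
      | some e =>
        exact absurd (List.mem_map.2 ⟨(fieldVar i, e.rename fieldVar), List.mem_cons_of_mem _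
          (List.mem_filterMap.2 ⟨i, List.mem_finRange i, by simp [hi]⟩), rfl⟩) hx
    · rfl
    · rfl
    · simp at hx
    · rfl
    · rfl

/-- The box in `pr` quantifies over all evolutions from `t = 0`, in particular over the given
solution, along which `t` is the elapsed time. -/
theorem ClassDecl.inv_flow_of_pr {K : Type} {n : ℕ} {c : ClassDecl K n} {ψ : Fml n} {σ : Val n}
    (h : (c.pr ψ).Holds σ) {f : ℝ → Fin n → ℝ} (hf : IsSolution c.ode (fun i => σ (fieldVar i)) f)
    {u : ℝ} (hu : 0 ≤ u) (hψ : ∀ s ∈ Set.Icc 0 u, ψ.Holds (flowState σ (f s) s)) :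
    c.inv (f u) := by
  have hfs : ∀ (ρ : Fin n → ℝ) s, flowState (Function.update σ .t 0) ρ s = flowState σ ρ s := by
    intro ρ s
    funext x
    rcases x with (i | _ | _) | _ | _ | _ <;> simp [flowState]
  refine h.2 (flowState σ (f u) u) ⟨_, rfl, ?_⟩
  have := rel_flow (c := c) (dom := ψ) (σ := Function.update σ .t 0) hf hu
    (by simpa [hfs] using hψ)
  simpa [Expr.eval, HP.Rel, hfs] using this

/-! # Weakest preconditions of remaining code -/

/-- The statement is a sequence. Loaded code does not contain sequences at the top level. -/
def Stmt.IsSeq {K : Type} {n : ℕ} : Stmt K n → Prop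
  | .seq _ _ => True
  | _ => False

section
variable {K : Type} {nf : K → ℕ} (P : Prog K nf) (C : Option K)

/-- The invariant holds now, and along every solution of the ODE. -/
def Prog.StaysInv (ρ : Fin (nfo nf C) → ℝ) : Prop :=
  (P.decl C).inv ρ ∧
    ∀ f, IsSolution (P.decl C).ode ρ f → ∀ u, 0 ≤ u → (P.decl C).inv (f u)

/-- What has to hold when a process that runs `m` terminates with the value `v`. -/
def Prog.ExitCond (m : Option ℕ) (v : ℝ) (σ : Val (nfo nf C)) : Prop :=
  σ .cll = 0 ∧ P.StaysInv C (fun i => σ (fieldVar i)) ∧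
    ∀ m' d, m = some m' → (P.decl C).meths m' = some d → d.post (fun i => σ (fieldVar i)) v

/-- Every execution of the translated code ends in a state that satisfies the exit condition. -/
def Prog.CodeWP (m : Option ℕ) : List (RStmt K (nfo nf C)) → Val (nfo nf C) → Prop
  | .stmt s :: k => fun σ => s.GuardsWeak ∧ ¬ s.IsSeq ∧
      ∀ σ', (P.trans (basicRegions nf) C s).Rel σ σ' → Prog.CodeWP m k σ'
  | .ret e :: _ => fun σ => P.ExitCond C m (e.trans.eval σ) σ
  | _ => fun _ => False

/-- The weakest precondition of the code holds in the given stores; `b` tells whether a check has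
failed before. -/
def Prog.CodeOK (m : Option ℕ) (o : ℕ) (b : Bool) (k : List (RStmt K (nfo nf C)))
    (ρ : Fin (nfo nf C) → ℝ) (τ : ℕ → ℝ) : Prop :=
  ∃ t r, P.CodeWP C m k (stateOf o ρ τ b t r)

variable {P C} {m : Option ℕ} {o : ℕ} {b : Bool} {k : List (RStmt K (nfo nf C))}
  {ρ : Fin (nfo nf C) → ℝ} {τ : ℕ → ℝ}

/-- Flattening a sequence into the list of remaining code corresponds to relational composition. -/
theorem Prog.CodeWP.load {s : Stmt K (nfo nf C)} (hw : s.GuardsWeak) {σ : Val (nfo nf C)}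
    (h : ∀ σ', (P.trans (basicRegions nf) C s).Rel σ σ' → P.CodeWP C m k σ') :
    P.CodeWP C m (s.load k) σ := by
  induction s generalizing k σ with
  | seq s₁ s₂ ih₁ ih₂ =>
    exact ih₁ hw.1 fun σ₁ h₁ => ih₂ hw.2 fun σ₂ h₂ => h σ₂ ⟨σ₁, h₁, h₂⟩
  | _ => exact ⟨hw, id, h⟩

theorem Prog.CodeOK.skip (h : P.CodeOK C m o b (.stmt .skip :: k) ρ τ) :
    P.CodeOK C m o b k ρ τ := by
  obtain ⟨t, r, -, -, h⟩ := h
  exact ⟨t, r, h _ ((HP.rel_skip _ _).2 rfl)⟩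

theorem Prog.CodeOK.assign {x : Option (Lhs (nfo nf C))} {e : Expr (PVar (nfo nf C))}
    (h : P.CodeOK C m o b (.stmt (.assign x (.expr e)) :: k) ρ τ) :
    P.CodeOK C m o b k (setHeap x (e.eval (env o ρ τ)) ρ) (setLoc x (e.eval (env o ρ τ)) τ) := by
  obtain ⟨t, r, -, -, h⟩ := h
  refine ⟨t, r, h _ ?_⟩
  cases x with
  | none => exact (HP.rel_skip _ _).2 rfl
  | some x =>
    refine (HP.rel_assign _ _ _ _).2 ?_
    rw [update_stateOf_toPVar, Expr.eval_trans]

theorem Prog.CodeOK.iteTrue {c : BExpr (PVar (nfo nf C))} {s₁ s₂ : Stmt K (nfo nf C)}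
    (h : P.CodeOK C m o b (.stmt (.ite c s₁ s₂) :: k) ρ τ) (hc : c.holds (env o ρ τ)) :
    P.CodeOK C m o b (s₁.load k) ρ τ := by
  obtain ⟨t, r, hw, -, h⟩ := h
  exact ⟨t, r, .load hw.1 fun σ' hσ => h _
    (.inl ⟨_, ⟨rfl, (BExpr.holds_trans o ρ τ b t r c).2 hc⟩, hσ⟩)⟩

theorem Prog.CodeOK.iteFalse {c : BExpr (PVar (nfo nf C))} {s₁ s₂ : Stmt K (nfo nf C)}
    (h : P.CodeOK C m o b (.stmt (.ite c s₁ s₂) :: k) ρ τ) (hc : ¬ c.holds (env o ρ τ)) :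
    P.CodeOK C m o b (s₂.load k) ρ τ := by
  obtain ⟨t, r, hw, -, h⟩ := h
  exact ⟨t, r, .load hw.2 fun σ' hσ => h _
    (.inr ⟨_, ⟨rfl, fun h => hc ((BExpr.holds_trans o ρ τ b t r c).1 h)⟩, hσ⟩)⟩

/-- The runtime unfolds a loop once; the executions of the unfolded code are among those of the
iteration. -/
theorem Prog.CodeOK.loop {c : BExpr (PVar (nfo nf C))} {s : Stmt K (nfo nf C)}
    (h : P.CodeOK C m o b (.stmt (.loop c s) :: k) ρ τ) :
    P.CodeOK C m o b (.stmt (.ite c (.seq s (.loop c s)) .skip) :: k) ρ τ := by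
  obtain ⟨t, r, hw, -, h⟩ := h
  refine ⟨t, r, ⟨⟨hw, hw⟩, trivial⟩, id, fun σ' hσ => h _ ?_⟩
  -- Either one pass through the body is put in front of the remaining iterations, or there are no
  -- iterations.
  rcases hσ with ⟨σ₁, h₁, σ₂, h₂, σ₃, h₃, h₄⟩ | ⟨σ₁, h₁, h₂⟩
  · exact ⟨σ₃, .head ⟨σ₁, h₁, h₂⟩ h₃, h₄⟩
  · obtain rfl := (HP.rel_skip _ _).1 h₂
    obtain ⟨rfl, h₁⟩ := h₁
    exact ⟨_, .refl, rfl, h₁⟩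

theorem Prog.trans_call (x : Option (Lhs (nfo nf C))) (e : Expr (PVar (nfo nf C))) (D : K)
    (m' : ℕ) (args : List (Expr (PVar (nfo nf C)))) :
    P.trans (basicRegions nf) C (.assign x (.call e D m' args)) =
      .seq (HP.check (P.callPre D m' args)) (HP.anyLhs x) := by
  cases x <;> rfl

theorem Prog.trans_new (x : Option (Lhs (nfo nf C))) (D : K)
    (args : List (Expr (PVar (nfo nf C)))) :
    P.trans (basicRegions nf) C (.assign x (.new D args)) =
      .seq (HP.check (P.newPre D args)) (HP.anyLhs x) := by
  cases x <;> rfl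

theorem Prog.trans_get (x : Option (Lhs (nfo nf C))) (e : Expr (PVar (nfo nf C))) :
    P.trans (basicRegions nf) C (.assign x (.get e)) =
      .choice
        (HP.seqs [.test ((P.decl C).pr Fml.tru), (P.decl C).havocPh, .test (P.decl C).invFml,
          HP.anyLhs x])
        (HP.seqs [.test (.neg ((P.decl C).pr Fml.tru)), HP.fail, (P.decl C).havocPh,
          HP.anyLhs x]) := by
  cases x <;> rfl

/-- Common core of calls and object creation: the future or object identity chosen at runtime is one
of the values of `v := *`, and whether the check succeeds decides if the flag is kept or raised. -/
theorem Prog.CodeOK.of_check {s : Stmt K (nfo nf C)} {φ : Fml (nfo nf C)}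
    {x : Option (Lhs (nfo nf C))}
    (hs : P.trans (basicRegions nf) C s = .seq (HP.check φ) (HP.anyLhs x))
    (h : P.CodeOK C m o b (.stmt s :: k) ρ τ) (v : ℝ) :
    ((∃ t r, φ.Holds (stateOf o ρ τ b t r)) ∧
        P.CodeOK C m o b k (setHeap x v ρ) (setLoc x v τ)) ∨
      P.CodeOK C m o true k (setHeap x v ρ) (setLoc x v τ) := by
  obtain ⟨t, r, -, -, h⟩ := h
  rw [hs] at h
  by_cases hφ : φ.Holds (stateOf o ρ τ b t r)
  · exact .inl ⟨⟨t, r, hφ⟩, t, r, h _ ⟨_, (HP.rel_check _ _ _).2 (.inl ⟨rfl, hφ⟩),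
      rel_anyLhs o ρ τ b t r x v⟩⟩
  · refine .inr ⟨t, r, h _ ⟨_, (HP.rel_check _ _ _).2 (.inr ⟨hφ, rfl⟩), ?_⟩⟩
    rw [update_stateOf_cll]
    exact rel_anyLhs o ρ τ true t r x v

theorem holds_argTerms {n a : ℕ} (R : (Fin a → ℝ) → Prop) (args : List (Expr (PVar n)))
    (o : ℕ) (ρ : Fin n → ℝ) (τ : ℕ → ℝ) (b : Bool) (t r : ℝ)
    (h : Fml.Holds (.pred a R fun i => argTerm args i) (stateOf o ρ τ b t r)) :
    R fun j => (args.map fun e => e.eval (env o ρ τ)).getD j 0 := by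
  rw [Fml.holds_pred] at h
  convert h using 2 with j
  rw [argTerm, Expr.eval_trans]
  by_cases hj : (j : ℕ) < args.length
  · simp [List.getD, hj]
  · simp [List.getD, hj, Expr.eval]

theorem initLoc_val {a : ℕ} (args : List ℝ) (j : Fin a) : initLoc a args j = args.getD j 0 :=
  if_pos j.2

theorem Prog.CodeOK.call {x : Option (Lhs (nfo nf C))} {e : Expr (PVar (nfo nf C))} {D : K}
    {m' : ℕ} {args : List (Expr (PVar (nfo nf C)))}
    (h : P.CodeOK C m o b (.stmt (.assign x (.call e D m' args)) :: k) ρ τ) (v : ℝ) :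
    ((∀ d, (P.cls D).meths m' = some d →
          d.pre fun j => initLoc d.arity (args.map fun a => a.eval (env o ρ τ)) j) ∧
        P.CodeOK C m o b k (setHeap x v ρ) (setLoc x v τ)) ∨
      P.CodeOK C m o true k (setHeap x v ρ) (setLoc x v τ) := by
  refine (h.of_check (P.trans_call x e D m' args) v).imp_left
    fun ⟨⟨t, r, hφ⟩, h'⟩ => ⟨fun d hd => ?_, h'⟩
  simp only [initLoc_val]
  rw [Prog.callPre, hd] at hφ
  exact holds_argTerms _ _ _ _ _ _ _ _ hφ

theorem Prog.CodeOK.new {x : Option (Lhs (nfo nf C))} {D : K}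
    {args : List (Expr (PVar (nfo nf C)))}
    (h : P.CodeOK C m o b (.stmt (.assign x (.new D args)) :: k) ρ τ) (v : ℝ) :
    ((P.cls D).pre (fun j => (args.map fun a => a.eval (env o ρ τ)).getD j 0) ∧
        P.CodeOK C m o b k (setHeap x v ρ) (setLoc x v τ)) ∨
      P.CodeOK C m o true k (setHeap x v ρ) (setLoc x v τ) := by
  refine (h.of_check (P.trans_new x D args) v).imp_left fun ⟨⟨t, r, hφ⟩, h'⟩ => ⟨?_, h'⟩
  exact holds_argTerms _ _ _ _ _ _ _ _ hφ

/-- While the limit of the guard is respected, the invariant holds along every solution. -/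
def Prog.InvWhile (P : Prog K nf) (C : Option K) (o : ℕ) (g : Guard (nfo nf C))
    (ρ : Fin (nfo nf C) → ℝ) (τ : ℕ → ℝ) : Prop :=
  (P.decl C).inv ρ ∧ ∀ f, IsSolution (P.decl C).ode ρ f → ∀ u, 0 ≤ u →
    (∀ s ∈ Set.Icc 0 u, g.stateLimit (env o (f s) τ)) → (P.decl C).inv (f u)

/-- Other processes may change all fields before reactivation; `havoc` covers whatever store they
leave behind. The subsequent test is passed because of the invariant or, after an earlier failure,
because of `cll = 1`. -/
theorem Prog.CodeOK.await {p : ℕ} {g : Guard (nfo nf C)}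
    (h : P.CodeOK C m o b (.stmt (.await p g) :: k) ρ τ) :
    (P.InvWhile C o g ρ τ ∧ ∀ ρ', (b = true ∨ (P.decl C).inv ρ') →
        g.stateCond (env o ρ' τ) → P.CodeOK C m o b k ρ' τ) ∨
      ∀ ρ', g.stateCond (env o ρ' τ) → P.CodeOK C m o true k ρ' τ := by
  obtain ⟨t, r, -, -, h⟩ := h
  by_cases hφ : ((P.decl C).pr (.conj Fml.tru g.limit)).Holds (stateOf o ρ τ b t r)
  · refine .inl ⟨⟨hφ.1, fun f hf u hu hl =>
      ClassDecl.inv_flow_of_pr hφ hf hu fun s hs => ⟨Fml.holds_tru _, by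
        rw [flowState_stateOf]
        exact (Guard.holds_limit _ _ _ _ _ _ g).2 (hl s hs)⟩⟩, fun ρ' hb hg => ?_⟩
    refine ⟨t, r, h _ (.inl ⟨_, ⟨rfl, hφ⟩, _, rel_havoc o ρ τ b t r ρ', _, ⟨rfl, ?_⟩,
      (HP.rel_skip _ _).2 rfl⟩)⟩
    refine ⟨(Guard.holds_trans _ _ _ _ _ _ g).2 hg, (Fml.holds_disj _ _ _).2 ?_⟩
    rcases hb with rfl | hb
    · exact .inr ((Fml.holds_cllOne _).2 rfl)
    · exact .inl hb
  · refine .inr fun ρ' hg => ⟨t, r, h _ (.inr ⟨_, ⟨rfl, hφ⟩, _, (HP.rel_fail _ _).2 rfl, _, ?_,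
      _, ⟨rfl, (Guard.holds_trans o ρ' τ true t r g).2 hg⟩, (HP.rel_skip _ _).2 rfl⟩)⟩
    rw [update_stateOf_cll]
    exact rel_havoc o ρ τ true t r ρ'

/-- A process that is blocked by `x = e.get`. -/
def Prog.GetGood (P : Prog K nf) (C : Option K) (m : Option ℕ) (o : ℕ) (b : Bool)
    (x : Option (Lhs (nfo nf C))) (k : List (RStmt K (nfo nf C)))
    (f : ℝ → Fin (nfo nf C) → ℝ) (τ : ℕ → ℝ) : Prop :=
  ((b = false → ∀ u, 0 ≤ u → (P.decl C).inv (f u)) ∧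
    ∀ u, 0 ≤ u → ∀ v, P.CodeOK C m o b k (setHeap x v (f u)) (setLoc x v τ))

/-- A process that waits for a future is not preempted, so the store changes only along `f`, and
`havocPh` reaches `f u` for every `u`. The conclusion speaks about the whole of `f` because the wait
may be split into several time steps during which the code stays the same. -/
theorem Prog.CodeOK.get {x : Option (Lhs (nfo nf C))} {e : Expr (PVar (nfo nf C))}
    (h : P.CodeOK C m o b (.stmt (.assign x (.get e)) :: k) ρ τ) {f : ℝ → Fin (nfo nf C) → ℝ}
    (hf : IsSolution (P.decl C).ode ρ f) :
    P.GetGood C m o b x k f τ ∨ P.GetGood C m o true x k f τ := by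
  have hph : ∀ u, 0 ≤ u → ∀ i, (P.decl C).ode i = none → f u i = ρ i := fun u hu i hi => by
    have := hf.2 u hu i
    rwa [hi] at this
  obtain ⟨t, r, -, -, h⟩ := h
  rw [P.trans_get] at h
  by_cases hφ : ((P.decl C).pr Fml.tru).Holds (stateOf o ρ τ b t r)
  · have hinv : ∀ u, 0 ≤ u → (P.decl C).inv (f u) := fun u hu =>
      ClassDecl.inv_flow_of_pr hφ hf hu fun s hs => Fml.holds_tru _
    refine .inl ⟨fun _ => hinv, fun u hu v => ⟨t, r, h _ (.inl ⟨_, ⟨rfl, hφ⟩, _,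
      rel_havocPh o ρ τ b t r _ (f u) (hph u hu), _, ⟨rfl, hinv u hu⟩, _,
      rel_anyLhs o (f u) τ b t r x v, (HP.rel_skip _ _).2 rfl⟩)⟩⟩
  · refine .inr ⟨nofun, fun u hu v => ⟨t, r, h _ (.inr ⟨_, ⟨rfl, hφ⟩, _, (HP.rel_fail _ _).2 rfl,
      _, ?_, _, rel_anyLhs o (f u) τ true t r x v, (HP.rel_skip _ _).2 rfl⟩)⟩⟩
    rw [update_stateOf_cll]
    exact rel_havocPh o ρ τ true t r _ (f u) (hph u hu)

/-- A process that is blocked by `duration(e)`. After a failed check this includes the case that it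
remains blocked forever. -/
def Prog.DurationGood (P : Prog K nf) (C : Option K) (m : Option ℕ) (o : ℕ) (b : Bool)
    (e : Expr (PVar (nfo nf C))) (k : List (RStmt K (nfo nf C)))
    (f : ℝ → Fin (nfo nf C) → ℝ) (τ : ℕ → ℝ) : Prop :=
  (b = true ∧ e.eval (env o (f 0) τ) < 0) ∨
  ((b = false → (P.decl C).inv (f 0)) ∧
    ∀ u, 0 ≤ u → (∀ s ∈ Set.Icc 0 u, s ≤ e.eval (env o (f s) τ)) →
      (b = false → (P.decl C).inv (f u)) ∧
      (e.eval (env o (f u) τ) ≤ u → P.CodeOK C m o b k (f u) τ))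

/-- The check takes place when the process arrives at the statement. It fixes the flag for the whole
waiting period, whose end is the moment at which the elapsed time reaches the value of `e`. -/
theorem Prog.CodeOK.duration {e : Expr (PVar (nfo nf C))}
    (h : P.CodeOK C m o b (.stmt (.duration e) :: k) ρ τ) {f : ℝ → Fin (nfo nf C) → ℝ}
    (hf : IsSolution (P.decl C).ode ρ f) :
    P.DurationGood C m o b e k f τ ∨ P.DurationGood C m o true e k f τ := by
  obtain ⟨t, r, -, -, h⟩ := h
  -- Here `b'` is the flag after the check, so that both outcomes are treated at once.
  have key : ∀ b' : Bool, (HP.check ((P.decl C).pr (.le (.var .t) e.trans))).Rel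
      (stateOf o ρ τ b 0 r) (stateOf o ρ τ b' 0 r) → ∀ u, 0 ≤ u →
      (∀ s ∈ Set.Icc 0 u, s ≤ e.eval (env o (f s) τ)) → e.eval (env o (f u) τ) ≤ u →
      P.CodeOK C m o b' k (f u) τ := by
    intro b' hb u hu hs he
    -- The clock variable is reset after the check and then runs for `u` time units, hence its final
    -- value.
    refine ⟨0 + u, r, h _ ⟨_, (HP.rel_assign _ _ _ _).2 rfl, stateOf o ρ τ b' 0 r, ?_, _,
      (HP.rel_assign _ _ _ _).2 rfl, stateOf o (f u) τ b' (0 + u) r, ?_, _, ⟨rfl, ?_⟩,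
      (HP.rel_skip _ _).2 rfl⟩⟩
    · change HP.Rel _ _ _
      simpa [Expr.eval] using hb
    · rw [update_stateOf_t]
      have := rel_flow (σ := stateOf o ρ τ b' 0 r) (dom := .le (.var .t) e.trans) hf hu
        (by simpa [Expr.eval, flowState_stateOf] using hs)
      rwa [flowState_stateOf] at this
    · change Fml.Holds _ _
      simpa [Expr.eval] using he
  by_cases hφ : ((P.decl C).pr (.le (.var .t) e.trans)).Holds (stateOf o ρ τ b 0 r)
  · refine .inl (.inr ⟨fun _ => hf.1 ▸ hφ.1,
      fun u hu hs => ⟨fun _ => ?_, key b ((HP.rel_check _ _ _).2 (.inl ⟨rfl, hφ⟩)) u hu hs⟩⟩)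
    exact ClassDecl.inv_flow_of_pr hφ hf hu (by simpa [Expr.eval, flowState_stateOf] using hs)
  · exact .inr (.inr ⟨nofun, fun u hu hs => ⟨nofun,
      key true ((HP.rel_check _ _ _).2 (.inr ⟨hφ, (update_stateOf_cll _ _ _ _ _ _).symm⟩)) u hu hs⟩⟩)

end

/-! # Solutions of the ODE -/

section
variable {n : ℕ} {ode : Fin n → Option (Expr (Fin n))} {ρ : Fin n → ℝ} {f : ℝ → Fin n → ℝ}

/-- The ODE is autonomous. -/
theorem IsSolution.shift (h : IsSolution ode ρ f) {x : ℝ} (hx : 0 ≤ x) :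
    IsSolution ode (f x) (fun u => f (x + u)) := by
  refine ⟨by simp, fun s hs i => ?_⟩
  have h₁ := h.2 (x + s) (by positivity) i
  have h₂ := h.2 x hx i
  cases hi : ode i with
  | none =>
    rw [hi] at h₁ h₂
    exact h₁.trans h₂.symm
  | some e =>
    rw [hi] at h₁
    have hg : HasDerivWithinAt (fun v : ℝ => x + v) 1 (Set.Ici 0) s :=
      (hasDerivWithinAt_id s _).const_add x
    have := h₁.comp s hg fun v (hv : 0 ≤ v) => add_nonneg hx hv
    simpa [Function.comp_def] using this

theorem IsSolution.continuousOn (h : IsSolution ode ρ f) : ContinuousOn f (Set.Ici 0) := by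
  refine continuousOn_pi.2 fun i s hs => ?_
  cases hi : ode i with
  | none =>
    have hc : ∀ u ∈ Set.Ici (0 : ℝ), f u i = ρ i := fun u hu => by
      have := h.2 u hu i
      rwa [hi] at this
    exact (continuousWithinAt_const (b := ρ i)).congr hc (hc s hs)
  | some e =>
    have := h.2 s hs i
    rw [hi] at this
    exact this.continuousWithinAt

theorem IsSolution.heap_eq (h : IsSolution ode ρ f) {s : ℝ} (hs : 0 ≤ s) (i : Fin n) :
    (if (ode i).isSome then f s i else ρ i) = f s i := by
  have := h.2 s hs i
  cases hi : ode i with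
  | none => rw [hi] at this; simp [this]
  | some e => simp

end

/-! ### Weak negation along a solution -/

/-- A weak inequality that fails is strict in the other direction. The converse is false: at
equality an atom and its weak negation both hold. -/
theorem BExpr.weakNeg_of_not_holds {V : Type} {σ : V → ℝ} {g : BExpr V} (hw : g.IsWeak)
    (h : ¬ g.holds σ) : g.weakNeg.holds σ := by
  induction g with
  | tt => exact absurd trivial h
  | le a b => exact (not_le.1 h).le
  | ge a b => exact (not_le.1 h).le
  | and a b iha ihb =>
    rcases not_and_or.1 h with h | h
    · exact .inl (iha hw.1 h)
    · exact .inr (ihb hw.2 h)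
  | or a b iha ihb =>
    exact ⟨iha hw.1 fun h' => h (.inl h'), ihb hw.2 fun h' => h (.inr h')⟩
  | not a => exact hw.elim

theorem BExpr.isClosed_weakNeg {V : Type} {g : BExpr V} (hw : g.IsWeak) :
    IsClosed {σ : V → ℝ | g.weakNeg.holds σ} := by
  induction g with
  | tt => simp [BExpr.weakNeg, BExpr.holds]
  | le a b => exact isClosed_le hw.2 hw.1
  | ge a b => exact isClosed_le hw.1 hw.2
  | and a b iha ihb => exact (iha hw.1).union (ihb hw.2)
  | or a b iha ihb => exact (iha hw.1).inter (ihb hw.2)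
  | not a => exact hw.elim

theorem continuousOn_env {n : ℕ} (o : ℕ) {f : ℝ → Fin n → ℝ} (τ : ℕ → ℝ) {s : Set ℝ}
    (hf : ContinuousOn f s) : ContinuousOn (fun u => env o (f u) τ) s := by
  refine continuousOn_pi.2 fun x => ?_
  cases x with
  | field i => exact continuousOn_pi.1 hf i
  | loc y => exact continuousOn_const
  | this => exact continuousOn_const

/-- On `[0, x)` the guard fails, so its weak negation holds; since this is a closed condition and
the solution is continuous, it extends to the closure `[0, x]`. At `x` itself the guard may already
be true, which is why ordinary negation would not do. -/
theorem weakNeg_on_Icc {n : ℕ} {o : ℕ} {f : ℝ → Fin n → ℝ} {τ : ℕ → ℝ} {g : BExpr (PVar n)}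
    (hw : g.IsWeak) (hf : ContinuousOn f (Set.Ici 0)) {x : ℝ}
    (h₀ : ¬ g.holds (env o (f 0) τ)) (h : ∀ u, 0 ≤ u → u < x → ¬ g.holds (env o (f u) τ)) :
    ∀ s ∈ Set.Icc 0 x, g.weakNeg.holds (env o (f s) τ) := by
  intro s hs
  -- The time 0 is separated because `[0, x)` is empty when `x = 0`; there `h₀` is needed.
  rcases hs.1.eq_or_lt with rfl | hs₀
  · exact BExpr.weakNeg_of_not_holds hw h₀
  have hm : Set.MapsTo (fun u => env o (f u) τ) (Set.Ico 0 x) {σ | g.weakNeg.holds σ} :=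
    fun u hu => BExpr.weakNeg_of_not_holds hw (h u hu.1 hu.2)
  have hcl := closure_Ico (hs₀.trans_le hs.2).ne
  have := hm.closure_of_continuousOn (by
    rw [hcl]
    exact (continuousOn_env o τ hf).mono Set.Icc_subset_Ici_self)
  rw [hcl, (BExpr.isClosed_weakNeg hw).closure_eq] at this
  exact this hs

/-! # Correctness of processes and objects -/

section
variable {K : Type} {nf : K → ℕ} (P : Prog K nf) (C : Option K)

/-- Correctness of an active process of an object with dynamics `f`. -/
def Prog.CodeGood (m : Option ℕ) (o : ℕ) (b : Bool) (f : ℝ → Fin (nfo nf C) → ℝ) (τ : ℕ → ℝ) :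
    List (RStmt K (nfo nf C)) → Prop
  | .susp :: k => (∃ p g k', k = .stmt (.await p g) :: k') ∧ P.CodeOK C m o b k (f 0) τ
  | .stmt (.assign x (.get _)) :: k => P.GetGood C m o b x k f τ
  | .stmt (.duration e) :: k => P.DurationGood C m o b e k f τ
  | k => P.CodeOK C m o b k (f 0) τ

def Prog.ActGood (o : ℕ) (b : Bool) (f : ℝ → Fin (nfo nf C) → ℝ) (q : Proc K (nfo nf C)) : Prop :=
  P.CodeGood C q.meth o b f q.loc q.code

/-- Correctness of an inactive process. -/
def Prog.QueGood (o : ℕ) (b : Bool) (q : Proc K (nfo nf C)) : Prop :=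
  (∀ p g k, q.code = .stmt (.await p g) :: k → ∀ ρ, (b = true ∨ (P.decl C).inv ρ) →
    g.stateCond (env o ρ q.loc) →
    P.CodeOK C q.meth o b k ρ q.loc ∨ P.CodeOK C q.meth o true k ρ q.loc) ∧
  ((∀ s ∈ q.code.head?, ¬ s.IsAwait) → ∀ ρ, (b = true ∨ (P.decl C).inv ρ) →
    P.CodeOK C q.meth o b q.code ρ q.loc)

/-- An inactive object, the last active process of which has ensured that the invariant holds until
it can be scheduled again. -/
def Prog.Idle (o : ℕ) (f : ℝ → Fin (nfo nf C) → ℝ) (Q : Multiset (Proc K (nfo nf C))) : Prop :=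
  (P.decl C).inv (f 0) ∧ ((∀ u, 0 ≤ u → (P.decl C).inv (f u)) ∨
    ∃ q ∈ Q, ∃ p g k, q.code = .stmt (.await p g) :: k ∧
      (Stmt.await p g : Stmt K (nfo nf C)).GuardsWeak ∧
      ∀ u, 0 ≤ u → (∀ s ∈ Set.Icc 0 u, g.stateLimit (env o (f s) q.loc)) → (P.decl C).inv (f u))

variable {P C} {m : Option ℕ} {o : ℕ} {b : Bool} {k : List (RStmt K (nfo nf C))}
  {f : ℝ → Fin (nfo nf C) → ℝ} {τ : ℕ → ℝ}

theorem Prog.CodeOK.guardsWeak {s : Stmt K (nfo nf C)} {ρ : Fin (nfo nf C) → ℝ}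
    (h : P.CodeOK C m o b (.stmt s :: k) ρ τ) : s.GuardsWeak := by
  obtain ⟨t, r, h, -⟩ := h
  exact h

/-- When `get` or `duration` comes to the head of the code, its check is evaluated at once, in the
current store. This is why the flag can rise without any runtime step of that statement. -/
theorem Prog.CodeOK.good {ρ : Fin (nfo nf C) → ℝ} (h : P.CodeOK C m o b k ρ τ)
    (hf : IsSolution (P.decl C).ode ρ f) :
    P.CodeGood C m o b f τ k ∨ P.CodeGood C m o true f τ k := by
  have h0 : P.CodeOK C m o b k (f 0) τ := hf.1.symm ▸ h
  rcases k with _ | ⟨s | _ | e, k⟩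
  · exact .inl h0
  · cases s with
    | assign x r =>
      cases r with
      | get e => exact h.get hf
      | _ => exact .inl h0
    | duration e => exact h.duration hf
    | _ => exact .inl h0
  · obtain ⟨t, r, h⟩ := h
    exact h.elim
  · exact .inl h0

/-- A body may begin with `await`, and the process is then scheduled through the guard without ever
having suspended. The translation still performs the check; the reactivation store is taken equal to
the initial one. -/
theorem Prog.QueGood.of_code {q : Proc K (nfo nf C)}
    (h : ∀ ρ, (P.decl C).inv ρ → P.CodeOK C q.meth o false q.code ρ q.loc) :
    P.QueGood C o false q := by
  refine ⟨fun p g k hk ρ hρ hg => ?_, fun _ ρ hρ => h ρ (by simpa using hρ)⟩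
  have hi : (P.decl C).inv ρ := by simpa using hρ
  have h' := h ρ hi
  rw [hk] at h'
  rcases h'.await with h' | h'
  · exact .inl (h'.2 ρ hρ hg)
  · exact .inr (h' ρ hg)

/-- The field store and the dynamics of the object fit together. -/
def Obj.Flows (P : Prog K nf) (ob : Obj K nf) : Prop :=
  IsSolution (P.decl ob.cls).ode ob.heap ob.dyn

/-- All processes of the object with futures in `S` are correct. -/
def Prog.ObjGood (P : Prog K nf) (S : ℕ → Prop) (b : Bool) (o : ℕ) (ob : Obj K nf) : Prop :=
  (∀ q, ob.act = some q → S q.fid → P.ActGood ob.cls o b ob.dyn q) ∧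
  ∀ q ∈ ob.queue, S q.fid → P.QueGood ob.cls o b q

/-- All processes of the object with futures in `S` are correct, possibly after a failed check. -/
def Prog.ObjStep (P : Prog K nf) (S : ℕ → Prop) (b : Bool) (o : ℕ) (ob : Obj K nf) : Prop :=
  (∀ q, ob.act = some q → S q.fid →
    P.ActGood ob.cls o b ob.dyn q ∨ P.ActGood ob.cls o true ob.dyn q) ∧
  ∀ q ∈ ob.queue, S q.fid → P.QueGood ob.cls o b q ∨ P.QueGood ob.cls o true q

variable {S : ℕ → Prop}

theorem Prog.objStep_of_code {ρ : Fin (nfo nf C) → ℝ} {q : Proc K (nfo nf C)}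
    {Q : Multiset (Proc K (nfo nf C))} (hf : IsSolution (P.decl C).ode ρ f)
    (hQ : ∀ q ∈ Q, S q.fid → P.QueGood C o b q)
    (h : S q.fid → P.CodeOK C q.meth o b q.code ρ q.loc ∨
      P.CodeOK C q.meth o true q.code ρ q.loc) :
    P.ObjStep S b o ⟨C, ρ, f, some q, Q⟩ := by
  refine ⟨fun q' hq' hS => ?_, fun q' hq' hS => .inl (hQ q' hq' hS)⟩
  obtain rfl : q = q' := Option.some.inj hq'
  rcases h hS with h | h
  · exact h.good hf
  · exact .inr ((h.good hf).elim id id)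

/-- Only an assignment to a field restarts the dynamics. In all cases the new dynamics solves the
ODE from the new store, and this is all that is needed of it. -/
theorem Obj.store_eq {sol : SolFun nf} (hsol : P.Solves sol) {ob : Obj K nf} (hf : ob.Flows P)
    (q : Proc K (nfo nf ob.cls)) (x : Option (Lhs (nfo nf ob.cls))) (v : ℝ)
    (k : List (RStmt K (nfo nf ob.cls))) :
    ∃ f, IsSolution (P.decl ob.cls).ode (setHeap x v ob.heap) f ∧
      ob.store sol q x v k = ⟨ob.cls, setHeap x v ob.heap, f,
        some ⟨setLoc x v q.loc, q.fid, k, q.meth⟩, ob.queue⟩ := by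
  rcases x with _ | i | y
  · exact ⟨_, hf, rfl⟩
  · exact ⟨_, hsol _ _, rfl⟩
  · exact ⟨_, hf, rfl⟩

theorem Prog.CodeGood.ok_of_head {ρ : Fin (nfo nf C) → ℝ} (hf : IsSolution (P.decl C).ode ρ f)
    (h : P.CodeGood C m o b f τ k)
    (hk : P.CodeGood C m o b f τ k = P.CodeOK C m o b k (f 0) τ) : P.CodeOK C m o b k ρ τ :=
  hf.1 ▸ hk ▸ h

/-! # Discrete steps of an object -/

variable {sol : SolFun nf} {futs : ℕ → FutSt}

theorem LStep.flows (hsol : P.Solves sol) {ob ob' : Obj K nf} (h : LStep sol futs o ob ob')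
    (hf : ob.Flows P) : ob'.Flows P := by
  cases h with
  | susp => exact hsol _ _
  | assign q x e k ha hc =>
    obtain ⟨f, hf', he⟩ := Obj.store_eq hsol hf q x (e.eval (env o ob.heap q.loc)) k
    rw [he]
    exact hf'
  | _ => exact hf

/-- Stated for arbitrary `S` and `b` so that it serves both for all processes without failure and
for one failed process. The invariant is needed only when an idle object schedules a process with
flag 0. -/
theorem LStep.objStep (hsol : P.Solves sol) {ob ob' : Obj K nf} (h : LStep sol futs o ob ob')
    (hf : ob.Flows P) (hg : P.ObjGood S b o ob)
    (hi : b = false → ob.act = none → (P.decl ob.cls).inv ob.heap) : P.ObjStep S b o ob' := by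
  obtain ⟨hact, hque⟩ := hg
  have key : ∀ q, ob.act = some q → S q.fid → P.CodeGood ob.cls q.meth o b ob.dyn q.loc q.code :=
    hact
  have hinv : ob.act = none → b = true ∨ (P.decl ob.cls).inv ob.heap := fun h => by
    cases b with
    | true => exact .inl rfl
    | false => exact .inr (hi rfl h)
  cases h with
  | await q p g k ha hc =>
    refine ⟨fun q' hq' hS => ?_, fun q' hq' hS => .inl (hque q' hq' hS)⟩
    obtain rfl := Option.some.inj hq'
    have h := key q ha hS
    rw [hc] at h
    exact .inl ⟨⟨p, g, k, rfl⟩, h⟩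
  | susp q k ha hc =>
    refine ⟨nofun, fun q' hq' hS => ?_⟩
    rcases Multiset.mem_cons.1 hq' with rfl | hq'
    · have h := key q ha hS
      rw [hc] at h
      obtain ⟨⟨p, g, k', rfl⟩, h⟩ := h
      have hn : ¬ ∀ s ∈ (RStmt.stmt (Stmt.await p g) :: k').head?, ¬ s.IsAwait :=
        fun h => h _ rfl trivial
      -- The check that belongs to `await` is evaluated at suspension, in the store in which the
      -- process releases the object.
      rcases h.await with h | h
      · refine .inl ⟨fun p' g' k'' he ρ hρ hg' => ?_, fun h => (hn h).elim⟩
        cases he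
        exact .inl (h.2 ρ hρ hg')
      · refine .inr ⟨fun p' g' k'' he ρ hρ hg' => ?_, fun h => (hn h).elim⟩
        cases he
        exact .inl (h ρ hg')
    · exact .inl (hque q' hq' hS)
  | schedAwait q Q p g k ha hq hc hg =>
    refine Prog.objStep_of_code hf (fun q' hq' => hque q' ?_) fun hS => ?_
    · rw [hq]; exact Multiset.mem_cons_of_mem hq'
    · exact (hque q (hq ▸ Multiset.mem_cons_self q Q) hS).1 p g k hc _ (hinv ha)
        (Guard.stateCond_of_holds hg)
  | sched q Q ha hq hc =>
    refine Prog.objStep_of_code hf (fun q' hq' => hque q' ?_) fun hS => ?_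
    · rw [hq]; exact Multiset.mem_cons_of_mem hq'
    · exact .inl ((hque q (hq ▸ Multiset.mem_cons_self q Q) hS).2 hc _ (hinv ha))
  | get q x e k fid v ha hc he hv =>
    refine ⟨fun q' hq' hS => ?_, fun q' hq' hS => .inl (hque q' hq' hS)⟩
    obtain rfl := Option.some.inj hq'
    have h := key q ha hS
    rw [hc] at h
    -- The waiting time that has passed is already absorbed in the shifted dynamics, so no further
    -- time is needed.
    obtain ⟨t, r, h⟩ := h.2 0 le_rfl v
    refine .inl ⟨t, r, trivial, id, fun σ' hσ => ?_⟩
    have : σ' = stateOf o (setHeap x v (ob.dyn 0)) (setLoc x v q.loc) b t r := by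
      cases x with
      | none => exact (HP.rel_skip _ _).1 hσ
      | some x => exact ((HP.rel_assign _ _ _ _).1 hσ).trans (update_stateOf_toPVar ..)
    exact this ▸ h
  | assign q x e k ha hc =>
    obtain ⟨f, hf', he⟩ := Obj.store_eq hsol hf q x (e.eval (env o ob.heap q.loc)) k
    rw [he]
    refine Prog.objStep_of_code hf' hque fun hS => ?_
    have h := key q ha hS
    rw [hc] at h
    exact .inl (h.ok_of_head hf rfl).assign
  | loop q c s k ha hc =>
    refine Prog.objStep_of_code hf hque fun hS => ?_
    have h := key q ha hS
    rw [hc] at h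
    exact .inl (h.ok_of_head hf rfl).loop
  | iteTrue q c s₁ s₂ k ha hc hb =>
    refine Prog.objStep_of_code hf hque fun hS => ?_
    have h := key q ha hS
    rw [hc] at h
    exact .inl ((h.ok_of_head hf rfl).iteTrue hb)
  | iteFalse q c s₁ s₂ k ha hc hb =>
    refine Prog.objStep_of_code hf hque fun hS => ?_
    have h := key q ha hS
    rw [hc] at h
    exact .inl ((h.ok_of_head hf rfl).iteFalse hb)
  | skip q k ha hc =>
    refine Prog.objStep_of_code hf hque fun hS => ?_
    have h := key q ha hS
    rw [hc] at h
    exact .inl (h.ok_of_head hf rfl).skip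
  | duration q e k ha hc he =>
    refine Prog.objStep_of_code hf hque fun hS => ?_
    have h := key q ha hS
    rw [hc] at h
    have he' : e.eval (env o (ob.dyn 0) q.loc) = 0 := by rw [hf.1]; exact he
    -- The rule fires only at the value 0: this excludes the process that is stuck with a negative
    -- argument, and it ends the waiting period of the other one at time 0.
    rcases h with h | h
    · exact absurd he' h.2.ne
    · refine .inl (hf.1 ▸ (h.2 0 le_rfl fun s hs => ?_).2 he'.le)
      obtain rfl : s = 0 := le_antisymm hs.2 hs.1
      exact he'.ge

/-- Among the local steps only a suspension leaves the object without an active process; the process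
that has just suspended is the witness for the limit on time. -/
theorem LStep.idle (hsol : P.Solves sol) {ob ob' : Obj K nf} (h : LStep sol futs o ob ob')
    (hf : ob.Flows P) (hg : P.ObjGood (fun _ => True) false o ob) (ha' : ob'.act = none) :
    P.Idle ob'.cls o ob'.dyn ob'.queue ∨ ∃ q ∈ ob'.queue, P.QueGood ob'.cls o true q := by
  cases h with
  | susp q k ha hc =>
    have h : P.CodeGood ob.cls q.meth o false ob.dyn q.loc q.code := hg.1 q ha trivial
    rw [hc] at h
    obtain ⟨⟨p, g, k', rfl⟩, h⟩ := h
    rw [hf.1] at h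
    rcases h.await with h' | h'
    · refine .inl ⟨?_, .inr ⟨_, Multiset.mem_cons_self _ _, p, g, k', rfl, h.guardsWeak,
        h'.1.2 _ (hsol _ _)⟩⟩
      change (P.decl ob.cls).inv (sol ob.cls ob.heap 0)
      rw [(hsol ob.cls ob.heap).1]
      exact h'.1.1
    · refine .inr ⟨_, Multiset.mem_cons_self _ _, fun p' g' k'' he ρ hρ hg' => ?_,
        fun h => (h _ rfl trivial).elim⟩
      cases he
      exact .inl (h' ρ hg')
  | assign q x e k ha hc =>
    obtain ⟨f, hf', he⟩ := Obj.store_eq hsol hf q x (e.eval (env o ob.heap q.loc)) k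
    rw [he] at ha'
    cases ha'
  | _ => cases ha'

/-! # Advance of time in an object -/

theorem Prog.advHeap_eq {ob : Obj K nf} (hf : ob.Flows P) {s : ℝ} (hs : 0 ≤ s) :
    P.advHeap ob s = ob.dyn s :=
  funext fun i => IsSolution.heap_eq hf hs i

theorem Prog.flows_adv {ob : Obj K nf} (hf : ob.Flows P) {s : ℝ} (hs : 0 ≤ s) :
    (P.advObj ob s).Flows P := by
  have := IsSolution.shift hf hs
  rw [← P.advHeap_eq hf hs] at this
  exact this

/-- The process waits for a future or for time to pass. -/
def Proc.Blocked {n : ℕ} (q : Proc K n) : Prop :=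
  (∃ x e k, q.code = .stmt (.assign x (.get e)) :: k) ∨ ∃ e k, q.code = .stmt (.duration e) :: k

theorem Proc.not_le_of_lt_mteBlocked {n : ℕ} {q : Proc K n} {f : ℝ → Fin n → ℝ}
    {e : Expr (PVar n)} {k : List (RStmt K n)} (hq : q.code = .stmt (.duration e) :: k) {u : ℝ}
    (hu : 0 ≤ u) (h : ENNReal.ofReal u < q.mteBlocked o f) :
    u < e.eval (env o (f u) q.loc) := by
  by_contra hle
  rw [Proc.mteBlocked, hq] at h
  exact h.not_ge (iInf₂_le u ⟨hu, not_lt.1 hle⟩)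

/-- Time passes strictly before the end of the waiting period, except possibly at its last moment.
If the invariant is not obtained at `x`, then `x` is such a last moment and the process is stuck
from then on, which counts as a failure. -/
theorem Prog.ActGood.adv {q : Proc K (nfo nf C)} (hq : q.Blocked) (hg : P.ActGood C o b f q)
    {x : ℝ} (hx : 0 ≤ x)
    (hlt : ∀ u, 0 ≤ u → u < x → ENNReal.ofReal u < q.mteBlocked o f) :
    (P.ActGood C o b (fun u => f (x + u)) (q.advActive x) ∨
      P.ActGood C o true (fun u => f (x + u)) (q.advActive x)) ∧
    (b = false → (P.decl C).inv (f x) ∨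
      (¬ ENNReal.ofReal x < q.mteBlocked o f ∧
        P.ActGood C o true (fun u => f (x + u)) (q.advActive x))) := by
  rcases q with ⟨τ, fid, code, m⟩
  rcases hq with ⟨y, e, k, rfl : code = _⟩ | ⟨e, k, rfl : code = _⟩
  · exact ⟨.inl ⟨fun hb u hu => hg.1 hb _ (by positivity), fun u hu => hg.2 _ (by positivity)⟩,
      fun hb => .inl (hg.1 hb x hx)⟩
  · have hev : ∀ u, (Expr.minus e (.const x)).eval (env o (f (x + u)) τ)
        = e.eval (env o (f (x + u)) τ) - x := fun u => rfl
    -- A process with a negative argument has maximal time elapse zero, so that only `x = 0` is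
    -- possible for it.
    rcases hg with ⟨rfl, hneg⟩ | ⟨hi, hg⟩
    · refine ⟨.inl (.inl ⟨rfl, ?_⟩), nofun⟩
      rcases hx.eq_or_lt with rfl | hx
      · change e.eval (env o (f (0 + 0)) τ) - 0 < 0
        simpa using hneg
      · have := Proc.not_le_of_lt_mteBlocked rfl le_rfl (hlt 0 le_rfl hx)
        exact absurd this hneg.not_gt
    -- The argument need not depend continuously on time, so it may drop below `x` exactly at `x`.
    -- Then the decreased argument is negative and the process never continues; it is treated as
    -- failed, although its check has succeeded.
    · by_cases hxe : x ≤ e.eval (env o (f x) τ)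
      · have hdom : ∀ s ∈ Set.Icc 0 x, s ≤ e.eval (env o (f s) τ) := fun s hs => by
          rcases hs.2.eq_or_lt with rfl | hsx
          · exact hxe
          · exact (Proc.not_le_of_lt_mteBlocked rfl hs.1 (hlt s hs.1 hsx)).le
        -- The evolution domain is glued from the part before `x` and the part after it, where the
        -- argument has been decreased by `x`.
        have hdom' : ∀ u, (∀ s ∈ Set.Icc 0 u,
            s ≤ (Expr.minus e (.const x)).eval (env o (f (x + s)) τ)) →
            ∀ s ∈ Set.Icc 0 (x + u), s ≤ e.eval (env o (f s) τ) := fun u hu s hs => by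
          rcases le_total s x with hsx | hsx
          · exact hdom s ⟨hs.1, hsx⟩
          · have := hu (s - x) ⟨by linarith, by linarith [hs.2]⟩
            rw [hev, add_sub_cancel] at this
            linarith
        refine ⟨.inl (.inr ⟨fun hb => ?_, fun u hu hs => ⟨fun hb => ?_, fun hle => ?_⟩⟩),
          fun hb => .inl ((hg x hx hdom).1 hb)⟩
        · have := (hg x hx hdom).1 hb
          simpa using this
        · exact (hg (x + u) (by positivity) (hdom' u hs)).1 hb
        · have hle : e.eval (env o (f (x + u)) τ) - x ≤ u := hle
          exact (hg (x + u) (by positivity) (hdom' u hs)).2 (by linarith)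
      · have hstuck : P.ActGood C o true (fun u => f (x + u))
            (Proc.advActive ⟨τ, fid, .stmt (.duration e) :: k, m⟩ x) := by
          refine .inl ⟨rfl, ?_⟩
          change e.eval (env o (f (x + 0)) τ) - x < 0
          rw [add_zero]
          linarith
        exact ⟨.inr hstuck, fun _ => .inr
          ⟨fun h => hxe (Proc.not_le_of_lt_mteBlocked rfl hx h).le, hstuck⟩⟩

/-- Time changes a queued process only by decreasing the argument of a `duration` guard, and such a
guard contributes no condition on the state. -/
theorem Prog.QueGood.adv {q : Proc K (nfo nf C)} (hg : P.QueGood C o b q) (x : ℝ) :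
    P.QueGood C o b (q.advQueued x) := by
  rcases q with ⟨τ, fid, code, m⟩
  unfold Proc.advQueued
  split
  · rename_i p e k hc
    obtain rfl : code = _ := hc
    refine ⟨fun p' g' k' he ρ hρ _ => ?_, fun h => (h _ rfl trivial).elim⟩
    cases he
    exact hg.1 p _ k rfl ρ hρ trivial
  · exact hg

theorem Proc.not_holds_of_lt_mte {n : ℕ} {q : Proc K n} {f : ℝ → Fin n → ℝ}
    {g : BExpr (PVar n)} {p : ℕ} {k : List (RStmt K n)}
    (hq : q.code = .stmt (.await p (.diff g)) :: k) {u : ℝ}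
    (hu : 0 ≤ u) (h : ENNReal.ofReal u < q.mte o f) : ¬ g.holds (env o (f u) q.loc) := by
  intro hg
  rw [Proc.mte, hq] at h
  exact h.not_ge (iInf₂_le u ⟨hu, hg⟩)

/-- The witness in the queue bounds the elapsed time, so the limit of its guard is respected up to
`x`; other processes can only shorten the step. The process remains a witness for the shifted
dynamics. -/
theorem Prog.Idle.adv {Q : Multiset (Proc K (nfo nf C))} (h : P.Idle C o f Q)
    (hf : ContinuousOn f (Set.Ici 0)) {x : ℝ} (hx : 0 ≤ x)
    (hlt : ∀ u, 0 ≤ u → u < x → ∀ q ∈ Q, ENNReal.ofReal u < q.mte o f)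
    (hns : ∀ q ∈ Q, ∀ p g k, q.code = .stmt (.await p g) :: k →
      ¬ g.holds futs (env o (f 0) q.loc)) :
    (P.decl C).inv (f x) ∧
      P.Idle C o (fun u => f (x + u)) (Q.map fun q => q.advQueued x) := by
  obtain ⟨-, h | ⟨q, hqQ, p, g, k, hq, hw, h⟩⟩ := h
  · refine ⟨h x hx, by simpa using h x hx, .inl fun u hu => h _ (by positivity)⟩
  -- `hns` supplies the failure of a differential guard at time 0, and the bound on the elapsed time
  -- its failure before `x`.
  have hlim : ∀ s ∈ Set.Icc 0 x, g.stateLimit (env o (f s) q.loc) := by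
    cases g with
    | diff g =>
      exact weakNeg_on_Icc hw hf (hns q hqQ p _ k hq) fun u hu hux =>
        Proc.not_holds_of_lt_mte hq hu (hlt u hu hux q hqQ)
    | _ => exact fun _ _ => trivial
  have hlim' : ∀ u, (∀ s ∈ Set.Icc 0 u, g.stateLimit (env o (f (x + s)) q.loc)) →
      ∀ s ∈ Set.Icc 0 (x + u), g.stateLimit (env o (f s) q.loc) := fun u hu s hs => by
    rcases le_total s x with hsx | hsx
    · exact hlim s ⟨hs.1, hsx⟩
    · have := hu (s - x) ⟨by linarith, by linarith [hs.2]⟩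
      rwa [add_sub_cancel] at this
  refine ⟨h x hx hlim, by simpa using h x hx hlim, .inr ⟨_, Multiset.mem_map_of_mem _ hqQ, ?_⟩⟩
  rcases q with ⟨τ, fid, code, m⟩
  obtain rfl : code = _ := hq
  cases g with
  | duration e =>
    exact ⟨p, _, k, rfl, trivial, fun u hu _ =>
      h (x + u) (by positivity) fun _ _ => trivial⟩
  | _ => exact ⟨p, _, k, rfl, hw, fun u hu hs => h (x + u) (by positivity) (hlim' u hs)⟩

end

/-! # New processes of a verified program -/

section
variable {K : Type} {nf : K → ℕ} {P : Prog K nf}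

theorem Prog.staysInv_of_pr {C : Option K} {σ : Val (nfo nf C)}
    (h : ((P.decl C).pr Fml.tru).Holds σ) : P.StaysInv C fun i => σ (fieldVar i) :=
  ⟨h.1, fun _ hf _ hu => ClassDecl.inv_flow_of_pr h hf hu fun _ _ => Fml.holds_tru _⟩

theorem Prog.GuardsWeak.ctor (hw : P.GuardsWeak) (C : Option K) : (P.decl C).ctor.GuardsWeak := by
  cases C with
  | none => exact hw.1
  | some C => exact (hw.2 C).1

theorem update_result_fieldVar {n : ℕ} (σ : Val n) (v : ℝ) :
    (fun i : Fin n => Function.update σ .result v (fieldVar i)) = fun i => σ (fieldVar i) :=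
  funext fun i => Function.update_of_ne (by simp [fieldVar]) _ _

theorem update_result_cll {n : ℕ} (σ : Val n) (v : ℝ) :
    Function.update σ .result v .cll = σ .cll :=
  Function.update_of_ne (by simp) _ _

/-- Turns a method obligation into a weakest precondition of the loaded body in every store that
satisfies the invariant, since it is unknown when the process will be scheduled. -/
theorem Prog.Verified.codeOK_meth (hv : P.Verified (basicRegions nf)) (hw : P.GuardsWeak)
    {C : Option K} {m : ℕ} {d : MethDecl K (nfo nf C)} (hd : (P.decl C).meths m = some d)
    {args : List ℝ} (hpre : d.pre fun j => initLoc d.arity args j) (o : ℕ)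
    {ρ : Fin (nfo nf C) → ℝ} (hρ : (P.decl C).inv ρ) :
    P.CodeOK C (some m) o false (d.body.load [.ret d.ret]) ρ (initLoc d.arity args) := by
  cases C with
  | none => cases hd
  | some C =>
    refine ⟨0, 0, .load ((hw.2 C).2 m d hd) fun σ hσ => ?_⟩
    have h := ((hv.2 C).2 m d hd) (stateOf o ρ (initLoc d.arity args) false 0 0)
    replace h := (Fml.holds_impl _ _ _).1 h
    obtain ⟨h₁, h₂, h₃⟩ := h ⟨hρ, hpre, rfl⟩ _ ⟨σ, hσ, rfl⟩
    -- The obligation speaks about the state after the assignment to `result`, the exit condition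
    -- about the state before it; they agree on the fields and on `cll`.
    have hu := update_result_fieldVar (n := nfo nf (some C)) σ (d.ret.trans.eval σ)
    refine ⟨?_, ?_, ?_⟩
    · exact (update_result_cll (n := nfo nf (some C)) σ _).symm.trans h₁
    · exact (congrArg (P.StaysInv (some C)) hu).mp (P.staysInv_of_pr (C := some C) h₃)
    · intro m' d' hm hd'
      cases hm
      obtain rfl : d = d' := Option.some.inj (hd.symm.trans hd')
      have h₂' : d.post (fun i => Function.update σ .result (d.ret.trans.eval σ) (fieldVar i))
          (Function.update σ .result (d.ret.trans.eval σ) .result) := h₂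
      exact (congrArg₂ d.post hu (Function.update_self ..)).mp h₂'

theorem Prog.Verified.codeOK_init (hv : P.Verified (basicRegions nf)) (hw : P.GuardsWeak)
    (C : Option K) {args : List ℝ} (hpre : (P.decl C).pre fun j => args.getD j 0) (o : ℕ) :
    P.CodeOK C none o false ((P.decl C).ctor.load [.ret (.const 0)])
      (fun i => ((P.decl C).init i).eval fun j : Fin _ => args.getD j.val 0)
      (initLoc (P.decl C).arity args) := by
  refine ⟨0, 0, .load (hw.ctor C) fun σ hσ => ?_⟩
  cases C with
  | none =>
    have h := hv.1 (stateOf o (fun i => ((P.decl none).init i).eval fun j : Fin _ =>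
      args.getD j.val 0) (initLoc (P.decl none).arity args) false 0 0)
    rw [Prog.oblMain, Fml.holds_impl] at h
    exact ⟨h rfl σ hσ, ⟨trivial, fun _ _ _ _ => trivial⟩, nofun⟩
  | some C =>
    -- The fields may start with any values, here 0, since the initialization overwrites all of
    -- them.
    have h := (hv.2 C).1 (stateOf o (fun _ => 0) (initLoc (P.cls C).arity args) false 0 0)
    rw [Prog.oblInit, Fml.holds_impl] at h
    have hpre' : (P.cls C).pre fun j => initLoc (P.cls C).arity args j := by
      simp only [initLoc_val]
      exact hpre
    obtain ⟨h₁, h₂⟩ := h ⟨hpre', rfl⟩ σ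
      ⟨_, rel_initFields o (fun _ => 0) _ false 0 0 (P.cls C).init (List.finRange (nf C))
        (fun i => ((P.cls C).init i).eval fun j : Fin _ => args.getD j.val 0)
        (fun i => by simp [initLoc_val]), hσ⟩
    exact ⟨h₁, P.staysInv_of_pr (C := some C) h₂, nofun⟩

end

/-! # Ownership of futures -/

/-- Every future is owned at most once, and only while it is pending. -/
structure Owned (F : Option ℕ → Multiset ℕ) (futs : ℕ → FutSt) : Prop where
  nodup : ∀ l, (F l).Nodup
  pending : ∀ l, ∀ f ∈ F l, futs f = .pending
  unique : ∀ l l' f, f ∈ F l → f ∈ F l' → l = l'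

namespace Owned
variable {F : Option ℕ → Multiset ℕ} {futs : ℕ → FutSt} {l l' : Option ℕ} {f : ℕ}
  {M : Multiset ℕ}

theorem mem_update : ∀ {l'' : Option ℕ}, f ∈ Function.update F l M l'' ↔
    (l'' = l ∧ f ∈ M) ∨ (l'' ≠ l ∧ f ∈ F l'') := by
  intro l''
  by_cases h : l'' = l
  · subst h; simp
  · simp [h]

/-- For calls and object creation: an unused future is owned by nobody. -/
theorem add (h : Owned F futs) (hf : futs f = .unused) :
    Owned (Function.update F l (f ::ₘ F l)) (Function.update futs f .pending) := by
  have hn : ∀ l, f ∉ F l := fun l hl => by simpa [hf] using h.pending l f hl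
  have hmem : ∀ l' g, g ∈ Function.update F l (f ::ₘ F l) l' ↔ (l' = l ∧ g = f) ∨ g ∈ F l' := by
    intro l' g
    rw [mem_update, Multiset.mem_cons]
    by_cases hl : l' = l
    · subst hl; simp
    · simp [hl]
  refine ⟨fun l' => ?_, fun l' g hg => ?_, fun l₁ l₂ g h₁ h₂ => ?_⟩
  · by_cases hl : l' = l
    · subst hl
      simpa using ⟨hn l', h.nodup l'⟩
    · simpa [hl] using h.nodup l'
  · by_cases hgf : g = f
    · simp [hgf]
    · rw [Function.update_of_ne hgf]
      refine h.pending l' g (((hmem l' g).1 hg).resolve_left fun h => hgf h.2)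
  · rw [hmem] at h₁ h₂
    rcases h₁ with ⟨rfl, rfl⟩ | h₁ <;> rcases h₂ with ⟨rfl, h₂⟩ | h₂
    · rfl
    · exact (hn _ h₂).elim
    · exact (hn _ (h₂ ▸ h₁)).elim
    · exact h.unique _ _ _ h₁ h₂

/-- For the return of a process: since ownership is unique, no owner of the resolved future is left.
-/
theorem remove (h : Owned F futs) (hl : F l = f ::ₘ M) (v : FutSt) :
    Owned (Function.update F l M) (Function.update futs f v) := by
  have hnd := h.nodup l
  rw [hl, Multiset.nodup_cons] at hnd
  have hsub : ∀ l' g, g ∈ Function.update F l M l' → g ∈ F l' ∧ g ≠ f := by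
    intro l' g hg
    rcases mem_update.1 hg with ⟨rfl, hg'⟩ | ⟨hne, hg⟩
    · refine ⟨by rw [hl]; exact Multiset.mem_cons_of_mem hg', ?_⟩
      rintro rfl
      exact hnd.1 hg'
    · refine ⟨hg, ?_⟩
      rintro rfl
      exact hne (h.unique _ _ g hg (by rw [hl]; exact Multiset.mem_cons_self _ _))
  refine ⟨fun l' => ?_, fun l' g hg => ?_, fun l₁ l₂ g h₁ h₂ =>
    h.unique _ _ g (hsub _ _ h₁).1 (hsub _ _ h₂).1⟩
  · by_cases hl' : l' = l
    · subst hl'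
      simpa using hnd.2
    · simpa [hl'] using h.nodup l'
  · rw [Function.update_of_ne (hsub _ _ hg).2]
    exact h.pending l' g (hsub _ _ hg).1

/-- For the dispatch of a message: its future passes from the pool of messages to the object. -/
theorem move (h : Owned F futs) (hl : F l = f ::ₘ M) (hne : l' ≠ l) :
    Owned (Function.update (Function.update F l M) l' (f ::ₘ F l')) futs := by
  have hnd := h.nodup l
  rw [hl, Multiset.nodup_cons] at hnd
  have hfl : f ∈ F l := by rw [hl]; exact Multiset.mem_cons_self _ _
  have hn : f ∉ F l' := fun h' => hne (h.unique _ _ f h' hfl)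
  have hmem : ∀ l'' g, g ∈ Function.update (Function.update F l M) l' (f ::ₘ F l') l'' →
      (l'' = l' ∧ g = f) ∨ (g ∈ F l'' ∧ g ≠ f) := by
    intro l'' g hg
    rcases mem_update.1 hg with ⟨rfl, h₁⟩ | ⟨-, h₁⟩
    · rcases Multiset.mem_cons.1 h₁ with rfl | h₂
      · exact .inl ⟨rfl, rfl⟩
      · exact .inr ⟨h₂, by rintro rfl; exact hn h₂⟩
    · rcases mem_update.1 h₁ with ⟨rfl, h₂⟩ | ⟨hne', h₂⟩
      · exact .inr ⟨by rw [hl]; exact Multiset.mem_cons_of_mem h₂, by rintro rfl; exact hnd.1 h₂⟩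
      · exact .inr ⟨h₂, by rintro rfl; exact hne' (h.unique _ _ g h₂ hfl)⟩
  refine ⟨fun l'' => ?_, fun l'' g hg => ?_, fun l₁ l₂ g h₁ h₂ => ?_⟩
  · by_cases h₁ : l'' = l'
    · subst h₁
      simpa using ⟨hn, h.nodup l''⟩
    · by_cases h₂ : l'' = l
      · subst h₂
        simpa [h₁] using hnd.2
      · simpa [h₁, h₂] using h.nodup l''
  · rcases hmem _ _ hg with ⟨-, rfl⟩ | hg
    · exact h.pending _ _ hfl
    · exact h.pending _ _ hg.1
  · rcases hmem _ _ h₁ with ⟨e₁, e₁'⟩ | h₁ <;> rcases hmem _ _ h₂ with ⟨e₂, e₂'⟩ | h₂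
    · exact e₁.trans e₂.symm
    · exact (h₂.2 e₁').elim
    · exact (h₁.2 e₂').elim
    · exact h.unique _ _ _ h₁.1 h₂.1

end Owned

/-! ### Well-formed configurations and their preservation -/

section
variable {K : Type} {nf : K → ℕ} {P : Prog K nf} {sol : SolFun nf}

/-- The futures of the processes of an object. -/
def Obj.fids (ob : Obj K nf) : Multiset ℕ :=
  (ob.act.elim 0 fun q => {q.fid}) + ob.queue.map Proc.fid

/-- The futures owned by the messages (`none`) and by the processes of each object. -/
def fidsAt (objs : ℕ → Option (Obj K nf)) (msgs : Multiset (Msg K)) : Option ℕ → Multiset ℕ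
  | none => msgs.map Msg.fid
  | some o => match objs o with
    | none => 0
    | some ob => ob.fids

theorem fidsAt_update (objs : ℕ → Option (Obj K nf)) (msgs : Multiset (Msg K)) (o : ℕ)
    (ob : Obj K nf) : fidsAt (Function.update objs o (some ob)) msgs =
      Function.update (fidsAt objs msgs) (some o) ob.fids := by
  funext l
  cases l with
  | none => simp [fidsAt]
  | some o' =>
    by_cases h : o' = o
    · subst h; simp [fidsAt]
    · simp [fidsAt, h]

theorem fidsAt_msgs (objs : ℕ → Option (Obj K nf)) (msgs msgs' : Multiset (Msg K)) :
    fidsAt objs msgs' = Function.update (fidsAt objs msgs) none (msgs'.map Msg.fid) := by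
  funext l
  cases l <;> simp [fidsAt]

theorem fidsAt_of_eq {objs : ℕ → Option (Obj K nf)} {msgs : Multiset (Msg K)} {o : ℕ}
    {ob : Obj K nf} (h : objs o = some ob) : fidsAt objs msgs (some o) = ob.fids := by
  simp [fidsAt, h]

theorem Obj.fids_act {ob : Obj K nf} {q : Proc K (nfo nf ob.cls)} (h : ob.act = some q) :
    ob.fids = q.fid ::ₘ ob.queue.map Proc.fid := by
  simp [Obj.fids, h]

theorem Obj.fids_idle {ob : Obj K nf} (h : ob.act = none) :
    ob.fids = ob.queue.map Proc.fid := by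
  simp [Obj.fids, h]

theorem Obj.fids_store (ob : Obj K nf) (q : Proc K (nfo nf ob.cls))
    (x : Option (Lhs (nfo nf ob.cls))) (v : ℝ) (k : List (RStmt K (nfo nf ob.cls)))
    (h : ob.act = some q) : (ob.store sol q x v k).fids = ob.fids := by
  rcases x with _ | i | y <;> simp [Obj.store, Obj.fids, h]

theorem LStep.fids {futs : ℕ → FutSt} {o : ℕ} {ob ob' : Obj K nf}
    (h : LStep sol futs o ob ob') : ob'.fids = ob.fids := by
  cases h with
  | assign q x e k ha hc => exact Obj.fids_store ob q x _ k ha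
  | susp q k ha hc => simp [Obj.fids, ha]
  | schedAwait q Q p g k ha hq => simp [Obj.fids, ha, hq]
  | sched q Q ha hq => simp [Obj.fids, ha, hq]
  | await q _ _ _ ha => simp [Obj.fids, ha]
  | get q _ _ _ _ _ ha => simp [Obj.fids, ha]
  | loop q _ _ _ ha => simp [Obj.fids, ha]
  | iteTrue q _ _ _ _ ha => simp [Obj.fids, ha]
  | iteFalse q _ _ _ _ ha => simp [Obj.fids, ha]
  | skip q _ ha => simp [Obj.fids, ha]
  | duration q _ _ ha => simp [Obj.fids, ha]

/-- Well-formed configurations. -/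
structure Conf.WF (P : Prog K nf) (c : Conf K nf) : Prop where
  finObjs : {o | c.objs o ≠ none}.Finite
  finFuts : {f | c.futs f ≠ .unused}.Finite
  flows : ∀ o ob, c.objs o = some ob → ob.Flows P
  owned : Owned (fidsAt c.objs c.msgs) c.futs

theorem update_objs_cases {objs : ℕ → Option (Obj K nf)} {o : ℕ} {ob' : Obj K nf}
    {Q : ℕ → Obj K nf → Prop} (hnew : Q o ob')
    (hold : ∀ o₁ ob, objs o₁ = some ob → Q o₁ ob) :
    ∀ o₁ ob, Function.update objs o (some ob') o₁ = some ob → Q o₁ ob := by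
  intro o₁ ob h
  by_cases ho : o₁ = o
  · subst ho
    rw [Function.update_self] at h
    cases h
    exact hnew
  · rw [Function.update_of_ne ho] at h
    exact hold o₁ ob h

theorem finite_update {α : Type} {g : ℕ → α} {a : α} (h : {x | g x ≠ a}.Finite) (y : ℕ) (v : α) :
    {x | Function.update g y v x ≠ a}.Finite := by
  refine (h.insert y).subset fun x hx => ?_
  by_cases hxy : x = y
  · exact .inl hxy
  · right
    simpa [hxy] using hx

/-- Local steps permute the futures within one object; every other rule adds, removes or moves
exactly one future. -/
theorem DStep.wf (hsol : P.Solves sol) {c c' : Conf K nf} (h : DStep P sol c c') (hc : c.WF P) :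
    c'.WF P := by
  obtain ⟨hfo, hff, hfl, hown⟩ := hc
  have hstore : ∀ o ob, c.objs o = some ob → ∀ q x v k, (ob.store sol q x v k).Flows P := by
    intro o ob ho q x v k
    obtain ⟨f, hf, he⟩ := Obj.store_eq hsol (hfl o ob ho) q x v k
    rw [he]
    exact hf
  cases h with
  | loc o ob ob' ho hs =>
    refine ⟨finite_update hfo _ _, hff,
      update_objs_cases (hs.flows hsol (hfl o ob ho)) hfl, ?_⟩
    change Owned (fidsAt (Function.update _ _ _) c.msgs) _
    rw [fidsAt_update, hs.fids, ← fidsAt_of_eq (msgs := c.msgs) ho, Function.update_eq_self]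
    exact hown
  | ret o ob ho q e k ha hc =>
    refine ⟨finite_update hfo _ _, finite_update hff _ _,
      update_objs_cases (hsol _ _) hfl, ?_⟩
    change Owned (fidsAt (Function.update _ _ _) c.msgs) _
    rw [fidsAt_update]
    refine hown.remove ?_ _
    rw [fidsAt_of_eq ho, Obj.fids_act ha, Obj.fids_idle rfl]
  | call o ob ho q x e D m args k fid ha hc hf =>
    refine ⟨finite_update hfo _ _, finite_update hff _ _,
      update_objs_cases (hstore o ob ho ..) hfl, ?_⟩
    change Owned (fidsAt (Function.update _ _ _) (_ ::ₘ c.msgs)) _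
    rw [fidsAt_update, Obj.fids_store ob q x _ k ha, fidsAt_msgs c.objs c.msgs,
      Function.update_comm (by simp), ← fidsAt_of_eq (msgs := c.msgs) ho, Function.update_eq_self,
      Multiset.map_cons]
    exact hown.add hf
  | dispatch o ob ho μ M d hm hd hC hmeth =>
    refine ⟨finite_update hfo _ _, hff, update_objs_cases (hfl o ob ho) hfl, ?_⟩
    change Owned (fidsAt (Function.update _ _ _) M) _
    rw [fidsAt_update, fidsAt_msgs c.objs c.msgs]
    have := hown.move (l := none) (l' := some o) (f := μ.fid) (M := M.map Msg.fid)
      (by simp [fidsAt, hm]) (by simp)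
    convert this using 2
    rw [fidsAt_of_eq ho]
    simp [Obj.fids, Multiset.add_cons]
  | new o ob ho q x D args k o' fid ha hc ho' hf =>
    refine ⟨finite_update (finite_update hfo _ _) _ _, finite_update hff _ _,
      update_objs_cases (hsol _ _) (update_objs_cases (hstore o ob ho ..) hfl), ?_⟩
    change Owned (fidsAt (Function.update (Function.update _ _ _) _ _) c.msgs) _
    rw [fidsAt_update, fidsAt_update, Obj.fids_store ob q x _ k ha,
      ← fidsAt_of_eq (msgs := c.msgs) ho, Function.update_eq_self]
    have := hown.add (l := some o') hf
    convert this using 2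
    simp [fidsAt, ho', Obj.fids, Prog.newObj]

theorem Proc.fid_advActive {n : ℕ} (q : Proc K n) (s : ℝ) : (q.advActive s).fid = q.fid := by
  unfold Proc.advActive
  split <;> rfl

theorem Proc.fid_advQueued {n : ℕ} (q : Proc K n) (s : ℝ) : (q.advQueued s).fid = q.fid := by
  unfold Proc.advQueued
  split <;> rfl

theorem Prog.fids_advObj (ob : Obj K nf) (s : ℝ) : (P.advObj ob s).fids = ob.fids := by
  have : ∀ q : Proc K (nfo nf ob.cls), (q.advQueued s).fid = q.fid := fun q => q.fid_advQueued s
  cases h : ob.act with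
  | none => simp [Obj.fids, Prog.advObj, h, this]
  | some q => simp [Obj.fids, Prog.advObj, h, this, Proc.fid_advActive]

theorem Prog.adv_objs {c : Conf K nf} {s : ℝ} {o : ℕ} {ob' : Obj K nf}
    (h : (P.adv c s).objs o = some ob') : ∃ ob, c.objs o = some ob ∧ P.advObj ob s = ob' :=
  Option.map_eq_some_iff.1 h

theorem Conf.WF.adv {c : Conf K nf} (hc : c.WF P) {s : ℝ} (hs : 0 ≤ s) : (P.adv c s).WF P := by
  obtain ⟨hfo, hff, hfl, hown⟩ := hc
  refine ⟨hfo.subset fun o ho => ?_, hff, fun o ob' ho => ?_, ?_⟩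
  · simpa [Prog.adv] using ho
  · obtain ⟨ob, ho', rfl⟩ := P.adv_objs ho
    exact P.flows_adv (hfl o ob ho') hs
  · have he : fidsAt (P.adv c s).objs (P.adv c s).msgs = fidsAt c.objs c.msgs := by
      funext l
      cases l with
      | none => rfl
      | some o => cases h : c.objs o <;> simp [fidsAt, Prog.adv, h, Prog.fids_advObj]
    rw [he]
    exact hown

end

/-! # Soundness -/

section
variable {K : Type} {nf : K → ℕ} {P : Prog K nf} {sol : SolFun nf}

/-- All processes are correct, idle objects satisfy their invariants, and the preconditions of all
calls hold. -/
structure Conf.Sound (P : Prog K nf) (c : Conf K nf) : Prop where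
  good : ∀ o ob, c.objs o = some ob → P.ObjGood (fun _ => True) false o ob
  idle : ∀ o ob, c.objs o = some ob → ob.act = none → P.Idle ob.cls o ob.dyn ob.queue
  msgs : ∀ μ ∈ c.msgs, ∀ d, (P.cls μ.cls).meths μ.meth = some d →
    d.pre fun j => initLoc d.arity μ.args j

/-- A check has failed in some process. -/
def Prog.ObjFailed (P : Prog K nf) (o : ℕ) (ob : Obj K nf) : Prop :=
  (∃ q, ob.act = some q ∧ P.ActGood ob.cls o true ob.dyn q) ∨
    ∃ q ∈ ob.queue, P.QueGood ob.cls o true q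

def Conf.Failed (P : Prog K nf) (c : Conf K nf) : Prop :=
  ∃ o ob, c.objs o = some ob ∧ P.ObjFailed o ob

/-- A check has failed in the process with future `f`, so that this process cannot terminate. -/
structure Conf.Doomed (P : Prog K nf) (f : ℕ) (c : Conf K nf) : Prop where
  pending : c.futs f = .pending
  msgs : ∀ μ ∈ c.msgs, μ.fid ≠ f
  good : ∀ o ob, c.objs o = some ob → P.ObjGood (fun f' => f' = f) true o ob

theorem Prog.ObjStep.good_of_not_failed {o : ℕ} {ob : Obj K nf}
    (h : P.ObjStep (fun _ => True) false o ob) (hn : ¬ P.ObjFailed o ob) :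
    P.ObjGood (fun _ => True) false o ob :=
  ⟨fun q hq _ => (h.1 q hq trivial).resolve_right fun h' => hn (.inl ⟨q, hq, h'⟩),
    fun q hq _ => (h.2 q hq trivial).resolve_right fun h' => hn (.inr ⟨q, hq, h'⟩)⟩

theorem Prog.ObjStep.good {S : ℕ → Prop} {o : ℕ} {ob : Obj K nf} (h : P.ObjStep S true o ob) :
    P.ObjGood S true o ob :=
  ⟨fun q hq hS => (h.1 q hq hS).elim id id, fun q hq hS => (h.2 q hq hS).elim id id⟩

theorem Obj.mem_fids_act {ob : Obj K nf} {q : Proc K (nfo nf ob.cls)} (h : ob.act = some q) :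
    q.fid ∈ ob.fids := by
  rw [Obj.fids_act h]
  exact Multiset.mem_cons_self _ _

theorem Obj.mem_fids_queue {ob : Obj K nf} {q : Proc K (nfo nf ob.cls)} (h : q ∈ ob.queue) :
    q.fid ∈ ob.fids :=
  Multiset.mem_add.2 (.inr (Multiset.mem_map_of_mem _ h))

theorem Obj.eq_of_fid_eq_act {ob : Obj K nf} (hn : ob.fids.Nodup) {q : Proc K (nfo nf ob.cls)}
    (h : ob.act = some q) : ∀ q' ∈ ob.queue, q'.fid ≠ q.fid := by
  rw [Obj.fids_act h, Multiset.nodup_cons] at hn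
  intro q' hq' he
  exact hn.1 (he ▸ Multiset.mem_map_of_mem _ hq')

theorem Obj.eq_of_fid_eq_queue {ob : Obj K nf} (hn : ob.fids.Nodup)
    {q q' : Proc K (nfo nf ob.cls)} (h : q ∈ ob.queue) (h' : q' ∈ ob.queue)
    (he : q'.fid = q.fid) : q' = q := by
  have : (ob.queue.map Proc.fid).Nodup :=
    Multiset.nodup_of_le (Multiset.le_add_left _ _) hn
  exact Multiset.inj_on_of_nodup_map this _ h' _ h he

/-- Ownership of futures singles out the failed process: no message and no other process carries its
future, so correctness with raised flag for this future concerns that process alone. -/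
theorem Conf.Failed.doomed {c : Conf K nf} (hc : c.WF P) (h : c.Failed P) :
    ∃ o ob q, c.objs o = some ob ∧ (ob.act = some q ∨ q ∈ ob.queue) ∧ c.Doomed P q.fid := by
  obtain ⟨o, ob, ho, h⟩ := h
  have hnd : ob.fids.Nodup := fidsAt_of_eq (msgs := c.msgs) ho ▸ hc.owned.nodup (some o)
  have main : ∀ q : Proc K (nfo nf ob.cls), q.fid ∈ ob.fids →
      P.ObjGood (fun f' => f' = q.fid) true o ob → c.Doomed P q.fid := by
    intro q hq hgood
    have hq' : q.fid ∈ fidsAt c.objs c.msgs (some o) := by rwa [fidsAt_of_eq ho]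
    refine ⟨hc.owned.pending _ _ hq', fun μ hμ he => ?_, fun o₁ ob₁ ho₁ => ?_⟩
    · have : q.fid ∈ fidsAt c.objs c.msgs none := he ▸ Multiset.mem_map_of_mem _ hμ
      cases hc.owned.unique _ _ _ hq' this
    · by_cases hoo : o₁ = o
      · subst hoo
        cases ho.symm.trans ho₁
        exact hgood
      · have hno : ∀ f' ∈ ob₁.fids, f' ≠ q.fid := by
          rintro f' hf' rfl
          rw [← fidsAt_of_eq (msgs := c.msgs) ho₁] at hf'
          exact hoo (Option.some.inj (hc.owned.unique _ _ _ hf' hq'))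
        exact ⟨fun q₁ hq₁ he => (hno _ (Obj.mem_fids_act hq₁) he).elim,
          fun q₁ hq₁ he => (hno _ (Obj.mem_fids_queue hq₁) he).elim⟩
  rcases h with ⟨q, hq, h⟩ | ⟨q, hq, h⟩
  · refine ⟨o, ob, q, ho, .inl hq, main q (Obj.mem_fids_act hq) ⟨fun q' hq' _ => ?_,
      fun q' hq' he => (Obj.eq_of_fid_eq_act hnd hq q' hq' he).elim⟩⟩
    cases hq.symm.trans hq'
    exact h
  · refine ⟨o, ob, q, ho, .inr hq, main q (Obj.mem_fids_queue hq) ⟨fun q' hq' he =>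
      (Obj.eq_of_fid_eq_act hnd hq' q hq he.symm).elim, fun q' hq' he => ?_⟩⟩
    rw [Obj.eq_of_fid_eq_queue hnd hq hq' he]
    exact h

/-! ### Discrete steps of configurations -/

theorem Obj.objStep_store {S : ℕ → Prop} {b : Bool} {o : ℕ} (hsol : P.Solves sol)
    {ob : Obj K nf} (hf : ob.Flows P) (hg : P.ObjGood S b o ob) (q : Proc K (nfo nf ob.cls))
    (x : Option (Lhs (nfo nf ob.cls))) (v : ℝ) (k : List (RStmt K (nfo nf ob.cls)))
    (h : S q.fid → P.CodeOK ob.cls q.meth o b k (setHeap x v ob.heap) (setLoc x v q.loc) ∨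
      P.CodeOK ob.cls q.meth o true k (setHeap x v ob.heap) (setLoc x v q.loc)) :
    P.ObjStep S b o (ob.store sol q x v k) := by
  obtain ⟨f, hf', he⟩ := Obj.store_eq hsol hf q x v k
  rw [he]
  exact Prog.objStep_of_code hf' hg.2 h

theorem Obj.failed_store {o : ℕ} (hsol : P.Solves sol)
    {ob : Obj K nf} (hf : ob.Flows P) (q : Proc K (nfo nf ob.cls))
    (x : Option (Lhs (nfo nf ob.cls))) (v : ℝ) (k : List (RStmt K (nfo nf ob.cls)))
    (h : P.CodeOK ob.cls q.meth o true k (setHeap x v ob.heap) (setLoc x v q.loc)) :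
    P.ObjFailed o (ob.store sol q x v k) := by
  obtain ⟨f, hf', he⟩ := Obj.store_eq hsol hf q x v k
  rw [he]
  exact .inl ⟨_, rfl, (h.good hf').elim id id⟩

theorem Obj.act_store (ob : Obj K nf) (q : Proc K (nfo nf ob.cls))
    (x : Option (Lhs (nfo nf ob.cls))) (v : ℝ) (k : List (RStmt K (nfo nf ob.cls))) :
    (ob.store sol q x v k).act ≠ none := by
  rcases x with _ | i | y <;> exact nofun

theorem Prog.objGood_new {S : ℕ → Prop} (hv : P.Verified (basicRegions nf)) (hw : P.GuardsWeak)
    (hsol : P.Solves sol) (C : Option K) {args : List ℝ}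
    (hpre : (P.decl C).pre fun j => args.getD j 0) (fid o : ℕ) :
    P.ObjStep S false o (P.newObj sol C args fid) :=
  Prog.objStep_of_code (hsol _ _) (fun _ h => (Multiset.notMem_zero _ h).elim) fun _ =>
    .inl (hv.codeOK_init hw C hpre o)

/-- The doomed process stays correct with raised flag, whatever the other processes do. Fresh
futures differ from `f`, which is pending. -/
theorem DStep.doomed (hsol : P.Solves sol) {c c' : Conf K nf} (hc : c.WF P) {f : ℕ}
    (h : DStep P sol c c') (hd : c.Doomed P f) : c'.Doomed P f := by
  obtain ⟨hp, hm, hg⟩ := hd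
  have hfne : ∀ fid, c.futs fid = .unused → fid ≠ f := by
    rintro fid h rfl
    rw [hp] at h
    cases h
  cases h with
  | loc o ob ob' ho hs =>
    exact ⟨hp, hm, update_objs_cases
      (hs.objStep hsol (hc.flows o ob ho) (hg o ob ho) nofun).good hg⟩
  | ret o ob ho q e k ha hcode =>
    -- A return of the doomed process would need `cll = 0`, whereas its flag is 1.
    have hne : q.fid ≠ f := by
      intro he
      have h : P.CodeGood ob.cls q.meth o true ob.dyn q.loc q.code := (hg o ob ho).1 q ha he
      rw [hcode] at h
      obtain ⟨t, r, h, -⟩ := h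
      simp [flag] at h
    refine ⟨?_, hm, update_objs_cases ⟨nofun, (hg o ob ho).2⟩ hg⟩
    change Function.update c.futs q.fid _ f = _
    rw [Function.update_of_ne hne.symm, hp]
  | call o ob ho q x e D m args k fid ha hcode hf =>
    refine ⟨?_, fun μ hμ => ?_, update_objs_cases
      (Obj.objStep_store hsol (hc.flows o ob ho) (hg o ob ho) q x fid k fun he => ?_).good hg⟩
    · change Function.update c.futs fid _ f = _
      rw [Function.update_of_ne (hfne fid hf).symm, hp]
    · rcases Multiset.mem_cons.1 hμ with rfl | hμ
      · exact hfne fid hf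
      · exact hm μ hμ
    · have h : P.CodeGood ob.cls q.meth o true ob.dyn q.loc q.code := (hg o ob ho).1 q ha he
      rw [hcode] at h
      exact .inl (((h.ok_of_head (hc.flows o ob ho) rfl).call fid).elim And.right id)
  | dispatch o ob ho μ M d hmsg hd hC hmeth =>
    refine ⟨hp, fun μ' hμ' => hm μ' (by rw [hmsg]; exact Multiset.mem_cons_of_mem hμ'),
      update_objs_cases ⟨(hg o ob ho).1, fun q hq he => ?_⟩ hg⟩
    rcases Multiset.mem_cons.1 hq with rfl | hq
    · exact (hm μ (by rw [hmsg]; exact Multiset.mem_cons_self _ _) he).elim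
    · exact (hg o ob ho).2 q hq he
  | new o ob ho q x D args k o' fid ha hcode ho' hf =>
    refine ⟨?_, hm, update_objs_cases ⟨fun q' hq' he => ?_,
      fun q' hq' _ => (Multiset.notMem_zero _ hq').elim⟩ (update_objs_cases
      (Obj.objStep_store hsol (hc.flows o ob ho) (hg o ob ho) q x o' k fun he => ?_).good hg)⟩
    · change Function.update c.futs fid _ f = _
      rw [Function.update_of_ne (hfne fid hf).symm, hp]
    · cases hq'
      exact (hfne fid hf he).elim
    · have h : P.CodeGood ob.cls q.meth o true ob.dyn q.loc q.code := (hg o ob ho).1 q ha he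
      rw [hcode] at h
      exact .inl (((h.ok_of_head (hc.flows o ob ho) rfl).new o').elim And.right id)

/-- Each check that the step meets either succeeds, which gives the property needed for the next
configuration, or makes that configuration failed. -/
theorem DStep.sound (hv : P.Verified (basicRegions nf)) (hw : P.GuardsWeak)
    (hsol : P.Solves sol) {c c' : Conf K nf} (hc : c.WF P)
    (h : DStep P sol c c') (hs : c.Sound P) : c'.Sound P ∨ c'.Failed P := by
  by_cases hF : c'.Failed P
  · exact .inr hF
  refine .inl ?_
  have hnf : ∀ o ob, c'.objs o = some ob → ¬ P.ObjFailed o ob := fun o ob ho h => hF ⟨o, ob, ho, h⟩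
  obtain ⟨hg, hi, hm⟩ := hs
  cases h with
  | loc o ob ob' ho hs =>
    have hn := hnf o ob' (Function.update_self ..)
    refine ⟨update_objs_cases ((hs.objStep hsol (hc.flows o ob ho) (hg o ob ho)
      fun _ ha => ?_).good_of_not_failed hn) hg, update_objs_cases (fun ha => ?_) hi, hm⟩
    · have h := (hi o ob ho ha).1
      rwa [(hc.flows o ob ho).1] at h
    · exact (hs.idle hsol (hc.flows o ob ho) (hg o ob ho) ha).resolve_right fun h => hn (.inr h)
  | ret o ob ho q e k ha hcode =>
    refine ⟨update_objs_cases ⟨nofun, (hg o ob ho).2⟩ hg, update_objs_cases (fun _ => ?_) hi, hm⟩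
    have h : P.CodeGood ob.cls q.meth o false ob.dyn q.loc q.code := (hg o ob ho).1 q ha trivial
    rw [hcode] at h
    obtain ⟨t, r, -, h, -⟩ := h.ok_of_head (hc.flows o ob ho) rfl
    -- The exit condition ensures the invariant along every solution, so after a return no waiting
    -- process is needed to limit the time.
    refine ⟨?_, .inl fun u hu => h.2 _ (hsol _ _) u hu⟩
    change (P.decl ob.cls).inv (sol ob.cls ob.heap 0)
    rw [(hsol ob.cls ob.heap).1]
    exact h.1
  | call o ob ho q x e D m args k fid ha hcode hf =>
    have h : P.CodeGood ob.cls q.meth o false ob.dyn q.loc q.code := (hg o ob ho).1 q ha trivial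
    rw [hcode] at h
    obtain ⟨hpre, hk⟩ := ((h.ok_of_head (hc.flows o ob ho) rfl).call fid).resolve_right fun h =>
      hnf o _ (Function.update_self ..) (Obj.failed_store hsol (hc.flows o ob ho) q x fid k h)
    refine ⟨update_objs_cases ((Obj.objStep_store hsol (hc.flows o ob ho) (hg o ob ho) q x fid k
      fun _ => .inl hk).good_of_not_failed (hnf o _ (Function.update_self ..))) hg,
      update_objs_cases (fun h => (Obj.act_store _ _ _ _ _ h).elim) hi, fun μ hμ d hd => ?_⟩
    rcases Multiset.mem_cons.1 hμ with rfl | hμ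
    · exact hpre d hd
    · exact hm μ hμ d hd
  | dispatch o ob ho μ M d hmsg hd hC hmeth =>
    have hμ : μ ∈ c.msgs := by rw [hmsg]; exact Multiset.mem_cons_self _ _
    refine ⟨update_objs_cases ⟨(hg o ob ho).1, fun q hq he => ?_⟩ hg,
      update_objs_cases (fun ha => ?_) hi,
      fun μ' hμ' => hm μ' (by rw [hmsg]; exact Multiset.mem_cons_of_mem hμ')⟩
    · rcases Multiset.mem_cons.1 hq with rfl | hq
      -- The precondition was checked by the caller and has been kept with the message.
      · refine Prog.QueGood.of_code fun ρ hρ => hv.codeOK_meth hw hmeth ?_ o hρ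
        rcases ob with ⟨C, heap, dyn, act, queue⟩
        obtain rfl : C = some μ.cls := hC
        exact hm μ hμ d hmeth
      · exact (hg o ob ho).2 q hq he
    -- A larger queue still contains the old witness.
    · obtain ⟨h₀, h⟩ := hi o ob ho ha
      exact ⟨h₀, h.imp_right fun ⟨q, hq, h⟩ => ⟨q, Multiset.mem_cons_of_mem hq, h⟩⟩
  | new o ob ho q x D args k o' fid ha hcode ho' hf =>
    have hoo : o ≠ o' := by
      rintro rfl
      rw [ho] at ho'
      cases ho'
    have hn₁ := hnf o _ ((Function.update_of_ne hoo _ _).trans (Function.update_self ..))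
    have h : P.CodeGood ob.cls q.meth o false ob.dyn q.loc q.code := (hg o ob ho).1 q ha trivial
    rw [hcode] at h
    obtain ⟨hpre, hk⟩ := ((h.ok_of_head (hc.flows o ob ho) rfl).new o').resolve_right fun h =>
      hn₁ (Obj.failed_store hsol (hc.flows o ob ho) q x o' k h)
    exact ⟨update_objs_cases ((Prog.objGood_new hv hw hsol (some D) hpre fid o').good_of_not_failed
      (hnf o' _ (Function.update_self ..))) (update_objs_cases
      ((Obj.objStep_store hsol (hc.flows o ob ho) (hg o ob ho) q x o' k
        fun _ => .inl hk).good_of_not_failed hn₁) hg),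
      update_objs_cases nofun
        (update_objs_cases (fun h => (Obj.act_store _ _ _ _ _ h).elim) hi), hm⟩

/-! # Advance of time -/

theorem Conf.WF.exists_unused {c : Conf K nf} (hc : c.WF P) : ∃ f, c.futs f = .unused := by
  by_contra! h
  exact Set.infinite_univ (hc.finFuts.subset fun f _ => h f)

theorem Conf.WF.exists_no_object {c : Conf K nf} (hc : c.WF P) : ∃ o, c.objs o = none := by
  by_contra! h
  exact Set.infinite_univ (hc.finObjs.subset fun o _ => h o)

/-- Correct code always has an applicable rule unless it waits: fresh identities exist by
finiteness, and the weakest precondition rules out empty code and an unflattened sequence at the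
head. -/
theorem Prog.ActGood.blocked {c : Conf K nf} (hc : c.WF P) (hn : ¬ ∃ d, DStep P sol c d) {o : ℕ}
    {ob : Obj K nf} (ho : c.objs o = some ob) {q : Proc K (nfo nf ob.cls)} (ha : ob.act = some q)
    {b : Bool} (h : P.ActGood ob.cls o b ob.dyn q) : q.Blocked := by
  have hl : ∀ ob', ¬ LStep sol c.futs o ob ob' := fun ob' hs => hn ⟨_, .loc c o ob ob' ho hs⟩
  have h' : P.CodeGood ob.cls q.meth o b ob.dyn q.loc q.code := h
  have hcases : ∀ (code : List (RStmt K (nfo nf ob.cls))), q.code = code → q.Blocked := by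
    intro code hcode
    rw [hcode] at h'
    rcases code with _ | ⟨s | _ | e, k⟩
    · obtain ⟨t, r, h'⟩ := h'
      exact h'.elim
    · cases s with
      | skip => exact (hl _ (.skip ob q k ha hcode)).elim
      | seq s₁ s₂ =>
        obtain ⟨t, r, -, h', -⟩ := h'
        exact (h' trivial).elim
      | ite c s₁ s₂ =>
        by_cases hb : c.holds (env o ob.heap q.loc)
        · exact (hl _ (.iteTrue ob q c s₁ s₂ k ha hcode hb)).elim
        · exact (hl _ (.iteFalse ob q c s₁ s₂ k ha hcode hb)).elim
      | loop c s => exact (hl _ (.loop ob q c s k ha hcode)).elim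
      | await p g => exact (hl _ (.await ob q p g k ha hcode)).elim
      | duration e => exact .inr ⟨e, k, hcode⟩
      | assign x r =>
        cases r with
        | expr e => exact (hl _ (.assign ob q x e k ha hcode)).elim
        | new D args =>
          obtain ⟨o', ho'⟩ := hc.exists_no_object
          obtain ⟨f, hf⟩ := hc.exists_unused
          exact (hn ⟨_, .new c o ob ho q x D args k o' f ha hcode ho' hf⟩).elim
        | get e => exact .inl ⟨x, e, k, hcode⟩
        | call e D m args =>
          obtain ⟨f, hf⟩ := hc.exists_unused
          exact (hn ⟨_, .call c o ob ho q x e D m args k f ha hcode hf⟩).elim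
    · exact (hl _ (.susp ob q k ha hcode)).elim
    · exact (hn ⟨_, .ret c o ob ho q e k ha hcode⟩).elim
  exact hcases _ rfl

theorem Conf.mte_le {c : Conf K nf} {o : ℕ} {ob : Obj K nf} (ho : c.objs o = some ob) :
    c.mte ≤ ob.mte o :=
  iInf_le_of_le o (iInf₂_le ob ho)

theorem Prog.ObjGood.adv {S : ℕ → Prop} {b : Bool} {c : Conf K nf} (hc : c.WF P)
    (hn : ¬ ∃ d, DStep P sol c d) {x : ℝ} (hx : 0 ≤ x)
    (hlt : ∀ u, 0 ≤ u → u < x → ENNReal.ofReal u < c.mte) {o : ℕ} {ob : Obj K nf}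
    (ho : c.objs o = some ob) (hg : P.ObjGood S b o ob) : P.ObjStep S b o (P.advObj ob x) := by
  refine ⟨fun q' hq' hS => ?_, fun q' hq' hS => ?_⟩
  · obtain ⟨q, ha, rfl⟩ := Option.map_eq_some_iff.1 hq'
    rw [Proc.fid_advActive] at hS
    have hq := hg.1 q ha hS
    refine (hq.adv (hq.blocked hc hn ho ha) hx fun u hu hux => ?_).1
    have := (hlt u hu hux).trans_le (Conf.mte_le ho)
    rwa [Obj.mte, ha] at this
  · obtain ⟨q, hq, rfl⟩ := Multiset.mem_map.1 hq'
    rw [Proc.fid_advQueued] at hS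
    exact .inl ((hg.2 q hq hS).adv x)

theorem Conf.Doomed.adv {c : Conf K nf} (hc : c.WF P) (hn : ¬ ∃ d, DStep P sol c d) {x : ℝ}
    (hx : 0 ≤ x) (hlt : ∀ u, 0 ≤ u → u < x → ENNReal.ofReal u < c.mte) {f : ℕ}
    (hd : c.Doomed P f) : (P.adv c x).Doomed P f := by
  refine ⟨hd.pending, hd.msgs, fun o ob' ho => ?_⟩
  obtain ⟨ob, ho₀, rfl⟩ := P.adv_objs ho
  exact ((hd.good o ob ho₀).adv hc hn hx hlt ho₀).good

/-- Since no discrete step is possible, no guard in the queue of an idle object holds at the start;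
the time bound excludes guards that become true before `x`. -/
theorem Conf.Sound.idle_adv {c : Conf K nf} (hc : c.WF P) (hs : c.Sound P)
    (hn : ¬ ∃ d, DStep P sol c d) {x : ℝ} (hx : 0 ≤ x)
    (hlt : ∀ u, 0 ≤ u → u < x → ENNReal.ofReal u < c.mte) {o : ℕ} {ob : Obj K nf}
    (ho : c.objs o = some ob) (ha : ob.act = none) :
    (P.decl ob.cls).inv (ob.dyn x) ∧ P.Idle ob.cls o (fun u => ob.dyn (x + u))
      (ob.queue.map fun q => q.advQueued x) := by
  have hf := hc.flows o ob ho
  refine (hs.idle o ob ho ha).adv (futs := c.futs) hf.continuousOn hx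
    (fun u hu hux q hq => ?_) fun q hq p g k hcode hg => ?_
  · have := (hlt u hu hux).trans_le (Conf.mte_le ho)
    rw [Obj.mte, ha] at this
    exact this.trans_le (iInf₂_le q hq)
  · obtain ⟨Q, hQ⟩ := Multiset.exists_cons_of_mem hq
    rw [hf.1] at hg
    exact hn ⟨_, .loc c o ob _ ho (.schedAwait ob q Q p g k ha hQ hcode hg)⟩

theorem Conf.Sound.adv {c : Conf K nf} (hc : c.WF P) (hs : c.Sound P)
    (hn : ¬ ∃ d, DStep P sol c d) {x : ℝ} (hx : 0 ≤ x)
    (hlt : ∀ u, 0 ≤ u → u < x → ENNReal.ofReal u < c.mte) :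
    (P.adv c x).Sound P ∨ (P.adv c x).Failed P := by
  by_cases hF : (P.adv c x).Failed P
  · exact .inr hF
  refine .inl ⟨fun o ob' ho' => ?_, fun o ob' ho' ha' => ?_, hs.msgs⟩
  · obtain ⟨ob, ho, rfl⟩ := P.adv_objs ho'
    exact ((hs.good o ob ho).adv hc hn hx hlt ho).good_of_not_failed fun h => hF ⟨o, _, ho', h⟩
  · obtain ⟨ob, ho, rfl⟩ := P.adv_objs ho'
    have ha : ob.act = none := Option.map_eq_none_iff.1 ha'
    exact (hs.idle_adv hc hn hx hlt ho ha).2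

/-- The exceptional alternative is a `duration` that gets stuck exactly at `x`. Its first component
confines this to the last moment of the time step. -/
theorem Conf.Sound.inv_adv {c : Conf K nf} (hc : c.WF P) (hs : c.Sound P)
    (hn : ¬ ∃ d, DStep P sol c d) {x : ℝ} (hx : 0 ≤ x)
    (hlt : ∀ u, 0 ≤ u → u < x → ENNReal.ofReal u < c.mte) {o : ℕ} {ob : Obj K nf}
    (ho : c.objs o = some ob) : (P.decl ob.cls).inv (P.advHeap ob x) ∨
      (¬ ENNReal.ofReal x < c.mte ∧ (P.adv c x).Failed P) := by
  rw [P.advHeap_eq (hc.flows o ob ho) hx]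
  cases ha : ob.act with
  | none => exact .inl (hs.idle_adv hc hn hx hlt ho ha).1
  | some q =>
    have hm : ob.mte o = q.mteBlocked o ob.dyn := by rw [Obj.mte, ha]
    have hq := (hs.good o ob ho).1 q ha trivial
    refine ((hq.adv (hq.blocked hc hn ho ha) hx fun u hu hux =>
      hm ▸ (hlt u hu hux).trans_le (Conf.mte_le ho)).2 rfl).imp_right fun ⟨h₁, h₂⟩ =>
      ⟨fun h => h₁ (hm ▸ h.trans_le (Conf.mte_le ho)), o, P.advObj ob x, ?_, .inl ⟨_, ?_, h₂⟩⟩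
    · exact Option.map_eq_some_iff.2 ⟨ob, ho, rfl⟩
    · exact Option.map_eq_some_iff.2 ⟨q, ha, rfl⟩

/-! # Runs -/

theorem TimeStep.lt_mte {s : ℝ} {c c' : TConf K nf} (h : TimeStep P sol s c c') :
    ∀ u, 0 ≤ u → u < s → ENNReal.ofReal u < c.conf.mte := by
  intro u hu hus
  rw [h.2.2.1]
  exact (ENNReal.ofReal_lt_ofReal_iff (hu.trans_lt hus)).2 hus

theorem TimeStep.conf_eq {s : ℝ} {c c' : TConf K nf} (h : TimeStep P sol s c c') :
    c'.conf = P.adv c.conf s := by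
  rw [h.2.2.2]

theorem Step.wf (hsol : P.Solves sol) {c c' : TConf K nf} (h : Step P sol c c')
    (hc : c.conf.WF P) : c'.conf.WF P := by
  rcases h with ⟨-, h⟩ | ⟨s, h⟩
  · exact h.wf hsol hc
  · rw [h.conf_eq]
    exact hc.adv h.2.1

theorem Step.doomed (hsol : P.Solves sol) {c c' : TConf K nf} (h : Step P sol c c')
    (hc : c.conf.WF P) {f : ℕ} (hd : c.conf.Doomed P f) : c'.conf.Doomed P f := by
  rcases h with ⟨-, h⟩ | ⟨s, h⟩
  · exact h.doomed hsol hc hd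
  · rw [h.conf_eq]
    exact hd.adv hc h.1 h.2.1 h.lt_mte

theorem Step.sound (hv : P.Verified (basicRegions nf)) (hw : P.GuardsWeak) (hsol : P.Solves sol)
    {c c' : TConf K nf} (h : Step P sol c c') (hc : c.conf.WF P) (hs : c.conf.Sound P) :
    c'.conf.Sound P ∨ c'.conf.Failed P := by
  rcases h with ⟨-, h⟩ | ⟨s, h⟩
  · exact h.sound hv hw hsol hc hs
  · rw [h.conf_eq]
    exact hs.adv hc h.1 h.2.1 h.lt_mte

theorem DStep.resolved {c c' : Conf K nf} (h : DStep P sol c c') {f : ℕ}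
    (hf : ∃ v, c.futs f = .resolved v) : ∃ v, c'.futs f = .resolved v := by
  obtain ⟨v, hv⟩ := hf
  have hne : ∀ fid, c.futs fid = .unused → f ≠ fid := by
    rintro fid h rfl
    rw [hv] at h
    cases h
  cases h with
  | loc => exact ⟨v, hv⟩
  | ret o ob ho q e k ha hc =>
    by_cases h : f = q.fid
    · exact ⟨_, by rw [h]; exact Function.update_self ..⟩
    · exact ⟨v, (Function.update_of_ne h _ _).trans hv⟩
  | call o ob ho q x e D m args k fid ha hc hf =>
    exact ⟨v, (Function.update_of_ne (hne fid hf) _ _).trans hv⟩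
  | dispatch => exact ⟨v, hv⟩
  | new o ob ho q x D args k o' fid ha hc ho' hf =>
    exact ⟨v, (Function.update_of_ne (hne fid hf) _ _).trans hv⟩

theorem Step.resolved {c c' : TConf K nf} (h : Step P sol c c') {f : ℕ}
    (hf : ∃ v, c.conf.futs f = .resolved v) : ∃ v, c'.conf.futs f = .resolved v := by
  rcases h with ⟨-, h⟩ | ⟨s, h⟩
  · exact h.resolved hf
  · rw [h.conf_eq]
    exact hf

/-- A finite run repeats its final configuration, so only genuine steps have to be examined. -/
theorem IsRun.preserves {r : ℕ → TConf K nf} (hr : IsRun P sol r) {Q : TConf K nf → Prop}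
    (hQ : ∀ i, Step P sol (r i) (r (i + 1)) → Q (r i) → Q (r (i + 1))) {i j : ℕ} (hij : i ≤ j)
    (hi : Q (r i)) : Q (r j) := by
  induction j, hij using Nat.le_induction with
  | base => exact hi
  | succ j _ ih =>
    rcases hr.2 j with h | ⟨-, h⟩
    · exact hQ j h ih
    · rwa [h]

theorem Prog.wf_init (hsol : P.Solves sol) : (P.initConf sol).conf.WF P := by
  have hobj : ∀ o ob, (P.initConf sol).conf.objs o = some ob →
      o = 0 ∧ ob = P.newObj sol none [] 0 := by
    intro o ob h
    by_cases ho : o = 0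
    · simp only [Prog.initConf, ho, if_true, Option.some.injEq] at h
      exact ⟨ho, h.symm⟩
    · simp [Prog.initConf, ho] at h
  have hmem : ∀ l f, f ∈ fidsAt (P.initConf sol).conf.objs (P.initConf sol).conf.msgs l →
      l = some 0 ∧ f = 0 := by
    intro l f hf
    cases l with
    | none => exact (Multiset.notMem_zero _ hf).elim
    | some o =>
      cases ho : (P.initConf sol).conf.objs o with
      | none => simp [fidsAt, ho] at hf
      | some ob =>
        rw [fidsAt_of_eq ho] at hf
        obtain ⟨rfl, rfl⟩ := hobj o ob ho
        exact ⟨rfl, by simpa [Obj.fids, Prog.newObj] using hf⟩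
  refine ⟨(Set.finite_singleton 0).subset fun o ho => ?_,
    (Set.finite_singleton 0).subset fun f hf => ?_, fun o ob ho => ?_, ⟨fun l => ?_, ?_, ?_⟩⟩
  · by_contra h
    exact ho (if_neg h)
  · by_contra h
    exact hf (if_neg h)
  · obtain ⟨-, rfl⟩ := hobj o ob ho
    exact hsol _ _
  · cases l with
    | none => exact Multiset.nodup_zero
    | some o =>
      cases ho : (P.initConf sol).conf.objs o with
      | none => simp [fidsAt, ho]
      | some ob =>
        rw [fidsAt_of_eq ho]
        obtain ⟨rfl, rfl⟩ := hobj o ob ho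
        simp [Obj.fids, Prog.newObj]
  · intro l f hf
    rw [(hmem l f hf).2]
    rfl
  · intro l l' f h h'
    rw [(hmem l f h).1, (hmem l' f h').1]

theorem Prog.sound_init (hv : P.Verified (basicRegions nf)) (hw : P.GuardsWeak)
    (hsol : P.Solves sol) :
    (P.initConf sol).conf.Sound P ∨ (P.initConf sol).conf.Failed P := by
  by_cases hF : (P.initConf sol).conf.Failed P
  · exact .inr hF
  have hobj : ∀ o ob, (P.initConf sol).conf.objs o = some ob → ob = P.newObj sol none [] 0 := by
    intro o ob h
    by_cases ho : o = 0
    · simp only [Prog.initConf, ho, if_true, Option.some.injEq] at h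
      exact h.symm
    · simp [Prog.initConf, ho] at h
  refine .inl ⟨fun o ob ho => ?_, fun o ob ho ha => ?_,
    fun μ hμ => (Multiset.notMem_zero μ hμ).elim⟩
  · obtain rfl := hobj o ob ho
    exact (Prog.objGood_new hv hw hsol none trivial 0 o).good_of_not_failed
      fun h => hF ⟨o, _, ho, h⟩
  · obtain rfl := hobj o ob ho
    cases ha

theorem IsRun.wf (hsol : P.Solves sol) {r : ℕ → TConf K nf} (hr : IsRun P sol r) (i : ℕ) :
    (r i).conf.WF P := by
  refine hr.preserves (Q := fun c => c.conf.WF P) (fun i h => h.wf hsol) (Nat.zero_le i) ?_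
  rw [hr.1]
  exact P.wf_init hsol

/-- The future of a doomed process stays pending, while local termination makes it resolved at some
index and resolution is permanent. -/
theorem IsRun.not_failed (hsol : P.Solves sol) {r : ℕ → TConf K nf} (hr : IsRun P sol r)
    (ht : LocallyTerminating r) (i : ℕ) : ¬ (r i).conf.Failed P := by
  intro h
  obtain ⟨o, ob, q, ho, hq, hd⟩ := h.doomed (hr.wf hsol i)
  obtain ⟨j, hj⟩ := ht i o ob ho q hq
  -- Both properties are carried to the later of the two indices; the resolution may have an index
  -- before `i`.
  have h₁ := hr.preserves (Q := fun c => c.conf.WF P ∧ c.conf.Doomed P q.fid)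
    (fun i h hc => ⟨h.wf hsol hc.1, h.doomed hsol hc.1 hc.2⟩) (le_max_left i j)
    ⟨hr.wf hsol i, hd⟩
  obtain ⟨v, hv⟩ := hr.preserves (Q := fun c => ∃ v, c.conf.futs q.fid = .resolved v)
    (fun i h => h.resolved) (le_max_right i j) hj
  rw [h₁.2.pending] at hv
  cases hv

theorem IsRun.sound (hv : P.Verified (basicRegions nf)) (hw : P.GuardsWeak) (hsol : P.Solves sol)
    {r : ℕ → TConf K nf} (hr : IsRun P sol r) (ht : LocallyTerminating r) (i : ℕ) :
    (r i).conf.Sound P := by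
  refine hr.preserves (Q := fun c => c.conf.Sound P) (fun i h hs =>
    (h.sound hv hw hsol (hr.wf hsol i) hs).resolve_right (hr.not_failed hsol ht (i + 1)))
    (Nat.zero_le i) ?_
  have h := P.sound_init hv hw hsol
  rw [← hr.1] at h
  exact h.resolve_right (hr.not_failed hsol ht 0)

theorem Final.no_step {c : TConf K nf} (h : Final P sol c) : ¬ ∃ d, DStep P sol c.conf d :=
  fun ⟨d, hd⟩ => h ⟨⟨c.clock, d⟩, .inl ⟨rfl, hd⟩⟩

/-- A finite maximal time elapse would permit a time step. -/
theorem Final.mte_eq_top {c : TConf K nf} (h : Final P sol c) : c.conf.mte = ⊤ := by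
  by_contra hne
  exact h ⟨_, .inr ⟨c.conf.mte.toReal, h.no_step, ENNReal.toReal_nonneg,
    (ENNReal.ofReal_toReal hne).symm, rfl⟩⟩

/-- Strictly inside a time step, or in a final configuration, `x` is below the maximal time elapse.
At the end of a step the exceptional alternative would make the next configuration failed. -/
theorem Conf.Sound.inv_of_elapses {r : ℕ → TConf K nf} {i : ℕ} (hc : (r i).conf.WF P)
    (hs : (r i).conf.Sound P) (hnf : ¬ (r (i + 1)).conf.Failed P) {x : ℝ}
    (hx : Elapses P sol r i x) {o : ℕ} {ob : Obj K nf} (ho : (r i).conf.objs o = some ob) :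
    (P.decl ob.cls).inv (P.advHeap ob x) := by
  obtain ⟨hx, ⟨s, hst, hxs⟩ | hfin⟩ := hx
  · refine (hs.inv_adv hc hst.1 hx (fun u hu hux => hst.lt_mte u hu (hux.trans_le hxs))
      ho).resolve_right fun ⟨h₁, h₂⟩ => ?_
    rcases hxs.eq_or_lt with rfl | hlt
    · rw [hst.conf_eq] at hnf
      exact hnf h₂
    · exact h₁ (hst.lt_mte x hx hlt)
  · have hlt : ∀ u : ℝ, ENNReal.ofReal u < (r i).conf.mte := fun u => by
      rw [hfin.mte_eq_top]
      exact ENNReal.ofReal_lt_top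
    exact (hs.inv_adv hc hfin.no_step hx (fun u _ _ => hlt u) ho).resolve_right
      fun h => h.1 (hlt x)

/-- Verification with basic regions is sound. -/
theorem Prog.Verified.safe (hv : P.Verified (basicRegions nf)) (hw : P.GuardsWeak)
    (hsol : P.Solves sol) : P.Safe sol := by
  intro D r hr _ ht i
  have hs := hr.sound hv hw hsol ht i
  have hc := hr.wf hsol i
  refine ⟨fun o ob ho _ => ⟨fun ha => ?_, fun x hx => ?_, ?_⟩, fun μ hμ hD d hd => ?_⟩
  · have := (hs.idle o ob ho ha).1
    rwa [(hc.flows o ob ho).1] at this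
  · exact hs.inv_of_elapses hc (hr.not_failed hsol ht (i + 1)) hx ho
  · intro q m d e k ha hm hd hcode
    have h : P.CodeGood ob.cls q.meth o false ob.dyn q.loc q.code := (hs.good o ob ho).1 q ha trivial
    rw [hcode] at h
    obtain ⟨t, r, -, -, h⟩ := h.ok_of_head (hc.flows o ob ho) rfl
    have := h m d hm hd
    rwa [Expr.eval_trans] at this
  · subst hD
    exact hs.msgs μ hμ d hd

end

/-! # Failed checks are kept -/

section
variable {n : ℕ}

/-- The formula does not depend on `cll`. -/
def Fml.CllFree (φ : Fml n) : Prop :=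
  ∀ σ r, φ.Holds (Function.update σ .cll r) ↔ φ.Holds σ

/-- Every transition is also possible after `cll` has been set to `r`. -/
def HP.Keeps (r : ℝ) (α : HP n) : Prop :=
  ∀ σ σ', α.Rel σ σ' → α.Rel (Function.update σ .cll r) (Function.update σ' .cll r)

namespace Fml.CllFree

theorem tru : (Fml.tru (n := n)).CllFree := fun _ _ => by simp

theorem neg {φ : Fml n} (h : φ.CllFree) : Fml.CllFree (.neg φ) :=
  fun σ r => not_congr (h σ r)

theorem conj {φ ψ : Fml n} (h : φ.CllFree) (h' : ψ.CllFree) : Fml.CllFree (.conj φ ψ) :=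
  fun σ r => and_congr (h σ r) (h' σ r)

/-- Both directions come from transporting transitions. For the second one `cll` is set back to its
original value, which is why `Keeps` is required for every value. -/
theorem box {α : HP n} {φ : Fml n} (hα : ∀ r, α.Keeps r) (h : φ.CllFree) :
    Fml.CllFree (.box α φ) := by
  intro σ r
  constructor
  · intro hb σ' hσ
    exact (h σ' r).1 (hb _ (hα r _ _ hσ))
  · intro hb σ' hσ
    have := hα (σ .cll) _ _ hσ
    rw [Function.update_idem, Function.update_eq_self] at this
    exact (h σ' (σ .cll)).1 (hb _ this)

theorem bexpr (b : BExpr (PVar n)) : b.trans.CllFree := by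
  intro σ r
  simp [BExpr.holds_trans_state]

theorem guard (g : Guard n) : g.trans.CllFree := by
  cases g with
  | diff b => exact bexpr b
  | _ => exact tru

theorem limit (g : Guard n) : g.limit.CllFree := by
  cases g with
  | diff b => exact bexpr _
  | _ => exact tru

theorem args {a : ℕ} (R : (Fin a → ℝ) → Prop) (as : List (Expr (PVar n))) :
    Fml.CllFree (.pred a R fun i => argTerm as i) := by
  intro σ r
  simp [argTerm, Expr.eval_trans_state]

theorem inv {K : Type} (c : ClassDecl K n) : c.invFml.CllFree := by
  intro σ r
  simp [fieldVar]

end Fml.CllFree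

/-- `cll` is frozen during an evolution and occurs neither in the right-hand sides nor in the
domain, so overwriting it along the whole curve gives another evolution. -/
theorem ClassDecl.keeps_flow {K : Type} (c : ClassDecl K n) {ψ : Fml n} (h : ψ.CllFree) (r : ℝ) :
    (c.flow ψ).Keeps r := by
  rintro σ σ' ⟨u, φ, hu, h₀, h₁, hφ⟩
  refine ⟨u, fun s => Function.update (φ s) .cll r, hu,
    congrArg (Function.update · .cll r) h₀, congrArg (Function.update · .cll r) h₁, fun s hs => ?_⟩
  obtain ⟨hd, ho, hc⟩ := hφ s hs
  refine ⟨(h _ _).2 hd, fun p hp => ?_, fun x hx => ?_⟩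
  · have hp' := ho p hp
    rcases List.mem_cons.1 hp with rfl | hp
    · simpa [Expr.eval] using hp'
    · obtain ⟨i, -, hi⟩ := List.mem_filterMap.1 hp
      obtain ⟨e, he, rfl⟩ := Option.map_eq_some_iff.1 hi
      simpa [Expr.eval_rename, fieldVar] using hp'
  · by_cases hxc : x = .cll
    · subst hxc; simp
    · simpa [hxc] using hc x hx

namespace HP.Keeps
variable {r : ℝ} {α β : HP n}

theorem assign {x : DVar n} (hx : x ≠ .cll) {a : Term n}
    (ha : ∀ σ, a.eval (Function.update σ .cll r) = a.eval σ) : HP.Keeps r (.assign x a) := by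
  intro σ σ' h
  refine (HP.rel_assign _ _ _ _).2 ?_
  rw [(HP.rel_assign _ _ _ _).1 h, ha, Function.update_comm hx.symm]

theorem any {x : DVar n} (hx : x ≠ .cll) : HP.Keeps r (.any x) := by
  rintro σ σ' ⟨v, rfl⟩
  exact ⟨v, Function.update_comm hx _ _ _⟩

theorem choice (h : α.Keeps r) (h' : β.Keeps r) : HP.Keeps r (.choice α β) :=
  fun σ σ' => Or.imp (h σ σ') (h' σ σ')

theorem seq (h : α.Keeps r) (h' : β.Keeps r) : HP.Keeps r (.seq α β) :=
  fun _ _ ⟨_, h₁, h₂⟩ => ⟨_, h _ _ h₁, h' _ _ h₂⟩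

theorem star (h : α.Keeps r) : HP.Keeps r (.star α) :=
  fun _ _ hs => Relation.ReflTransGen.lift (r := α.Rel) (p := α.Rel)
    (fun σ : Val n => Function.update σ .cll r) h _ _ hs

theorem test {φ : Fml n} (h : ∀ σ, φ.Holds σ → φ.Holds (Function.update σ .cll r)) :
    HP.Keeps r (.test φ) := by
  rintro σ σ' ⟨rfl, hφ⟩
  exact ⟨rfl, h _ hφ⟩

theorem test_of_cllFree {φ : Fml n} (h : φ.CllFree) : HP.Keeps r (.test φ) :=
  test fun σ => (h σ r).2

theorem skip : (HP.skip (n := n)).Keeps r := test_of_cllFree .tru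

theorem seqs {l : List (HP n)} (h : ∀ α ∈ l, α.Keeps r) : (HP.seqs l).Keeps r := by
  induction l with
  | nil => exact skip
  | cons α l ih =>
    exact seq (h α (by simp)) (ih fun β hβ => h β (by simp [hβ]))

/-- Here the value 1 matters: `fail` overwrites `cll`, so no other value would survive. -/
theorem fail : (HP.fail (n := n)).Keeps 1 := by
  intro σ σ' h
  rw [HP.rel_fail] at h ⊢
  rw [h]

theorem check {φ : Fml n} (h : φ.CllFree) : (HP.check φ).Keeps 1 :=
  choice (test_of_cllFree h) (seq (test_of_cllFree h.neg) fail)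

theorem anyLhs (x : Option (Lhs n)) : (HP.anyLhs x).Keeps r := by
  cases x with
  | none => exact skip
  | some x => exact any (by simp)

theorem havoc : (HP.havoc (n := n)).Keeps r := by
  refine seqs fun α hα => ?_
  obtain ⟨i, -, rfl⟩ := List.mem_map.1 hα
  exact any (by simp [fieldVar])

theorem havocPh {K : Type} (c : ClassDecl K n) : c.havocPh.Keeps r := by
  refine seqs fun α hα => ?_
  obtain ⟨i, -, rfl⟩ := List.mem_map.1 hα
  exact any (by simp [fieldVar])

end HP.Keeps

theorem Fml.CllFree.pr {K : Type} (c : ClassDecl K n) {ψ : Fml n} (h : ψ.CllFree) :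
    (c.pr ψ).CllFree :=
  .conj (.inv c) (.box (fun r => .seq (.assign (by simp) fun _ => rfl) (c.keeps_flow h r)) (.inv c))

end

section
variable {K : Type} {nf : K → ℕ}

theorem Fml.CllFree.callPre (P : Prog K nf) {n : ℕ} (C : K) (m : ℕ)
    (args : List (Expr (PVar n))) : (P.callPre C m args).CllFree := by
  unfold Prog.callPre
  split
  · exact .tru
  · exact .args _ _

/-- Once the flag is raised, translated code can still do everything it could do before. The only
test that mentions `cll` is the one after a successful `await` check, and setting `cll` to 1 makes
it true. -/
theorem Prog.keeps_trans (P : Prog K nf) (C : Option K) (s : Stmt K (nfo nf C)) :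
    (P.trans (basicRegions nf) C s).Keeps 1 := by
  induction s with
  | skip => exact .skip
  | seq s₁ s₂ ih₁ ih₂ => exact .seq ih₁ ih₂
  | ite b s₁ s₂ ih₁ ih₂ =>
    exact .choice (.seq (.test_of_cllFree (.bexpr b)) ih₁)
      (.seq (.test_of_cllFree (.neg (.bexpr b))) ih₂)
  | loop b s ih =>
    exact .seq (.star (.seq (.test_of_cllFree (.bexpr b)) ih)) (.test_of_cllFree (.neg (.bexpr b)))
  | await p g =>
    have hφ : ((P.decl C).pr (.conj Fml.tru g.limit)).CllFree := .pr _ (.conj .tru (.limit g))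
    refine .choice (.seq (.test_of_cllFree hφ) (.seq .havoc (.seq (.test fun σ h => ?_) .skip)))
      (.seq (.test_of_cllFree hφ.neg) (.seq .fail (.seq .havoc
        (.seq (.test_of_cllFree (.guard g)) .skip))))
    exact ⟨(Fml.CllFree.guard g σ 1).2 h.1, (Fml.holds_disj _ _ _).2
      (.inr ((Fml.holds_cllOne _).2 (Function.update_self ..)))⟩
  | assign x e =>
    cases e with
    | expr e =>
      cases x with
      | none => exact .skip
      | some x => exact .assign (by simp) fun σ => by simp [Expr.eval_trans_state]
    | new D args =>
      rw [P.trans_new]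
      exact .seq (.check (.args _ _)) (.anyLhs x)
    | get e =>
      rw [P.trans_get]
      have hφ : ((P.decl C).pr Fml.tru).CllFree := .pr _ .tru
      exact .choice (.seq (.test_of_cllFree hφ) (.seq (.havocPh _) (.seq
          (.test_of_cllFree (.inv _)) (.seq (.anyLhs x) .skip))))
        (.seq (.test_of_cllFree hφ.neg) (.seq .fail (.seq (.havocPh _)
          (.seq (.anyLhs x) .skip))))
    | call e D m args =>
      rw [P.trans_call]
      exact .seq (.check (.callPre P D m args)) (.anyLhs x)
  | duration e =>
    have hdom : Fml.CllFree (n := nfo nf C) (.le (.var .t) e.trans) := fun σ r => by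
      simp [Expr.eval_trans_state, Expr.eval]
    have hdom' : Fml.CllFree (n := nfo nf C) (.le e.trans (.var .t)) := fun σ r => by
      simp [Expr.eval_trans_state, Expr.eval]
    exact .seq (.assign (by simp) fun _ => rfl) (.seq (.check (.pr _ hdom))
      (.seq (.assign (by simp) fun _ => rfl) (.seq ((P.decl C).keeps_flow hdom 1)
        (.seq (.test_of_cllFree hdom') .skip))))

/-! # Programs that differ in their code -/

/-- At most the code of the method differs. -/
def SameSpec {n : ℕ} (o o' : Option (MethDecl K n)) : Prop :=
  (o = none ∧ o' = none) ∨
    ∃ d s e, o = some d ∧ o' = some { d with body := s, ret := e }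

/-- The programs differ only in their code and in the method `C.m`. -/
structure Prog.Agree (P P' : Prog K nf) (C : K) (m : ℕ) : Prop where
  cls : ∀ D, ∃ s M, P'.cls D = { P.cls D with ctor := s, meths := M }
  meths : ∀ D m', ¬ (D = C ∧ m' = m) → SameSpec ((P.cls D).meths m') ((P'.cls D).meths m')

namespace Prog.Agree
variable {P P' : Prog K nf} {C : K} {m : ℕ} (h : P.Agree P' C m)
include h

theorem ode_eq (D : Option K) : (P'.decl D).ode = (P.decl D).ode := by
  cases D with
  | none => rfl
  | some D =>
    obtain ⟨s, M, hc⟩ := h.cls D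
    change (P'.cls D).ode = (P.cls D).ode
    rw [hc]

theorem inv_eq (D : Option K) : (P'.decl D).inv = (P.decl D).inv := by
  cases D with
  | none => rfl
  | some D =>
    obtain ⟨s, M, hc⟩ := h.cls D
    change (P'.cls D).inv = (P.cls D).inv
    rw [hc]

theorem solves {sol : SolFun nf} (hsol : P.Solves sol) : P'.Solves sol := by
  intro D ρ
  rw [h.ode_eq]
  exact hsol D ρ

theorem newPre_eq {n : ℕ} (D : K) (args : List (Expr (PVar n))) :
    P'.newPre D args = P.newPre D args := by
  obtain ⟨s, M, hc⟩ := h.cls D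
  unfold Prog.newPre
  rw [hc]

theorem callPre_eq {n : ℕ} {D : K} {m' : ℕ} (hne : ¬ (D = C ∧ m' = m))
    (args : List (Expr (PVar n))) : P'.callPre D m' args = P.callPre D m' args := by
  unfold Prog.callPre
  rcases h.meths D m' hne with ⟨h₁, h₂⟩ | ⟨d, s, e, h₁, h₂⟩ <;> rw [h₁, h₂]

theorem pr_eq (D : Option K) (ψ : Fml (nfo nf D)) : (P'.decl D).pr ψ = (P.decl D).pr ψ := by
  simp only [ClassDecl.pr, ClassDecl.invFml, ClassDecl.flow, h.ode_eq, h.inv_eq]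

theorem trans_eq (D : Option K) (s : Stmt K (nfo nf D)) (hs : ¬ s.Calls C m) :
    P'.trans (basicRegions nf) D s = P.trans (basicRegions nf) D s := by
  induction s with
  | skip => rfl
  | seq s₁ s₂ ih₁ ih₂ =>
    have hs := not_or.1 hs
    simp only [Prog.trans, ih₁ hs.1, ih₂ hs.2]
  | ite b s₁ s₂ ih₁ ih₂ =>
    have hs := not_or.1 hs
    simp only [Prog.trans, ih₁ hs.1, ih₂ hs.2]
  | loop b s ih => simp only [Prog.trans, ih hs]
  | await p g => simp only [Prog.trans, h.pr_eq, ClassDecl.invFml, h.inv_eq]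
  | assign x e =>
    cases e with
    | expr e => cases x <;> rfl
    | new E args => rw [P.trans_new, P'.trans_new, h.newPre_eq]
    | get e =>
      simp only [trans_get, h.pr_eq, ClassDecl.invFml, ClassDecl.havocPh, h.inv_eq, h.ode_eq]
    | call e E m' args => rw [P.trans_call, P'.trans_call, h.callPre_eq hs]
  | duration e => simp only [Prog.trans, h.pr_eq, ClassDecl.flow, h.ode_eq]

end Prog.Agree

/-! # Transfer of proof obligations -/

/-- Every final state of `β` is a final state of `α`, up to a failed check. -/
def HP.Covers {n : ℕ} (α β : HP n) : Prop :=
  ∀ σ σ', β.Rel σ σ' → α.Rel σ σ' ∨ α.Rel σ (Function.update σ' .cll 1)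

/-- The obligation with the translated constructor block as a parameter. Contract and code can thus
be varied independently. -/
noncomputable def ClassDecl.initObligation {n : ℕ} (c : ClassDecl K n) (α : HP n) : Fml n :=
  Fml.impl (.conj (.pred c.arity c.pre fun i => .var (locVar i)) Fml.cllZero)
    (.box (.seq (HP.seqs ((List.finRange n).map fun i =>
      .assign (fieldVar i) ((c.init i).rename fun j : Fin _ => locVar j.val))) α)
      (.conj Fml.cllZero (c.pr Fml.tru)))

noncomputable def ClassDecl.methObligation {n : ℕ} (c : ClassDecl K n) (d : MethDecl K n)
    (α : HP n) : Fml n :=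
  Fml.impl
    (.conj c.invFml (.conj (.pred d.arity d.pre fun i => .var (locVar i)) Fml.cllZero))
    (.box (.seq α (.assign .result d.ret.trans))
      (.conj Fml.cllZero
        (.conj
          (.pred (n + 1) (fun v => d.post (fun i => v i.succ) (v 0))
            (Fin.cons (.var .result) fun i => .var (fieldVar i)))
          (c.pr Fml.tru))))

theorem Prog.oblInit_eq (P : Prog K nf) (D : K) : P.oblInit (basicRegions nf) D =
    (P.cls D).initObligation (P.trans (basicRegions nf) (some D) (P.cls D).ctor) := rfl

theorem Fml.not_cllZero_update {n : ℕ} (σ : Val n) :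
    ¬ Fml.cllZero.Holds (Function.update σ .cll 1) := by
  simp

/-- If the simulating execution ends with `cll = 1`, the obligation for `α` is contradicted; so only
faithful simulations remain. -/
theorem ClassDecl.initObligation_mono {n : ℕ} {c : ClassDecl K n} {α β : HP n}
    (hαβ : α.Covers β) (h : (c.initObligation α).Valid) : (c.initObligation β).Valid := by
  intro σ
  refine (Fml.holds_impl _ _ _).2 fun hpre σ' hσ' => ?_
  obtain ⟨σ₁, h₁, h₂⟩ := hσ'
  have hα := (Fml.holds_impl _ _ _).1 (h σ) hpre
  rcases hαβ _ _ h₂ with h₂ | h₂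
  · exact hα _ ⟨σ₁, h₁, h₂⟩
  · exact (Fml.not_cllZero_update _ (hα _ ⟨σ₁, h₁, h₂⟩).1).elim

theorem ClassDecl.methObligation_mono {n : ℕ} {c : ClassDecl K n} {d : MethDecl K n} {α β : HP n}
    (hαβ : α.Covers β) (h : (c.methObligation d α).Valid) : (c.methObligation d β).Valid := by
  intro σ
  refine (Fml.holds_impl _ _ _).2 fun hpre σ' hσ' => ?_
  obtain ⟨σ₁, h₁, h₂⟩ := hσ'
  have hα := (Fml.holds_impl _ _ _).1 (h σ) hpre
  rcases hαβ _ _ h₁ with h₁ | h₁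
  · exact hα _ ⟨σ₁, h₁, h₂⟩
  · have := hα _ ⟨_, h₁, (HP.rel_assign _ _ _ _).2 rfl⟩
    -- Storing the result does not touch `cll`, so the raised flag is still visible at the end.
    rw [Function.update_comm (by simp)] at this
    exact (Fml.not_cllZero_update _ this.1).elim

theorem Prog.Agree.initObligation_eq {P P' : Prog K nf} {C : K} {m : ℕ} (h : P.Agree P' C m)
    (D : K) (α : HP (nf D)) : (P'.cls D).initObligation α = (P.cls D).initObligation α := by
  obtain ⟨s, M, hc⟩ := h.cls D
  rw [hc]
  rfl

theorem Prog.Agree.methObligation_eq {P P' : Prog K nf} {C : K} {m : ℕ} (h : P.Agree P' C m)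
    (D : K) (d : MethDecl K (nf D)) (α : HP (nf D)) :
    (P'.cls D).methObligation d α = (P.cls D).methObligation d α := by
  obtain ⟨s, M, hc⟩ := h.cls D
  rw [hc]
  rfl

theorem Prog.Agree.classVerified {P P' : Prog K nf} {C : K} {m : ℕ} (h : P.Agree P' C m) {D : K}
    (hD : P.ClassVerified (basicRegions nf) D)
    (hinit : ((P'.cls D).ctor = (P.cls D).ctor ∧ ¬ (P'.cls D).ctor.Calls C m) ∨
      (P'.oblInit (basicRegions nf) D).Valid)
    (hmeth : ∀ m' d, (P'.cls D).meths m' = some d →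
      ((P.cls D).meths m' = some d ∧ ¬ d.body.Calls C m) ∨
      (P'.oblMeth (basicRegions nf) D m' d).Valid) :
    P'.ClassVerified (basicRegions nf) D := by
  refine ⟨?_, fun m' d hd => ?_⟩
  · rcases hinit with ⟨hc, hn⟩ | hinit
    · have hv := hD.1
      rw [P.oblInit_eq, ← hc] at hv
      exact (congrArg Fml.Valid (h.initObligation_eq D _)).mpr (ClassDecl.initObligation_mono
        (fun _ _ hr => .inl (h.trans_eq (some D) _ hn ▸ hr)) hv)
    · exact hinit
  · rcases hmeth m' d hd with ⟨hd', hn⟩ | hv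
    · exact (congrArg Fml.Valid (h.methObligation_eq D d _)).mpr (ClassDecl.methObligation_mono
        (fun _ _ hr => .inl (h.trans_eq (some D) _ hn ▸ hr)) (hD.2 m' d hd'))
    · exact hv

theorem Prog.changedCallers_refl (P : Prog K nf) (C : K) (m : ℕ) : P.ChangedCallers P C m := by
  refine ⟨.inl rfl, fun D => ⟨⟨_, _, rfl⟩, .inl rfl, fun m' => ?_⟩⟩
  cases (P.cls D).meths m' with
  | none => trivial
  | some d => exact .inl rfl

/-! # Removal of a method -/

section
variable [DecidableEq K]

/-- Erasing a call omits a check. The original code performs the same execution, possibly with the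
flag raised from that point on; failures are propagated through the rest by `Prog.keeps_trans`. -/
theorem Prog.Agree.covers {P P' : Prog K nf} {C : K} {m : ℕ} (h : P.Agree P' C m) (D : Option K)
    (s : Stmt K (nfo nf D)) : (P.trans (basicRegions nf) D s).Covers
      (P'.trans (basicRegions nf) D (s.eraseCalls C m)) := by
  induction s with
  | skip => exact fun _ _ => .inl
  | seq s₁ s₂ ih₁ ih₂ =>
    rintro σ σ' ⟨σ₁, h₁, h₂⟩
    rcases ih₁ _ _ h₁ with h₁ | h₁ <;> rcases ih₂ _ _ h₂ with h₂ | h₂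
    · exact .inl ⟨_, h₁, h₂⟩
    · exact .inr ⟨_, h₁, h₂⟩
    -- The first part is matched only with raised flag, so the second part is repeated from there.
    · exact .inr ⟨_, h₁, P.keeps_trans D s₂ _ _ h₂⟩
    · have := P.keeps_trans D s₂ _ _ h₂
      rw [Function.update_idem] at this
      exact .inr ⟨_, h₁, this⟩
  | ite b s₁ s₂ ih₁ ih₂ =>
    rintro σ σ' (⟨σ₁, h₁, h₂⟩ | ⟨σ₁, h₁, h₂⟩)
    · exact (ih₁ _ _ h₂).imp (fun h => .inl ⟨_, h₁, h⟩) fun h => .inl ⟨_, h₁, h⟩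
    · exact (ih₂ _ _ h₂).imp (fun h => .inr ⟨_, h₁, h⟩) fun h => .inr ⟨_, h₁, h⟩
  | loop b s ih =>
    rintro σ σ' ⟨σ₁, h₁, h₂⟩
    have hstep : ∀ σ σ', HP.Rel (.seq (.test b.trans)
        (P'.trans (basicRegions nf) D (s.eraseCalls C m))) σ σ' →
        HP.Rel (.seq (.test b.trans) (P.trans (basicRegions nf) D s)) σ σ' ∨
        HP.Rel (.seq (.test b.trans) (P.trans (basicRegions nf) D s)) σ
          (Function.update σ' .cll 1) :=
      fun σ σ' ⟨σ₁, h₁, h₂⟩ => (ih _ _ h₂).imp (fun h => ⟨_, h₁, h⟩) fun h => ⟨_, h₁, h⟩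
    have hkeep : HP.Keeps 1 (.seq (.test b.trans) (P.trans (basicRegions nf) D s)) :=
      .seq (.test_of_cllFree (.bexpr b)) (P.keeps_trans D s)
    -- Induction on the number of iterations; after the first failure all later iterations are
    -- repeated with raised flag.
    have hstar : HP.Rel (.star (.seq (.test b.trans) (P.trans (basicRegions nf) D s))) σ σ₁ ∨
        HP.Rel (.star (.seq (.test b.trans) (P.trans (basicRegions nf) D s))) σ
          (Function.update σ₁ .cll 1) := by
      clear h₂
      induction h₁ with
      | refl => exact .inl .refl
      | tail _ h₂ ih =>
        rcases ih with ih | ih <;> rcases hstep _ _ h₂ with h₂ | h₂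
        · exact .inl (.tail ih h₂)
        · exact .inr (.tail ih h₂)
        · exact .inr (.tail ih (hkeep _ _ h₂))
        · have := hkeep _ _ h₂
          rw [Function.update_idem] at this
          exact .inr (.tail ih this)
    have hneg : Fml.CllFree (.neg b.trans) := .neg (.bexpr b)
    rcases hstar with hs | hs
    · exact .inl ⟨_, hs, h₂⟩
    · exact .inr ⟨_, hs, HP.Keeps.test_of_cllFree hneg _ _ h₂⟩
  | await p g => exact fun _ _ hr => .inl (h.trans_eq D (.await p g) id ▸ hr)
  | duration e => exact fun _ _ hr => .inl (h.trans_eq D (.duration e) id ▸ hr)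
  | assign x e =>
    cases e with
    | call e E m' args =>
      by_cases hE : E = C ∧ m' = m
      · intro σ σ' hr
        have : (Stmt.assign x (.call e E m' args)).eraseCalls C m = .skip := if_pos hE
        rw [this] at hr
        obtain rfl := (HP.rel_skip _ _).1 hr
        -- The call may assign to its target the value that is there already, and so imitate `skip`.
        have hany : ∀ σ : Val (nfo nf D), (HP.anyLhs x).Rel σ σ := fun σ => by
          cases x with
          | none => exact (HP.rel_skip _ _).2 rfl
          | some x => exact ⟨_, (Function.update_eq_self _ _).symm⟩
        rw [P.trans_call]
        by_cases hφ : (P.callPre E m' args).Holds σ'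
        · exact .inl ⟨_, (HP.rel_check _ _ _).2 (.inl ⟨rfl, hφ⟩), hany _⟩
        · exact .inr ⟨_, (HP.rel_check _ _ _).2 (.inr ⟨hφ, rfl⟩), hany _⟩
      · have : (Stmt.assign x (.call e E m' args)).eraseCalls C m =
            .assign x (.call e E m' args) := if_neg hE
        rw [this]
        exact fun _ _ hr => .inl (h.trans_eq D (.assign x (.call e E m' args)) hE ▸ hr)
    | expr e => exact fun _ _ hr => .inl (h.trans_eq D (.assign x (.expr e)) id ▸ hr)
    | new E args => exact fun _ _ hr => .inl (h.trans_eq D (.assign x (.new E args)) id ▸ hr)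
    | get e => exact fun _ _ hr => .inl (h.trans_eq D (.assign x (.get e)) id ▸ hr)

theorem Stmt.GuardsWeak.eraseCalls {n : ℕ} {s : Stmt K n} (h : s.GuardsWeak) (C : K) (m : ℕ) :
    (s.eraseCalls C m).GuardsWeak := by
  induction s with
  | seq s₁ s₂ ih₁ ih₂ => exact ⟨ih₁ h.1, ih₂ h.2⟩
  | ite b s₁ s₂ ih₁ ih₂ => exact ⟨ih₁ h.1, ih₂ h.2⟩
  | loop b s ih => exact ih h
  | assign x e =>
    cases e with
    | call e E m' args =>
      unfold Stmt.eraseCalls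
      split <;> trivial
    | _ => exact h
  | _ => exact h

theorem Prog.removeMethod_meths {P : Prog K nf} {C : K} {m : ℕ} {D : K} {m' : ℕ}
    {d : MethDecl K (nf D)} (h : ((P.removeMethod C m).cls D).meths m' = some d) :
    ∃ d', (P.cls D).meths m' = some d' ∧ { d' with body := d'.body.eraseCalls C m } = d := by
  change (if D = C ∧ m' = m then none
    else ((P.cls D).meths m').map fun d => { d with body := d.body.eraseCalls C m }) = some d at h
  split at h
  · cases h
  · exact Option.map_eq_some_iff.1 h

theorem Prog.agree_removeMethod (P : Prog K nf) (C : K) (m : ℕ) :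
    P.Agree (P.removeMethod C m) C m := by
  refine ⟨fun D => ⟨_, _, rfl⟩, fun D m' hne => ?_⟩
  have he : ((P.removeMethod C m).cls D).meths m' =
      ((P.cls D).meths m').map fun d => { d with body := d.body.eraseCalls C m } := if_neg hne
  rw [he]
  cases (P.cls D).meths m' with
  | none => exact .inl ⟨rfl, rfl⟩
  | some d => exact .inr ⟨d, _, d.ret, rfl, rfl⟩

theorem Prog.GuardsWeak.removeMethod {P : Prog K nf} (h : P.GuardsWeak) (C : K) (m : ℕ) :
    (P.removeMethod C m).GuardsWeak := by
  refine ⟨h.1.eraseCalls C m, fun D => ⟨(h.2 D).1.eraseCalls C m, fun m' d hd => ?_⟩⟩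
  obtain ⟨d', hd', rfl⟩ := Prog.removeMethod_meths hd
  exact ((h.2 D).2 m' d' hd').eraseCalls C m

theorem Prog.ClassVerified.removeMethod {P : Prog K nf} {D : K}
    (h : P.ClassVerified (basicRegions nf) D) (C : K) (m : ℕ) :
    (P.removeMethod C m).ClassVerified (basicRegions nf) D := by
  have ha := P.agree_removeMethod C m
  refine ⟨?_, fun m' d hd => ?_⟩
  · exact ClassDecl.initObligation_mono (ha.covers (some D) (P.cls D).ctor) h.1
  · obtain ⟨d', hd', rfl⟩ := Prog.removeMethod_meths hd
    exact ClassDecl.methObligation_mono (ha.covers (some D) d'.body) (h.2 m' d' hd')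

theorem Prog.Verified.removeMethod {P : Prog K nf} (h : P.Verified (basicRegions nf)) (C : K)
    (m : ℕ) : (P.removeMethod C m).Verified (basicRegions nf) := by
  refine ⟨fun σ => (Fml.holds_impl _ _ _).2 fun hσ σ' hr => ?_, fun D => (h.2 D).removeMethod C m⟩
  have hmain := (Fml.holds_impl _ _ _).1 (h.1 σ) hσ
  rcases (P.agree_removeMethod C m).covers none P.main _ _ hr with hr | hr
  · exact hmain _ hr
  · exact (Fml.not_cllZero_update _ (hmain _ hr)).elim

/-! # Addition of a method -/

theorem Prog.addMethod_meths_self (P : Prog K nf) (C : K) (m : ℕ) (d : MethDecl K (nf C)) :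
    ((P.addMethod C m d).cls C).meths m = some d := by
  simp [Prog.addMethod]

theorem Prog.addMethod_meths_of_ne (P : Prog K nf) {C : K} {m : ℕ} (d : MethDecl K (nf C)) {D : K}
    {m' : ℕ} (h : ¬ (D = C ∧ m' = m)) :
    ((P.addMethod C m d).cls D).meths m' = (P.cls D).meths m' := by
  by_cases hD : D = C
  · subst hD
    have hm : m' ≠ m := fun hm => h ⟨rfl, hm⟩
    simp [Prog.addMethod, hm]
  · simp [Prog.addMethod, hD]

theorem Prog.addMethod_cls (P : Prog K nf) (C : K) (m : ℕ) (d : MethDecl K (nf C)) (D : K) :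
    ∃ M, (P.addMethod C m d).cls D = { P.cls D with meths := M } := by
  by_cases hD : D = C
  · subst hD
    exact ⟨_, Function.update_self ..⟩
  · exact ⟨(P.cls D).meths, Function.update_of_ne hD _ _⟩

theorem Prog.addMethod_ctor (P : Prog K nf) (C : K) (m : ℕ) (d : MethDecl K (nf C)) (D : K) :
    ((P.addMethod C m d).cls D).ctor = (P.cls D).ctor := by
  obtain ⟨M, h⟩ := P.addMethod_cls C m d D
  rw [h]

theorem Prog.GuardsWeak.addMethod {P : Prog K nf} (h : P.GuardsWeak) (C : K) (m : ℕ)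
    {d : MethDecl K (nf C)} (hd : d.body.GuardsWeak) : (P.addMethod C m d).GuardsWeak := by
  refine ⟨h.1, fun D => ⟨by rw [P.addMethod_ctor]; exact (h.2 D).1, fun m' d' hd' => ?_⟩⟩
  by_cases hD : D = C ∧ m' = m
  · obtain ⟨rfl, rfl⟩ := hD
    rw [P.addMethod_meths_self] at hd'
    cases hd'
    exact hd
  · rw [P.addMethod_meths_of_ne d hD] at hd'
    exact (h.2 D).2 m' d' hd'

/-! ### Changed callers of an added method -/

section
variable {P P' : Prog K nf} {C : K} {m : ℕ} {d : MethDecl K (nf C)}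
  (h : (P.addMethod C m d).ChangedCallers P' C m)
include h

theorem Prog.ChangedCallers.meths_of_ne {D : K} {m' : ℕ} (hne : ¬ (D = C ∧ m' = m)) :
    ((P.cls D).meths m' = none ∧ (P'.cls D).meths m' = none) ∨
      ∃ d₀ d', (P.cls D).meths m' = some d₀ ∧ (P'.cls D).meths m' = some d' ∧
        (d' = d₀ ∨ (d'.body.Calls C m ∧ ∃ s e, d' = { d₀ with body := s, ret := e })) := by
  have hm := (h.2 D).2.2 m'
  rw [P.addMethod_meths_of_ne d hne] at hm
  cases h₁ : (P.cls D).meths m' <;> cases h₂ : (P'.cls D).meths m' <;> rw [h₁, h₂] at hm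
  · exact .inl ⟨rfl, rfl⟩
  · exact hm.elim
  · exact hm.elim
  · exact .inr ⟨_, _, rfl, rfl, hm⟩

theorem Prog.ChangedCallers.agree : P.Agree P' C m := by
  refine ⟨fun D => ?_, fun D m' hne => ?_⟩
  · obtain ⟨s, M, hc⟩ := (h.2 D).1
    obtain ⟨M', hc'⟩ := P.addMethod_cls C m d D
    rw [hc'] at hc
    exact ⟨s, M, hc⟩
  · rcases h.meths_of_ne hne with ⟨h₁, h₂⟩ | ⟨d₀, d', h₁, h₂, rfl | ⟨-, s, e, rfl⟩⟩
    · exact .inl ⟨h₁, h₂⟩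
    · exact .inr ⟨d', d'.body, d'.ret, h₁, h₂⟩
    · exact .inr ⟨d₀, s, e, h₁, h₂⟩

/-- Code that calls `C.m` has a valid obligation by hypothesis; code that does not call it is
unchanged, and its translation is the same in both programs. -/
theorem Prog.ChangedCallers.classVerified
    (hC : ∀ d', (P'.cls C).meths m = some d' → (P'.oblMeth (basicRegions nf) C m d').Valid) {D : K}
    (hD : P.ClassVerified (basicRegions nf) D)
    (hcall : P'.CallersVerified (basicRegions nf) C m D) :
    P'.ClassVerified (basicRegions nf) D := by
  refine h.agree.classVerified hD ?_ fun m' d' hd' => ?_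
  · by_cases hc : (P'.cls D).ctor.Calls C m
    · exact .inr (hcall.1 hc)
    · exact .inl ⟨((h.2 D).2.1.resolve_right hc).trans (P.addMethod_ctor C m d D), hc⟩
  · by_cases hc : d'.body.Calls C m
    · exact .inr (hcall.2 m' d' hd' hc)
    -- The added method itself has no counterpart in `P`; if it is not recursive, its obligation
    -- comes from `hC` and not from the callers.
    · by_cases hne : D = C ∧ m' = m
      · obtain ⟨rfl, rfl⟩ := hne
        exact .inr (hC d' hd')
      · rcases h.meths_of_ne hne with ⟨-, h₂⟩ | ⟨d₀, d₁, h₁, h₂, h₃⟩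
        · rw [h₂] at hd'
          cases hd'
        · obtain rfl : d₁ = d' := Option.some.inj (h₂.symm.trans hd')
          exact .inl ⟨h₁.trans (congrArg some (h₃.resolve_right fun h => hc h.1).symm), hc⟩

theorem Prog.ChangedCallers.verified
    (hC : ∀ d', (P'.cls C).meths m = some d' → (P'.oblMeth (basicRegions nf) C m d').Valid)
    (hv : P.Verified (basicRegions nf))
    (hcall : ∀ D, P'.CallersVerified (basicRegions nf) C m D)
    (hmain : P'.main.Calls C m → (P'.oblMain (basicRegions nf)).Valid) :
    P'.Verified (basicRegions nf) := by
  refine ⟨?_, fun D => h.classVerified hC (hv.2 D) (hcall D)⟩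
  by_cases hc : P'.main.Calls C m
  · exact hmain hc
  · have he : P'.main = P.main := h.1.resolve_right hc
    have := hv.1
    rw [Prog.oblMain, ← he] at this
    rw [Prog.oblMain, h.agree.trans_eq none _ hc]
    exact this

end

/-- When the old code does not call `C.m`, its only possible caller is the new method itself, by
recursion. -/
theorem Prog.callersVerified_addMethod {P : Prog K nf} {C : K} {m : ℕ} {d : MethDecl K (nf C)}
    (hP : ¬ P.Calls C m)
    (hC : ((P.addMethod C m d).oblMeth (basicRegions nf) C m d).Valid) (D : K) :
    (P.addMethod C m d).CallersVerified (basicRegions nf) C m D := by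
  refine ⟨fun hc => ?_, fun m' d' hd' hc => ?_⟩
  · rw [P.addMethod_ctor] at hc
    exact (hP (.inr ⟨D, .inl hc⟩)).elim
  · by_cases hD : D = C ∧ m' = m
    · obtain ⟨rfl, rfl⟩ := hD
      rw [P.addMethod_meths_self] at hd'
      cases hd'
      exact hC
    · rw [P.addMethod_meths_of_ne d hD] at hd'
      exact (hP (.inr ⟨D, .inr ⟨m', d', hd', hc⟩⟩)).elim

end

end

theorem mainTheorem9 {K : Type} [DecidableEq K] {nf : K → ℕ} (P : Prog K nf)
    (hweak : P.GuardsWeak) (sol : SolFun nf) (hsol : P.Solves sol) (C : K) (m : ℕ) :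
    -- removal of a method
    ((∀ D, P.ClassVerified (basicRegions nf) D →
        (P.removeMethod C m).ClassVerified (basicRegions nf) D) ∧
      (P.Verified (basicRegions nf) →
        (P.removeMethod C m).Verified (basicRegions nf) ∧ (P.removeMethod C m).Safe sol)) ∧
    -- addition of a method
    (∀ d : MethDecl K (nf C), (P.cls C).meths m = none → ¬ P.Calls C m → d.body.GuardsWeak →
      ((P.addMethod C m d).oblMeth (basicRegions nf) C m d).Valid →
      (∀ D, P.ClassVerified (basicRegions nf) D →
        (P.addMethod C m d).ClassVerified (basicRegions nf) D) ∧
      (P.Verified (basicRegions nf) →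
        (P.addMethod C m d).Verified (basicRegions nf) ∧ (P.addMethod C m d).Safe sol)) ∧
    -- addition of a method, together with changes of code that calls it
    (∀ (d : MethDecl K (nf C)) (P' : Prog K nf), (P.cls C).meths m = none →
      (P.addMethod C m d).ChangedCallers P' C m → P'.GuardsWeak →
      (∀ d', (P'.cls C).meths m = some d' → (P'.oblMeth (basicRegions nf) C m d').Valid) →
      (∀ D, P.ClassVerified (basicRegions nf) D →
        P'.CallersVerified (basicRegions nf) C m D →
        P'.ClassVerified (basicRegions nf) D) ∧
      (P.Verified (basicRegions nf) →
        (∀ D, P'.CallersVerified (basicRegions nf) C m D) →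
        (P'.main.Calls C m → (P'.oblMain (basicRegions nf)).Valid) →
        P'.Verified (basicRegions nf) ∧ P'.Safe sol)) := by
  refine ⟨⟨fun D hD => hD.removeMethod C m, fun hv => ?_⟩, fun d _ hP hd hC => ?_,
    fun d P' _ h hw hC => ?_⟩
  · have hv' := hv.removeMethod C m
    exact ⟨hv', hv'.safe (hweak.removeMethod C m) ((P.agree_removeMethod C m).solves hsol)⟩
  -- Plain addition is the case of changed callers in which no code is changed.
  · have h := (P.addMethod C m d).changedCallers_refl C m
    have hcall := Prog.callersVerified_addMethod hP hC
    have hC' : ∀ d', ((P.addMethod C m d).cls C).meths m = some d' →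
        ((P.addMethod C m d).oblMeth (basicRegions nf) C m d').Valid := fun d' hd' => by
      rw [P.addMethod_meths_self] at hd'
      cases hd'
      exact hC
    refine ⟨fun D hD => h.classVerified hC' hD (hcall D), fun hv => ?_⟩
    have hv' := h.verified hC' hv hcall fun hc => (hP (.inl hc)).elim
    exact ⟨hv', hv'.safe (hweak.addMethod C m hd) (h.agree.solves hsol)⟩
  · refine ⟨fun D hD hcall => h.classVerified hC hD hcall, fun hv hcall hmain => ?_⟩
    have hv' := h.verified hC hv hcall hmain
    exact ⟨hv', hv'.safe hw (h.agree.solves hsol)⟩
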